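/- Let $n\ge 3$ be odd, $\mathcal T=\langle x,y,z\rangle\cong\mathbb Z^3$ embedded in $\mathbb R^3$ by $x^ay^bz^c\mapsto a\hat x+b\hat y+c\hat z$, and $R=\mathbb Z_n[x^\pm,y^\pm,z^\pm]$ with antipode $\bar r$. Throughout, $(\mu,\nu,\rho)$ is a cyclic permutation of $(x,y,z)$, $d_\mu=1-\mu$, $d_{\mu\nu}=d_\mu d_\nu$, $f_\mu=1+\mu$, $g_\mu=\nu+\rho$, $\Delta=1-t$. **Definitions.** A $p$-theory consists of $\mathcal T$, its embedding $\eta$, a finitely generated $R$-module $S$ of exponent $n$ (superselection sectors) in which $0$ is the only element with stabilizer group $\cong\mathbb Z^3$, and, for each orientation $a$ of planons (elements with stabilizer group $\cong\mathbb Z^2$, the orientation being the real span of that group under $\eta$), a unit normal $\hat n_a$ and a biadditive, translation invariant, local form $\langle\cdot,\cdot\rangle_a:S_a\times S\to\mathbb Z_n$, symmetric on $S_a$, where $S_a$ is generated by the $a$-oriented planons. It is $p$-modular if every $x\ne0$ has $\langle p,x\rangle_a\neq0$ for some $a$ and some $p\in S_a$. Isomorphisms preserve all these data; the stack $P_1\ominus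 P_2$ has $S=S_1\oplus S_2$ and the sum of the forms. A Pauli code with $q$ qudits per cell is given by its excitation map $\epsilon:R^{2q}\to R^{k}$ (first $q$ columns for $Z$, last $q$ for $X$), and its $p$-theory has $S=\operatorname{coker}\epsilon$, with $\langle p,x\rangle_a$ the phase for moving $p$ around a large loop, counterclockwise about $\hat n_a$, in the presence of $x$. A constraint map $\omega$ from a direct sum $Q=\bigoplus_\mu Q_\mu$ of free $\mathbb Z_n[t^\pm]$-modules (where $\mu$ acts on $Q_\mu$ as $t$, and $\nu,\rho$ act trivially) and anti-linear statistics $\Phi_\mu:\ker\omega|_{Q_\mu}\to Q_\mu^*$ give a $p$-theory with $S=\ker\omega$, normals $\hat x,\hat y,\hat z$, and $\langle p,x\rangle_\mu$ the constant coefficient of $\Phi_\mu(p)$ evaluated on the $Q_\mu$-component of $x$. Define in this way: * $P^\mu_{\rm An}$: generators $\mathbf q^s_\nu,\mathbf q^s_\rho$ ($s\in\{e,m\}$); $\omega$: $\mathbf q^e_\nu\mapsto\mathbf r^e_\nu$, $\mathbf q^e_\rho\mapsto-\mathbf r^e_\nu$, $\mathbf q^m_\nu,\mathbf q^m_\rho\mapsto\mathbf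 r^m_\rho$; for $\mu'\in\{\nu,\rho\}$, $\Phi_{\mu'}$: $\Delta\mathbf q^e_{\mu'}\mapsto\mathbf q^{m*}_{\mu'}$, $\bar\Delta\mathbf q^m_{\mu'}\mapsto\mathbf q^{e*}_{\mu'}$. * $P_{\rm Ch}$: generators $\mathbf q^s_{\mu0},\mathbf q^s_{\mu1}$; $\omega$: $\mathbf q^s_{\mu0}\mapsto\mathbf r^s_\nu-\mathbf r^s_\rho$, $\mathbf q^s_{\mu1}\mapsto\mathbf r^s_\mu$; $\Phi_\mu$: $\Delta\mathbf q^e_{\mu0}\mapsto\mathbf q^{m*}_{\mu1}$, $\bar\Delta\mathbf q^m_{\mu1}\mapsto\mathbf q^{e*}_{\mu0}$, $\bar\Delta\mathbf q^e_{\mu1}\mapsto-\mathbf q^{m*}_{\mu0}$, $\Delta\mathbf q^m_{\mu0}\mapsto-\mathbf q^{e*}_{\mu1}$. The $\mu$-anisotropic code is $\epsilon^\mu_{\rm An}=\begin{pmatrix}0&0&-d_\mu&d_{\nu\rho}\\-\bar d_{\nu\rho}&-\bar d_\mu&0&0\end{pmatrix}$. The (coarse-grained) checkerboard code is $\epsilon_{\rm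 Ch}=\operatorname{diag}\big((M\,|\,-N),(M\,|\,N)\big)$ with $$M=\begin{pmatrix}1&1&1&1\\\overline{yz}&1&\bar y&\bar z\\\overline{zx}&\bar x&1&\bar z\\\overline{xy}&\bar x&\bar y&1\end{pmatrix},\qquad N=\begin{pmatrix}1&yz&zx&xy\\1&1&x&x\\1&y&1&y\\1&z&z&1\end{pmatrix}.$$ Let $u=\operatorname{diag}(u_1,u_2)$ and $v=\operatorname{diag}(v_1,v_2)$, where $$u_1=\begin{pmatrix}1&0&0&0\\-\frac12&-\frac12&\frac12&\frac12\\-\frac12&\frac12&-\frac12&\frac12\\-\frac12&\frac12&\frac12&-\frac12\end{pmatrix},\qquad u_2=\begin{pmatrix}2&0&0&0\\-1&-yz&zx&xy\\-1&yz&-zx&xy\\-1&yz&zx&-xy\end{pmatrix},$$ $$v_1=\begin{pmatrix}2&0&0&0&0&0&0&0\\2&1&0&0&0&0&\bar f_z&\bar f_y\\2&0&1&0&0&\bar f_z&0&\bar f_x\\2&0&0&1&0&\bar f_y&\bar f_x&0\\2&1&1&1&1&\bar g_x&\bar g_y&\bar g_z\\2\overline{yz}&0&0&0&0&2\overline{yz}&0&0\\2\overline{zx}&0&0&0&0&0&2\overline{zx}&0\\2\overline{xy}&0&0&0&0&0&0&2\overline{xy}\end{pmatrix},$$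 $$v_2=\begin{pmatrix}\frac12&\frac12g_x&\frac12g_y&\frac12g_z&-1&-\frac12&-\frac12&-\frac12\\0&1&0&0&-1&0&0&0\\0&0&1&0&-1&0&0&0\\0&0&0&1&-1&0&0&0\\0&0&0&0&1&0&0&0\\0&0&-\frac12\overline{yz}f_z&-\frac12\overline{yz}f_y&\overline{yz}&\frac12\overline{yz}&0&0\\0&-\frac12\overline{zx}f_z&0&-\frac12\overline{zx}f_x&\overline{zx}&0&\frac12\overline{zx}&0\\0&-\frac12\overline{xy}f_y&-\frac12\overline{xy}f_x&0&\overline{xy}&0&0&\frac12\overline{xy}\end{pmatrix}.$$ **Theorem.** 1. $P_{\rm Ch}$ and $P^x_{\rm An},P^y_{\rm An},P^z_{\rm An}$ are $p$-modular $p$-theories and are the $p$-theories of the codes $\epsilon_{\rm Ch}$ and $\epsilon^\mu_{\rm An}$; the stack below is defined, and $P_{\rm Ch}\cong P^x_{\rm An}\ominus P^y_{\rm An}\ominus P^z_{\rm An}$. 2. $u$ is invertible and $v$ is symplectic; composed with the translation by $x^2y^2z^2$ of one species of qudits (the first, which is an ancilla after the transformation), $v$ is a product of elementary symplectic gates (controlled-NOT,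 controlled-phase, Hadamard, and rescalings by units of $\mathbb Z_n$). Moreover $u\,\epsilon_{\rm Ch}\,v=\operatorname{diag}(T_1,T_2)$ with $$T_1=\begin{pmatrix}0&0&0&0&-1&0&0&0\\0&-\bar d_x&0&0&0&\bar d_{yz}&0&0\\0&0&-\bar d_y&0&0&0&\bar d_{zx}&0\\0&0&0&-\bar d_z&0&0&0&\bar d_{xy}\end{pmatrix},\quad T_2=\begin{pmatrix}1&0&0&0&0&0&0&0\\0&-d_{yz}&0&0&0&-d_x&0&0\\0&0&-d_{zx}&0&0&0&-d_y&0\\0&0&0&-d_{xy}&0&0&0&-d_z\end{pmatrix},$$ which, up to labelling and signs of the stabilizers and of the qudit operators, is the excitation map of three decoupled anisotropic codes $\epsilon^x_{\rm An},\epsilon^y_{\rm An},\epsilon^z_{\rm An}$ plus two ancilla qudits per unit cell. 3. Hence $\epsilon_{\rm Ch}$ is related to three decoupled anisotropic codes plus two ancilla qudits per unit cell by a translation-invariant finite-depth Clifford circuit (acting on Pauli operators modulo phases), up to an invertible change of basis of the stabilizers. -/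

import Mathlib

noncomputable section

namespace Fracton

open scoped Classical

/-! ### Translation group rings -/

/-- Physical space. -/
abbrev Space : Type := EuclideanSpace ℝ (Fin 3)

/-- The group ring `ℤ_n G` of a translation group `G` (written additively). -/
abbrev GroupRing (n : ℕ) (G : Type) [AddCommGroup G] : Type := AddMonoidAlgebra (ZMod n) G

section GroupRing

variable {n : ℕ} {G : Type} [AddCommGroup G]

/-- The translation `g`, as an element of the group ring. -/
def mono (n : ℕ) (g : G) : GroupRing n G := AddMonoidAlgebra.single g 1

/-- The scalar `c ∈ ℤ_n`, as an element of the group ring. -/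
def scalar (G : Type) [AddCommGroup G] (c : ZMod n) : GroupRing n G :=
  AddMonoidAlgebra.single 0 c

/-- The antipode `r ↦ r̄`, which sends each `g` to `g⁻¹`. -/
def antipode : GroupRing n G →+* GroupRing n G :=
  AddMonoidAlgebra.mapDomainRingHom (ZMod n) (negAddMonoidHom : G →+ G)

end GroupRing

/-! ### p-theories of excitations -/

/-- The data of a `p`-theory with translation group `G` and embedding `η : G → ℝ³`: the module
`S` of superselection sectors, a normal vector for each orientation of planons and a mutual
statistics form for each orientation. An orientation is a linear subspace of `ℝ³`; only the values
of `normal a` at the orientations `a` of planons, and of `form a p x` at `p ∈ S_a`, have a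
meaning. The laws are stated in `PTheory.IsPTheory`. -/
structure PTheory (n : ℕ) (G : Type) [AddCommGroup G] (η : G →+ Space) where
  S : Type
  [addCommGroup : AddCommGroup S]
  [module : Module (GroupRing n G) S]
  normal : Submodule ℝ Space → Space
  form : Submodule ℝ Space → S → S → ZMod n

attribute [instance] PTheory.addCommGroup PTheory.module

namespace PTheory

variable {n : ℕ} {G : Type} [AddCommGroup G] {η : G →+ Space}

/-- The stabilizer group of a superselection sector under translations. -/
def stab (P : PTheory n G η) (x : P.S) : AddSubgroup G where
  carrier := {g | mono n g • x = x}
  zero_mem' := by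
    change (1 : GroupRing n G) • x = x
    exact one_smul _ x
  add_mem' := by
    intro g h hg hh
    have hgh : mono n (g + h) = mono n g * mono n h := by
      simp [mono, AddMonoidAlgebra.single_mul_single]
    change mono n (g + h) • x = x
    rw [hgh, mul_smul, hh, hg]
  neg_mem' := by
    intro g hg
    have hgg : mono n (-g) * mono n g = 1 := by
      simp [mono, AddMonoidAlgebra.single_mul_single, AddMonoidAlgebra.one_def]
    change mono n (-g) • x = x
    calc mono n (-g) • x = mono n (-g) • (mono n g • x) := by rw [hg]
      _ = x := by rw [← mul_smul, hgg, one_smul]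

/-- `x` is a planon: its stabilizer group is isomorphic to `ℤ²`. -/
def IsPlanon (P : PTheory n G η) (x : P.S) : Prop :=
  Nonempty (P.stab x ≃+ (Fin 2 → ℤ))

/-- `x` is fully mobile: its stabilizer group is isomorphic to `ℤ³`. -/
def IsFullyMobile (P : PTheory n G η) (x : P.S) : Prop :=
  Nonempty (P.stab x ≃+ (Fin 3 → ℤ))

/-- The orientation of an excitation: the real span of its stabilizer group. -/
def orientation (P : PTheory n G η) (x : P.S) : Submodule ℝ Space :=
  Submodule.span ℝ (η '' (P.stab x : Set G))

/-- The set `A` of orientations of planons. -/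
def orientations (P : PTheory n G η) : Set (Submodule ℝ Space) :=
  {a | ∃ p, P.IsPlanon p ∧ P.orientation p = a}

/-- The submodule `S_a` generated by the `a`-oriented planons. -/
def planons (P : PTheory n G η) (a : Submodule ℝ Space) : Submodule (GroupRing n G) P.S :=
  Submodule.span _ {p | P.IsPlanon p ∧ P.orientation p = a}

/-- The laws of a `p`-theory of excitations. -/
structure IsPTheory (P : PTheory n G η) : Prop where
  lattice : ∃ b : Module.Basis (Fin 3) ℤ G, LinearIndependent ℝ (fun i => η (b i))
  finite : Module.Finite (GroupRing n G) P.S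
  exponent : AddMonoid.exponent P.S = n
  not_mobile : ∀ x, P.IsFullyMobile x → x = 0
  normal_spec : ∀ a ∈ P.orientations, ‖P.normal a‖ = 1 ∧ ∀ v ∈ a, inner ℝ (P.normal a) v = 0
  translation : ∀ a ∈ P.orientations, ∀ p ∈ P.planons a, ∀ x, ∀ g : G,
    P.form a (mono n g • p) (mono n g • x) = P.form a p x
  add_left : ∀ a ∈ P.orientations, ∀ p ∈ P.planons a, ∀ q ∈ P.planons a, ∀ x,
    P.form a (p + q) x = P.form a p x + P.form a q x
  add_right : ∀ a ∈ P.orientations, ∀ p ∈ P.planons a, ∀ x y,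
    P.form a p (x + y) = P.form a p x + P.form a p y
  symm : ∀ a ∈ P.orientations, ∀ p ∈ P.planons a, ∀ q ∈ P.planons a, P.form a p q = P.form a q p
  locality : ∀ a ∈ P.orientations, ∀ p ∈ P.planons a, ∀ x, ∀ g : G,
    (∀ i : ℤ, mono n (i • g) • p = p → i = 0) →
    ∃ m : ℤ, ∀ i : ℤ, m ≤ |i| → P.form a (mono n (i • g) • p) x = 0

/-- `p`-modularity: every non-zero superselection sector is detected by some planon. -/
def IsPModular (P : PTheory n G η) : Prop :=
  ∀ x : P.S, x ≠ 0 → ∃ a ∈ P.orientations, ∃ p ∈ P.planons a, P.form a p x ≠ 0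

/-- The condition under which the stack of two `p`-theories (with the same `G` and `η`) is defined:
the normal vectors agree at the common orientations. -/
def Stackable (P₁ P₂ : PTheory n G η) : Prop :=
  ∀ a, a ∈ P₁.orientations → a ∈ P₂.orientations → P₁.normal a = P₂.normal a

/-- The stack of two `p`-theories. -/
def stack (P₁ P₂ : PTheory n G η) : PTheory n G η where
  S := P₁.S × P₂.S
  normal a := if a ∈ P₁.orientations then P₁.normal a else P₂.normal a
  form a p x :=
    (if a ∈ P₁.orientations then P₁.form a p.1 x.1 else 0) +
      (if a ∈ P₂.orientations then P₂.form a p.2 x.2 else 0)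

/-- Isomorphism of `p`-theories. As `η₂ ∘ αG = η₁`, the map `αS` preserves orientations, so the
sets of planon orientations of the two theories coincide. -/
def Isomorphic {G₁ G₂ : Type} [AddCommGroup G₁] [AddCommGroup G₂] {η₁ : G₁ →+ Space}
    {η₂ : G₂ →+ Space} (P₁ : PTheory n G₁ η₁) (P₂ : PTheory n G₂ η₂) : Prop :=
  ∃ (αG : G₁ ≃+ G₂) (αS : P₁.S ≃+ P₂.S),
    (∀ g, η₂ (αG g) = η₁ g) ∧
    (∀ (r : GroupRing n G₁) (x : P₁.S),
      αS (r • x) = AddMonoidAlgebra.mapDomainRingHom (ZMod n) (αG : G₁ →+ G₂) r • αS x) ∧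
    P₁.orientations = P₂.orientations ∧
    ∀ a ∈ P₁.orientations, P₁.normal a = P₂.normal a ∧
      ∀ p ∈ P₁.planons a, ∀ x, P₁.form a p x = P₂.form a (αS p) (αS x)

end PTheory

/-! ### p-theories given by constraint map and planon mutual statistics -/

/-- The lattice `ℤ³ = ⟨x, y, z⟩` of translations. -/
abbrev Lattice : Type := Fin 3 → ℤ

/-- The coordinate vectors of `ℝ³`. -/
def axis (μ : Fin 3) : Space := EuclideanSpace.single μ 1

/-- The embedding `x^a y^b z^c ↦ a x̂ + b ŷ + c ẑ`. -/
def embed : Lattice →+ Space where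
  toFun g := WithLp.toLp 2 (fun i => (g i : ℝ))
  map_zero' := by ext i; simp
  map_add' g h := by ext i; simp

/-- The coordinate plane through the origin that is orthogonal to the `μ`-axis. -/
def plane (μ : Fin 3) : Submodule ℝ Space := (Submodule.span ℝ {axis μ})ᗮ

/-- The projection `ℤ_n[x^±, y^±, z^±] → ℤ_n[t^±]` that sends `μ` to `t` and the other two
variables to `1`. -/
def proj (n : ℕ) (μ : Fin 3) : GroupRing n Lattice →+* LaurentPolynomial (ZMod n) :=
  AddMonoidAlgebra.mapDomainRingHom (ZMod n) (Pi.evalAddMonoidHom (fun _ : Fin 3 => ℤ) μ)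

/-- The augmentation `ℤ_n[t^±] → ℤ_n`, `t ↦ 1`. -/
def augment (n : ℕ) : LaurentPolynomial (ZMod n) →ₐ[ZMod n] ZMod n :=
  AddMonoidAlgebra.lift (ZMod n) (ZMod n) ℤ 1

/-- The quotient of `p` by `d` in `ℤ_n[t^±]` (zero if `d` does not divide `p`). -/
def divide {n : ℕ} (p d : LaurentPolynomial (ZMod n)) : LaurentPolynomial (ZMod n) :=
  if h : ∃ f, p = f * d then h.choose else 0

/-- `Δ = 1 - t`. -/
def delta (n : ℕ) : LaurentPolynomial (ZMod n) := 1 - mono n (1 : ℤ)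

/-- `Δ̄ = 1 - t⁻¹`. -/
def deltaBar (n : ℕ) : LaurentPolynomial (ZMod n) := 1 - mono n (-1 : ℤ)

/-- A constraint map together with planon mutual statistics. The plane charge module `Q` is free
over `ℤ_n[t^±]` on generators `q_i`, `i ∈ I`, where `μ ∈ {x, y, z}` acts on `q_i` as `t` if
`μ = dir i` and trivially otherwise; the constraint module is `ℤ_n{r_j}` with the trivial action.
* `ω(q_i) = ∑_j constraint i j • r_j`;
* the `divisor i • q_i` with `dir i = μ` are to be a basis of the kernel of `ω` on `Q_μ`;
* `Φ_μ(divisor i • q_i) = ∑_j stat i j • q_j^*`, the sum being over the `j` with `dir j = μ`. -/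
structure PlaneChargeData (n : ℕ) (I J : Type) where
  dir : I → Fin 3
  constraint : I → J → ZMod n
  divisor : I → LaurentPolynomial (ZMod n)
  stat : I → I → LaurentPolynomial (ZMod n)

namespace PlaneChargeData

variable {n : ℕ} {I J : Type}

/-- The plane charge module. -/
def Q (_D : PlaneChargeData n I J) : Type := I → LaurentPolynomial (ZMod n)

instance (D : PlaneChargeData n I J) : AddCommGroup D.Q :=
  inferInstanceAs (AddCommGroup (I → LaurentPolynomial (ZMod n)))

instance (D : PlaneChargeData n I J) : Module (GroupRing n Lattice) D.Q where
  smul r q := fun i => proj n (D.dir i) r * q i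
  one_smul q := by
    funext i
    change proj n (D.dir i) 1 * q i = q i
    rw [map_one, one_mul]
  mul_smul r s q := by
    funext i
    change proj n (D.dir i) (r * s) * q i = proj n (D.dir i) r * (proj n (D.dir i) s * q i)
    rw [map_mul, mul_assoc]
  smul_zero r := by
    funext i
    exact mul_zero (proj n (D.dir i) r)
  smul_add r p q := by
    funext i
    exact mul_add (proj n (D.dir i) r) (p i) (q i)
  add_smul r s q := by
    funext i
    change proj n (D.dir i) (r + s) * q i = proj n (D.dir i) r * q i + proj n (D.dir i) s * q i
    rw [map_add, add_mul]
  zero_smul q := by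
    funext i
    change proj n (D.dir i) 0 * q i = 0
    rw [map_zero, zero_mul]

variable [Fintype I]

/-- The constraint map `ω`. -/
def omega (D : PlaneChargeData n I J) (q : D.Q) : J → ZMod n :=
  fun j => ∑ i, augment n (q i) * D.constraint i j

theorem augment_proj (μ ν : Fin 3) (r : GroupRing n Lattice) :
    augment n (proj n μ r) = augment n (proj n ν r) := by
  induction r using AddMonoidAlgebra.induction_linear with
  | zero => simp
  | add f g hf hg => simp [hf, hg]
  | single g c =>
    simp only [augment, proj, AddMonoidAlgebra.mapDomainRingHom_apply,
      AddMonoidAlgebra.mapDomain_single, AddMonoidAlgebra.lift_single]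
    simp

/-- The module of superselection sectors `S = ker ω ⊆ Q`. -/
def sectors (D : PlaneChargeData n I J) : Submodule (GroupRing n Lattice) D.Q where
  carrier := {q | D.omega q = 0}
  zero_mem' := by
    funext j
    change ∑ i, augment n 0 * D.constraint i j = 0
    simp
  add_mem' := by
    intro p q hp hq
    funext j
    have hpj : ∑ i, augment n (p i) * D.constraint i j = 0 := congrFun hp j
    have hqj : ∑ i, augment n (q i) * D.constraint i j = 0 := congrFun hq j
    change ∑ i, augment n (p i + q i) * D.constraint i j = 0
    simp only [map_add, add_mul, Finset.sum_add_distrib, hpj, hqj, add_zero]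
  smul_mem' := by
    intro r q hq
    funext j
    have hqj : ∑ i, augment n (q i) * D.constraint i j = 0 := congrFun hq j
    change ∑ i, augment n (proj n (D.dir i) r * q i) * D.constraint i j = 0
    have h0 : ∀ i, augment n (proj n (D.dir i) r * q i) * D.constraint i j =
        augment n (proj n 0 r) * (augment n (q i) * D.constraint i j) := by
      intro i
      rw [map_mul, augment_proj (D.dir i) 0, mul_assoc]
    simp only [h0, ← Finset.mul_sum, hqj, mul_zero]

/-- The `ℤ_n[t^±]`-valued statistics `Φ_μ(p)(x)`: if `p = ∑ f_i • (divisor i • q_i)` then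
`Φ_μ(p) = ∑ f_i • stat i j • q_j^*`, and `q_j^*` is the anti-linear map that sends `x` to the
antipode of its `j`-th coordinate. -/
def pairing (D : PlaneChargeData n I J) (μ : Fin 3) (p x : D.Q) : LaurentPolynomial (ZMod n) :=
  ∑ i, ∑ j, if D.dir i = μ ∧ D.dir j = μ then
    divide (p i) (D.divisor i) * D.stat i j * antipode (n := n) (G := ℤ) (x j) else 0

/-- The `p`-theory with the given constraint map and planon mutual statistics, where the normal
vector to the `μ`-plane is `μ̂`. The `ℤ_n`-valued form is the constant coefficient of the
`ℤ_n[t^±]`-valued one. -/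
def toPTheory (D : PlaneChargeData n I J) : PTheory n Lattice embed where
  S := D.sectors
  normal a := ∑ μ, if a = plane μ then axis μ else 0
  form a p x := ∑ μ, if a = plane μ then (D.pairing μ p.1 x.1).coeff 0 else 0

end PlaneChargeData

/-- The two sectors of plane charges. -/
inductive Sector where
  | e : Sector
  | m : Sector
  deriving DecidableEq

instance : Fintype Sector where
  elems := {Sector.e, Sector.m}
  complete := by
    intro s
    cases s <;> simp

/-- The `μ`-anisotropic theory. The directions `x, y, z` are `0, 1, 2` and `(μ, ν, ρ)` is
`(μ, μ + 1, μ + 2)` modulo 3; the generator `(k, s)` is `q_ν^s` if `k = 0` and `q_ρ^s` if `k = 1`;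
the constraint module generators are `r_ν^e` (for `Sector.e`) and `r_ρ^m` (for `Sector.m`). -/
def anisotropicData (n : ℕ) (μ : Fin 3) : PlaneChargeData n (Fin 2 × Sector) Sector where
  dir i := if i.1 = 0 then μ + 1 else μ + 2
  constraint i s :=
    match i.2, s with
    | Sector.e, Sector.e => if i.1 = 0 then 1 else -1
    | Sector.m, Sector.m => 1
    | _, _ => 0
  divisor i :=
    match i.2 with
    | Sector.e => delta n
    | Sector.m => deltaBar n
  stat i j := if i.1 = j.1 ∧ i.2 ≠ j.2 then 1 else 0

/-- The coarse-grained checkerboard theory. The generator `(μ, k, s)` is `q_{μ k}^s` and the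
constraint module generator `(μ, s)` is `r_μ^s`. -/
def checkerboardData (n : ℕ) :
    PlaneChargeData n (Fin 3 × Fin 2 × Sector) (Fin 3 × Sector) where
  dir i := i.1
  constraint i j :=
    if i.2.2 = j.2 then
      if i.2.1 = 0 then
        (if j.1 = i.1 + 1 then 1 else if j.1 = i.1 + 2 then -1 else 0)
      else (if j.1 = i.1 then 1 else 0)
    else 0
  divisor i := if i.2.1 = 0 then delta n else deltaBar n
  stat i j :=
    if i.1 = j.1 ∧ i.2.1 ≠ j.2.1 ∧ i.2.2 ≠ j.2.2 then
      (if i.2 = (0, Sector.e) ∨ i.2 = (1, Sector.m) then 1 else -1)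
    else 0

/-- The `p`-theory of the anisotropic model with lineons mobile along the `μ`-direction. -/
def anisotropicTheory (n : ℕ) (μ : Fin 3) : PTheory n Lattice embed :=
  (anisotropicData n μ).toPTheory

/-- The `p`-theory of the checkerboard model. -/
def checkerboardTheory (n : ℕ) : PTheory n Lattice embed :=
  (checkerboardData n).toPTheory

/-! ### Pauli codes -/

section Codes

variable {n : ℕ} {G : Type} [AddCommGroup G]
variable {ι κ : Type} [Fintype ι] [Fintype κ] [DecidableEq ι] [DecidableEq κ]

/-- The conjugate transpose with respect to the antipode. -/
def dagger {α β : Type} (M : Matrix α β (GroupRing n G)) : Matrix β α (GroupRing n G) :=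
  M.transpose.map antipode

/-- The symplectic form on the Pauli module `R^ι ⊕ R^ι` (`Z`-part first, then `X`-part). -/
def lam (n : ℕ) (G : Type) [AddCommGroup G] (ι : Type) [DecidableEq ι] :
    Matrix (ι ⊕ ι) (ι ⊕ ι) (GroupRing n G) :=
  Matrix.fromBlocks 0 1 (-1) 0

/-- The stabilizer map `σ` of the code with excitation map `ε = σ† λ`. -/
def stabilizerMap (ε : Matrix κ (ι ⊕ ι) (GroupRing n G)) : Matrix (ι ⊕ ι) κ (GroupRing n G) :=
  lam n G ι * dagger ε

/-- `Braids η ε a nrm e φ`: for some large loop in the plane `a`, counterclockwise about `nrm`,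
transporting the excitation pattern `e` around the loop multiplies the state with excitation
pattern `x` by the phase `exp(2πi φ(x) / n)`. Here `s` and `s'` are Pauli operators that
move `e` by the translations `g` and `h`; moving `e` around the elementary parallelogram is the
product `w` of stabilizers, and moving it around a large disc is the product of the translates of
`w` by the elements of `⟨g, h⟩` in the disc. -/
def Braids (η : G →+ Space) (ε : Matrix κ (ι ⊕ ι) (GroupRing n G)) (a : Submodule ℝ Space)
    (nrm : Space) (e : κ → GroupRing n G) (φ : (κ → GroupRing n G) → ZMod n) : Prop :=
  ∃ (g h : G) (s s' : ι ⊕ ι → GroupRing n G) (w : κ → GroupRing n G),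
    η g ∈ a ∧ η h ∈ a ∧
    0 < Matrix.det (Matrix.of fun i j : Fin 3 => (![η g, η h, nrm] i) j) ∧
    ε.mulVec s = (mono n g - 1) • e ∧
    ε.mulVec s' = (mono n h - 1) • e ∧
    (1 - mono n h) • s - (1 - mono n g) • s' = (stabilizerMap ε).mulVec w ∧
    ∀ x, φ x = ∑ᶠ k : ℤ × ℤ,
      (∑ i, antipode (w i) * x i).coeff (k.1 • g + k.2 • h)

/-- `P` is the `p`-theory of the code with excitation map `ε`: its module of superselection sectors
is the cokernel of `ε` and its forms are given by transporting planons around large loops. -/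
def PTheory.IsTheoryOf {η : G →+ Space} (P : PTheory n G η)
    (ε : Matrix κ (ι ⊕ ι) (GroupRing n G)) : Prop :=
  ∃ θ : ((κ → GroupRing n G) ⧸ LinearMap.range ε.mulVecLin) ≃ₗ[GroupRing n G] P.S,
    ∀ a ∈ P.orientations, ∀ e : κ → GroupRing n G, θ (Submodule.Quotient.mk e) ∈ P.planons a →
      Braids η ε a (P.normal a) e
        (fun x => P.form a (θ (Submodule.Quotient.mk e)) (θ (Submodule.Quotient.mk x)))

/-- The decoupled stack of two codes. -/
def stackCodes {ι₁ ι₂ κ₁ κ₂ : Type} (ε₁ : Matrix κ₁ (ι₁ ⊕ ι₁) (GroupRing n G))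
    (ε₂ : Matrix κ₂ (ι₂ ⊕ ι₂) (GroupRing n G)) :
    Matrix (κ₁ ⊕ κ₂) ((ι₁ ⊕ ι₂) ⊕ (ι₁ ⊕ ι₂)) (GroupRing n G) :=
  (Matrix.fromBlocks ε₁ 0 0 ε₂).submatrix id (Equiv.sumSumSumComm ι₁ ι₂ ι₁ ι₂)

/-- `v` is symplectic. -/
def IsSymplectic (v : Matrix (ι ⊕ ι) (ι ⊕ ι) (GroupRing n G)) : Prop :=
  dagger v * lam n G ι * v = lam n G ι

/-- The elementary symplectic gates: controlled-NOT, controlled-phase, Hadamard, and the gates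
that rescale `Z` by `c` and `X` by `c⁻¹` for a unit `c` of `ℤ_n`. -/
inductive IsElementaryGate : Matrix (ι ⊕ ι) (ι ⊕ ι) (GroupRing n G) → Prop
  | cnot (i j : ι) (hij : i ≠ j) (r : GroupRing n G) :
      IsElementaryGate (Matrix.fromBlocks (1 + Matrix.single i j r) 0 0
        (1 - Matrix.single j i (antipode r)))
  | phase (i : ι) (r : GroupRing n G) (hr : antipode r = r) :
      IsElementaryGate (Matrix.fromBlocks 1 0 (Matrix.single i i r) 1)
  | hadamard (i : ι) :
      IsElementaryGate (Matrix.fromBlocks (1 - Matrix.single i i 1) (-Matrix.single i i 1)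
        (Matrix.single i i 1) (1 - Matrix.single i i 1))
  | rescale (i : ι) (c : (ZMod n)ˣ) :
      IsElementaryGate (Matrix.fromBlocks
        (Matrix.diagonal (Function.update 1 i (scalar G (c : ZMod n)))) 0 0
        (Matrix.diagonal (Function.update 1 i (scalar G ((c⁻¹ : (ZMod n)ˣ) : ZMod n)))))

/-- `v` is an elementary symplectic transformation: a product of elementary symplectic gates. -/
def IsElementarySymplectic (v : Matrix (ι ⊕ ι) (ι ⊕ ι) (GroupRing n G)) : Prop :=
  v ∈ Submonoid.closure {w : Matrix (ι ⊕ ι) (ι ⊕ ι) (GroupRing n G) | IsElementaryGate w}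

/-- The translation by `g` of all the qudits of species `i`. -/
def translateQudit (n : ℕ) {G : Type} [AddCommGroup G] {ι : Type} [DecidableEq ι] (i : ι) (g : G) :
    Matrix (ι ⊕ ι) (ι ⊕ ι) (GroupRing n G) :=
  Matrix.fromBlocks (Matrix.diagonal (Function.update 1 i (mono n g))) 0 0
    (Matrix.diagonal (Function.update 1 i (mono n g)))

/-- The `ℤ_n`-valued commutation form of two Pauli operators. -/
def commutation (s s' : ι ⊕ ι → GroupRing n G) : ZMod n :=
  (∑ i, antipode (s i) * (lam n G ι).mulVec s' i).coeff 0

/-- The Pauli operator `s` acts only on the qudits in `A`, where the qudit `(i, g)` is the one of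
species `i` in the unit cell `g`. -/
def SupportedIn (A : Set (ι × G)) (s : ι ⊕ ι → GroupRing n G) : Prop :=
  ∀ i g, (s (Sum.inl i)).coeff g ≠ 0 ∨ (s (Sum.inr i)).coeff g ≠ 0 → (i, g) ∈ A

/-- A layer of a Clifford circuit, through its action on Pauli operators modulo phases: the qudits
are divided into disjoint cells of bounded diameter, and one gate acts on each cell. -/
def IsCircuitLayer (η : G →+ Space)
    (f : (ι ⊕ ι → GroupRing n G) ≃ₗ[ZMod n] (ι ⊕ ι → GroupRing n G)) : Prop :=
  (∀ s s', commutation (f s) (f s') = commutation s s') ∧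
  ∃ (cells : Setoid (ι × G)) (d : ℝ),
    (∀ a b, cells.r a b → dist (η a.2) (η b.2) ≤ d) ∧
    ∀ a s, SupportedIn {b | cells.r a b} s → SupportedIn {b | cells.r a b} (f s)

/-- The matrix `v` is the action on Pauli operators modulo phases of a finite-depth Clifford
circuit. -/
def IsFiniteDepthCircuit (η : G →+ Space) (v : Matrix (ι ⊕ ι) (ι ⊕ ι) (GroupRing n G)) : Prop :=
  ∃ layers : List ((ι ⊕ ι → GroupRing n G) ≃ₗ[ZMod n] (ι ⊕ ι → GroupRing n G)),
    (∀ f ∈ layers, IsCircuitLayer η f) ∧ ∀ s, layers.prod s = v.mulVec s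

/-- Two codes are related by a translation-invariant finite-depth Clifford circuit (`v`), up to an
invertible change of basis of the stabilizers (`u`) and a labelling of the qudits and stabilizers in
the unit cell. -/
def FiniteDepthEquivalent (η : G →+ Space) {ι' κ' : Type}
    (ε : Matrix κ (ι ⊕ ι) (GroupRing n G)) (ε' : Matrix κ' (ι' ⊕ ι') (GroupRing n G)) : Prop :=
  ∃ (eκ : κ' ≃ κ) (eι : ι' ≃ ι) (u : Matrix κ κ (GroupRing n G))
    (v : Matrix (ι ⊕ ι) (ι ⊕ ι) (GroupRing n G)),
    IsUnit u ∧ IsFiniteDepthCircuit η v ∧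
      (u * ε * v).submatrix eκ (Sum.map eι eι) = ε'

/-- Two codes are the same up to labelling of the qudits and stabilizers in the unit cell and up to
replacing some of the stabilizers by their inverses, and the operators `Z, X` of some species of
qudits by `Z⁻¹, X⁻¹`. -/
def SameUpToLabelsAndSigns {ι' κ' : Type}
    (ε : Matrix κ (ι ⊕ ι) (GroupRing n G)) (ε' : Matrix κ' (ι' ⊕ ι') (GroupRing n G)) : Prop :=
  ∃ (eκ : κ' ≃ κ) (eι : ι' ≃ ι) (a : κ → ℤˣ) (b : ι → ℤˣ),
    (Matrix.of fun i j => (((a i : ℤ) * (b (Sum.elim id id j) : ℤ) : ℤ) : GroupRing n G) * ε i j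
      ).submatrix eκ (Sum.map eι eι) = ε'

end Codes

/-! ### The models -/

section Models

variable (n : ℕ)

/-- The Laurent polynomial ring `ℤ_n[x^±, y^±, z^±]`. -/
abbrev R : Type := GroupRing n Lattice

/-- The monomial `x^a y^b z^c`. -/
def mon (a b c : ℤ) : R n := mono n (![a, b, c] : Lattice)

/-- The variables `x, y, z` as `var n 0, var n 1, var n 2`. -/
def var (μ : Fin 3) : R n := mono n (Pi.single μ 1 : Lattice)

/-- `d_μ = 1 - μ`. -/
def dd (μ : Fin 3) : R n := 1 - var n μ

/-- `d_{μν} = (1 - μ)(1 - ν)`. -/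
def dd₂ (μ ν : Fin 3) : R n := dd n μ * dd n ν

/-- The element `1/2` (for odd `n`). -/
def half : R n := scalar Lattice ((2 : ZMod n)⁻¹)

/-- `f_μ = 1 + μ`. -/
def ff (μ : Fin 3) : R n := 1 + var n μ

/-- `g_μ = ν + ρ`. -/
def gg (μ : Fin 3) : R n := var n (μ + 1) + var n (μ + 2)

/-- The excitation map of the anisotropic model with lineons mobile along the `μ`-direction. -/
def anisotropicCode (μ : Fin 3) : Matrix (Fin 2) (Fin 2 ⊕ Fin 2) (R n) :=
  Matrix.of fun i => Sum.elim
    (!![0, 0; -antipode (dd₂ n (μ + 1) (μ + 2)), -antipode (dd n μ)] i)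
    (!![-dd n μ, dd₂ n (μ + 1) (μ + 2); 0, 0] i)

/-- One ancilla qudit per unit cell, with stabilizer `Z`. -/
def ancillaZ : Matrix (Fin 1) (Fin 1 ⊕ Fin 1) (R n) :=
  Matrix.of fun _ => Sum.elim 0 1

/-- One ancilla qudit per unit cell, with stabilizer `X`. -/
def ancillaX : Matrix (Fin 1) (Fin 1 ⊕ Fin 1) (R n) :=
  Matrix.of fun _ => Sum.elim (-1) 0

/-- Two ancilla qudits per unit cell and the three decoupled anisotropic models. -/
def decoupledCode :=
  stackCodes (stackCodes (ancillaX n) (ancillaZ n))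
    (stackCodes (anisotropicCode n 0)
      (stackCodes (anisotropicCode n 1) (anisotropicCode n 2)))

/-- The coarse-grained checkerboard excitation map. -/
def checkerboardCode : Matrix (Fin 4 ⊕ Fin 4) (Fin 8 ⊕ Fin 8) (R n) :=
  Matrix.fromBlocks
    !![1, 1, 1, 1, -1, -mon n 0 1 1, -mon n 1 0 1, -mon n 1 1 0;
       mon n 0 (-1) (-1), 1, mon n 0 (-1) 0, mon n 0 0 (-1), -1, -1, -mon n 1 0 0, -mon n 1 0 0;
       mon n (-1) 0 (-1), mon n (-1) 0 0, 1, mon n 0 0 (-1), -1, -mon n 0 1 0, -1, -mon n 0 1 0;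
       mon n (-1) (-1) 0, mon n (-1) 0 0, mon n 0 (-1) 0, 1, -1, -mon n 0 0 1, -mon n 0 0 1, -1]
    0 0
    !![1, 1, 1, 1, 1, mon n 0 1 1, mon n 1 0 1, mon n 1 1 0;
       mon n 0 (-1) (-1), 1, mon n 0 (-1) 0, mon n 0 0 (-1), 1, 1, mon n 1 0 0, mon n 1 0 0;
       mon n (-1) 0 (-1), mon n (-1) 0 0, 1, mon n 0 0 (-1), 1, mon n 0 1 0, 1, mon n 0 1 0;
       mon n (-1) (-1) 0, mon n (-1) 0 0, mon n 0 (-1) 0, 1, 1, mon n 0 0 1, mon n 0 0 1, 1]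

/-- The stabilizer change of basis. -/
def uMatrix : Matrix (Fin 4 ⊕ Fin 4) (Fin 4 ⊕ Fin 4) (R n) :=
  Matrix.fromBlocks
    !![1, 0, 0, 0;
       -half n, -half n, half n, half n;
       -half n, half n, -half n, half n;
       -half n, half n, half n, -half n]
    0 0
    !![2, 0, 0, 0;
       -1, -mon n 0 1 1, mon n 1 0 1, mon n 1 1 0;
       -1, mon n 0 1 1, -mon n 1 0 1, mon n 1 1 0;
       -1, mon n 0 1 1, mon n 1 0 1, -mon n 1 1 0]

/-- The symplectic transformation. -/
def vMatrix : Matrix (Fin 8 ⊕ Fin 8) (Fin 8 ⊕ Fin 8) (R n) :=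
  Matrix.fromBlocks
    !![2, 0, 0, 0, 0, 0, 0, 0;
       2, 1, 0, 0, 0, 0, antipode (ff n 2), antipode (ff n 1);
       2, 0, 1, 0, 0, antipode (ff n 2), 0, antipode (ff n 0);
       2, 0, 0, 1, 0, antipode (ff n 1), antipode (ff n 0), 0;
       2, 1, 1, 1, 1, antipode (gg n 0), antipode (gg n 1), antipode (gg n 2);
       2 * mon n 0 (-1) (-1), 0, 0, 0, 0, 2 * mon n 0 (-1) (-1), 0, 0;
       2 * mon n (-1) 0 (-1), 0, 0, 0, 0, 0, 2 * mon n (-1) 0 (-1), 0;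
       2 * mon n (-1) (-1) 0, 0, 0, 0, 0, 0, 0, 2 * mon n (-1) (-1) 0]
    0 0
    !![half n, half n * gg n 0, half n * gg n 1, half n * gg n 2, -1, -half n, -half n, -half n;
       0, 1, 0, 0, -1, 0, 0, 0;
       0, 0, 1, 0, -1, 0, 0, 0;
       0, 0, 0, 1, -1, 0, 0, 0;
       0, 0, 0, 0, 1, 0, 0, 0;
       0, 0, -(half n * mon n 0 (-1) (-1) * ff n 2), -(half n * mon n 0 (-1) (-1) * ff n 1),
         mon n 0 (-1) (-1), half n * mon n 0 (-1) (-1), 0, 0;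
       0, -(half n * mon n (-1) 0 (-1) * ff n 2), 0, -(half n * mon n (-1) 0 (-1) * ff n 0),
         mon n (-1) 0 (-1), 0, half n * mon n (-1) 0 (-1), 0;
       0, -(half n * mon n (-1) (-1) 0 * ff n 1), -(half n * mon n (-1) (-1) 0 * ff n 0), 0,
         mon n (-1) (-1) 0, 0, 0, half n * mon n (-1) (-1) 0]

/-- The transformed excitation map. -/
def transformedCode : Matrix (Fin 4 ⊕ Fin 4) (Fin 8 ⊕ Fin 8) (R n) :=
  Matrix.fromBlocks
    !![0, 0, 0, 0, -1, 0, 0, 0;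
       0, -antipode (dd n 0), 0, 0, 0, antipode (dd₂ n 1 2), 0, 0;
       0, 0, -antipode (dd n 1), 0, 0, 0, antipode (dd₂ n 2 0), 0;
       0, 0, 0, -antipode (dd n 2), 0, 0, 0, antipode (dd₂ n 0 1)]
    0 0
    !![1, 0, 0, 0, 0, 0, 0, 0;
       0, -dd₂ n 1 2, 0, 0, 0, -dd n 0, 0, 0;
       0, 0, -dd₂ n 2 0, 0, 0, 0, -dd n 1, 0;
       0, 0, 0, -dd₂ n 0 1, 0, 0, 0, -dd n 2]

end Models

end Fracton

end

open Fracton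

set_option linter.unusedSimpArgs false
set_option linter.unusedSectionVars false

namespace Fracton

open scoped Classical

/-! ### Monomials, scalars and the antipode in the group ring. -/

section GroupRing

variable {n : ℕ} {G : Type} [AddCommGroup G]

/-! The statement has two halves, one about modules with forms and one about matrices, and a bridge
between them.

Modules with forms. In both kinds of theory a translation `g` acts on the coordinate of direction
`μ` as multiplication by `t ^ g μ`, and a nonzero Laurent polynomial is never invariant under a
nontrivial shift. So the stabilizer of a sector only depends on the set of directions in which it
has components (`PlaneChargeData.stab_eq`): planons are the nonzero sectors living in one direction,
and only `0` is fully mobile. The constraint map forces a sector of a single direction to have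
coordinates of augmentation zero, that is, divisible by `Δ`; since `Δ` is not a zero divisor and `Δ
= -t Δ̄`, the quotients in the definition of `Φ` are meaningful. The abstract condition `IsPaired`
collects what is needed (generators paired by an involution, antipodal divisors, signs, independence
of the constraints in each direction) and yields all laws of a p-theory and p-modularity at once.

Each direction `ν` is shared by exactly two of the three anisotropic theories, those with `μ = ν +
2` and `μ = ν + 1` modulo 3, and their plane charges are the sum and the difference of the
checkerboard generators with indices `0` and `1` (with a factor `t` for `e`, to match the divisors).
As `2` is invertible, this change of basis is invertible; it respects the constraints, and in the
sum of the two pairings the cross terms cancel (`sum_pairing_toAnisotropic`). This is the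
isomorphism of p-theories.

Matrices. The identities for `u` and `v` become polynomial identities once the inverse variables and
`1/2` are treated as letters subject to `X X' = 1` and `2 h = 1`. The `Z`-block of `v` has
determinant `16 x⁻²y⁻²z⁻²`, whereas those of controlled-NOT gates and rescalings have determinants
that are units of `ℤ_n`; the translation by `x²y²z²` removes the monomial. After it, the block
factors into unipotent matrices and a diagonal one, and Whitehead's lemma handles the monomials on
the diagonal (`isCssBlock_vTop`). A controlled-NOT with a polynomial coefficient is a product of
monomial ones, each a single layer of two-qudit gates, which gives the finite-depth circuit.

Bridge. For the anisotropic code, the cokernel and the operators that move planons around a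
parallelogram are written down explicitly (`realizes_anisotropic`). The description of a code by
sectors and loops is compatible with stacking, relabelling, change of stabilizer basis and
symplectic maps (`Realizes.stack`, `Realizes.of_transformed`). Hence the theory of the checkerboard
code is not computed directly but transported from the decoupled code, through the circuit on one
side and the isomorphism of p-theories on the other. -/

theorem mono_add (g h : G) : mono n (g + h) = mono n g * mono n h := by
  simp [mono, AddMonoidAlgebra.single_mul_single]

@[simp] theorem mono_zero : mono n (0 : G) = 1 := rfl

theorem mono_mul_mono_neg (g : G) : mono n g * mono n (-g) = 1 := by
  rw [← mono_add, add_neg_cancel, mono_zero]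

@[simp] theorem antipode_mono (g : G) : antipode (mono n g) = mono n (-g) := by
  simp [antipode, mono, AddMonoidAlgebra.mapDomain_single]

@[simp] theorem antipode_single (g : G) (c : ZMod n) :
    antipode (AddMonoidAlgebra.single g c : GroupRing n G) = AddMonoidAlgebra.single (-g) c := by
  simp [antipode, AddMonoidAlgebra.mapDomain_single]

@[simp] theorem antipode_scalar (c : ZMod n) : antipode (scalar G c) = scalar G c := by
  simp [scalar]

@[simp] theorem antipode_antipode (r : GroupRing n G) : antipode (antipode r) = r := by
  induction r using AddMonoidAlgebra.induction_linear with
  | zero => simp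
  | add f g hf hg => simp [hf, hg]
  | single g c => simp

theorem scalar_mul (c d : ZMod n) : scalar G (c * d) = scalar G c * scalar G d := by
  simp [scalar, AddMonoidAlgebra.single_mul_single]

@[simp] theorem scalar_one : scalar G (1 : ZMod n) = 1 := rfl

theorem scalar_two : scalar G (2 : ZMod n) = 2 := by
  have h : scalar G ((1 : ZMod n) + 1) = scalar G 1 + scalar G 1 :=
    AddMonoidAlgebra.single_add ..
  rw [← one_add_one_eq_two, h, scalar_one, one_add_one_eq_two]

theorem scalar_neg_one : scalar G (-1 : ZMod n) = -1 :=
  AddMonoidAlgebra.single_neg ..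

end GroupRing

section Variables

variable (n : ℕ)

/-- The inverse of the variable `μ`. -/
noncomputable def varInv (μ : Fin 3) : R n := mono n (-Pi.single μ 1 : Lattice)

theorem var_mul_varInv (μ : Fin 3) : var n μ * varInv n μ = 1 := mono_mul_mono_neg _

@[simp] theorem antipode_var (μ : Fin 3) : antipode (var n μ) = varInv n μ := antipode_mono _

@[simp] theorem antipode_varInv (μ : Fin 3) : antipode (varInv n μ) = var n μ := by
  rw [← antipode_var, antipode_antipode]

theorem mon_eq (a b c : ℤ) :
    mon n a b c = mono n (Pi.single 0 a) * mono n (Pi.single 1 b) * mono n (Pi.single 2 c) := by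
  rw [← mono_add, ← mono_add, mon]
  congr 1
  ext i
  fin_cases i <;> simp

theorem mono_single_one (μ : Fin 3) : mono n (Pi.single μ 1 : Lattice) = var n μ := rfl

theorem mono_single_neg_one (μ : Fin 3) : mono n (Pi.single μ (-1) : Lattice) = varInv n μ := by
  rw [varInv, Pi.single_neg]

theorem two_mul_half (hn : Odd n) : 2 * half n = 1 := by
  have h2 : IsUnit (2 : ZMod n) := by
    have := (ZMod.isUnit_iff_coprime 2 n).2 (Nat.coprime_two_left.2 hn)
    exact_mod_cast this
  rw [half, ← scalar_two, ← scalar_mul, ZMod.mul_inv_of_unit _ h2, scalar_one]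

end Variables

/-! ### Conjugate transposes of matrices. -/

section Dagger

variable {n : ℕ} {G : Type} [AddCommGroup G] {α β γ : Type}

theorem dagger_mul [Fintype β] (M : Matrix α β (GroupRing n G)) (N : Matrix β γ (GroupRing n G)) :
    dagger (M * N) = dagger N * dagger M := by
  simp only [dagger, Matrix.transpose_mul, Matrix.map_mul]

@[simp] theorem dagger_dagger (M : Matrix α β (GroupRing n G)) : dagger (dagger M) = M := by
  ext i j : 2
  simp [dagger]

@[simp] theorem dagger_zero : dagger (0 : Matrix α β (GroupRing n G)) = 0 := by
  ext i j : 2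
  simp [dagger]

theorem dagger_add (M N : Matrix α β (GroupRing n G)) : dagger (M + N) = dagger M + dagger N := by
  ext i j : 2
  simp [dagger]

@[simp] theorem dagger_one [DecidableEq α] : dagger (1 : Matrix α α (GroupRing n G)) = 1 := by
  ext i j : 2
  simp only [dagger, Matrix.map_apply, Matrix.transpose_apply, Matrix.one_apply, @eq_comm _ j i]
  split_ifs <;> simp

@[simp] theorem dagger_single [DecidableEq α] [DecidableEq β] (i : α) (j : β)
    (r : GroupRing n G) : dagger (Matrix.single i j r) = Matrix.single j i (antipode r) := by
  ext k l : 2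
  simp only [dagger, Matrix.map_apply, Matrix.transpose_apply, Matrix.single_apply,
    and_comm (a := j = k)]
  split_ifs <;> simp

@[simp] theorem dagger_diagonal [DecidableEq α] (f : α → GroupRing n G) :
    dagger (Matrix.diagonal f) = Matrix.diagonal fun i => antipode (f i) := by
  rw [dagger, Matrix.diagonal_transpose, Matrix.diagonal_map (map_zero _)]

theorem dagger_fromBlocks {δ : Type} (A : Matrix α β (GroupRing n G))
    (B : Matrix α δ (GroupRing n G)) (C : Matrix γ β (GroupRing n G))
    (D : Matrix γ δ (GroupRing n G)) :
    dagger (Matrix.fromBlocks A B C D) =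
      Matrix.fromBlocks (dagger A) (dagger C) (dagger B) (dagger D) := by
  simp [dagger, Matrix.fromBlocks_transpose, Matrix.fromBlocks_map]

end Dagger

/-! ### Symplectic matrices and the CSS circuits among them. -/

section Symplectic

variable {n : ℕ} {G : Type} [AddCommGroup G] {ι : Type} [Fintype ι] [DecidableEq ι]

theorem isSymplectic_one : IsSymplectic (1 : Matrix (ι ⊕ ι) (ι ⊕ ι) (GroupRing n G)) := by
  simp [IsSymplectic]

theorem IsSymplectic.mul {v w : Matrix (ι ⊕ ι) (ι ⊕ ι) (GroupRing n G)} (hv : IsSymplectic v)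
    (hw : IsSymplectic w) : IsSymplectic (v * w) := by
  unfold IsSymplectic at *
  calc dagger (v * w) * lam n G ι * (v * w)
      = dagger w * (dagger v * lam n G ι * v) * w := by
        rw [dagger_mul]; simp only [Matrix.mul_assoc]
    _ = lam n G ι := by rw [hv, hw]

/-- The two nonzero blocks of the symplectic condition are conjugate transposes of each other up to
sign, so one of them suffices. -/
theorem isSymplectic_fromBlocks_iff (A B : Matrix ι ι (GroupRing n G)) :
    IsSymplectic (Matrix.fromBlocks A 0 0 B) ↔ dagger A * B = 1 := by
  rw [IsSymplectic, lam, dagger_fromBlocks, Matrix.fromBlocks_multiply, Matrix.fromBlocks_multiply,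
    Matrix.fromBlocks_inj]
  simp only [dagger_zero, Matrix.mul_zero, Matrix.zero_mul, Matrix.mul_one, Matrix.mul_neg,
    Matrix.neg_mul, add_zero, zero_add, neg_zero, true_and, and_true, neg_inj]
  refine ⟨fun h => h.1, fun h => ⟨h, ?_⟩⟩
  simpa [dagger_mul] using congrArg dagger h

theorem lam_mul_lam : lam n G ι * lam n G ι = -1 := by
  rw [lam, Matrix.fromBlocks_multiply, ← Matrix.fromBlocks_one, Matrix.fromBlocks_neg]
  simp

/-- As `λ² = -1`, the matrix `-λ v† λ` is a left inverse of `v`; over a commutative ring it is also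
a right inverse. This form of the condition is the one that acts on stabilizer maps `λ ε†`. -/
theorem IsSymplectic.mul_lam_mul_dagger {v : Matrix (ι ⊕ ι) (ι ⊕ ι) (GroupRing n G)}
    (hv : IsSymplectic v) : v * lam n G ι * dagger v = lam n G ι := by
  unfold IsSymplectic at hv
  have h1 : (-(lam n G ι * dagger v * lam n G ι)) * v = 1 := by
    rw [Matrix.neg_mul, Matrix.mul_assoc, Matrix.mul_assoc, ← Matrix.mul_assoc (dagger v), hv,
      lam_mul_lam, neg_neg]
  have h2 := mul_eq_one_comm.1 h1
  calc v * lam n G ι * dagger v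
      = (v * -(lam n G ι * dagger v * lam n G ι)) * lam n G ι := by
        rw [Matrix.mul_neg, Matrix.neg_mul]
        simp only [Matrix.mul_assoc, lam_mul_lam]
        simp
    _ = lam n G ι := by rw [h2, Matrix.one_mul]

theorem IsSymplectic.commutation {v : Matrix (ι ⊕ ι) (ι ⊕ ι) (GroupRing n G)}
    (hv : IsSymplectic v) (s s' : ι ⊕ ι → GroupRing n G) :
    commutation (v.mulVec s) (v.mulVec s') = commutation s s' := by
  -- Vectors are viewed as one-column matrices, so that the form becomes a product of matrices.
  have key : ∀ s s' : ι ⊕ ι → GroupRing n G, ∑ i, antipode (s i) * (lam n G ι).mulVec s' i =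
      (dagger (Matrix.of fun i (_ : Unit) => s i) * lam n G ι *
        (Matrix.of fun i (_ : Unit) => s' i)) () () := by
    intro s s'
    rw [Matrix.mul_assoc, Matrix.mul_apply]
    rfl
  have hcol : ∀ s : ι ⊕ ι → GroupRing n G, (Matrix.of fun i (_ : Unit) => v.mulVec s i) =
      v * Matrix.of fun i (_ : Unit) => s i := by
    intro s
    rfl
  unfold Fracton.commutation
  rw [key, key, hcol, hcol, dagger_mul]
  unfold IsSymplectic at hv
  have h : dagger (Matrix.of fun i (_ : Unit) => s i) * dagger v * lam n G ι *
      (v * Matrix.of fun i (_ : Unit) => s' i) = dagger (Matrix.of fun i (_ : Unit) => s i) *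
      lam n G ι * Matrix.of fun i (_ : Unit) => s' i := by
    rw [← Matrix.mul_assoc, Matrix.mul_assoc _ (dagger v), Matrix.mul_assoc _ (_ * lam n G ι), hv]
  rw [h]
 
/-- The gates generating the CSS circuits: controlled-NOT and rescalings. -/
inductive IsCssGate : Matrix (ι ⊕ ι) (ι ⊕ ι) (GroupRing n G) → Prop
  | cnot (i j : ι) (hij : i ≠ j) (r : GroupRing n G) :
      IsCssGate (Matrix.fromBlocks (1 + Matrix.single i j r) 0 0
        (1 - Matrix.single j i (antipode r)))
  | rescale (i : ι) (c : (ZMod n)ˣ) :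
      IsCssGate (Matrix.fromBlocks
        (Matrix.diagonal (Function.update 1 i (scalar G (c : ZMod n)))) 0 0
        (Matrix.diagonal (Function.update 1 i (scalar G ((c⁻¹ : (ZMod n)ˣ) : ZMod n)))))

/-- Products of controlled-NOT gates and rescalings. -/
def IsCssCircuit (v : Matrix (ι ⊕ ι) (ι ⊕ ι) (GroupRing n G)) : Prop :=
  v ∈ Submonoid.closure {w : Matrix (ι ⊕ ι) (ι ⊕ ι) (GroupRing n G) | IsCssGate w}

theorem IsCssCircuit.isElementarySymplectic {v : Matrix (ι ⊕ ι) (ι ⊕ ι) (GroupRing n G)}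
    (hv : IsCssCircuit v) : IsElementarySymplectic v := by
  refine Submonoid.closure_mono ?_ hv
  rintro w (⟨i, j, hij, r⟩ | ⟨i, c⟩)
  · exact .cnot i j hij r
  · exact .rescale i c

theorem isSymplectic_cnot {i j : ι} (hij : i ≠ j) (r : GroupRing n G) :
    IsSymplectic (Matrix.fromBlocks (1 + Matrix.single i j r) 0 0
        (1 - Matrix.single j i (antipode r))) := by
  rw [isSymplectic_fromBlocks_iff, dagger_add, dagger_one, dagger_single, Matrix.add_mul,
    Matrix.mul_sub, Matrix.mul_sub, Matrix.single_mul_single_of_ne (h := hij)]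
  simp

theorem isSymplectic_rescale (i : ι) (c : (ZMod n)ˣ) :
    IsSymplectic (Matrix.fromBlocks
        (Matrix.diagonal (Function.update 1 i (scalar G (c : ZMod n)))) 0 0
        (Matrix.diagonal (Function.update 1 i (scalar G ((c⁻¹ : (ZMod n)ˣ) : ZMod n))))) := by
  rw [isSymplectic_fromBlocks_iff, dagger_diagonal, Matrix.diagonal_mul_diagonal,
    ← Matrix.diagonal_one]
  congr 1
  funext k
  by_cases hk : k = i
  · subst hk
    simp [← scalar_mul]
  · simp [hk]

theorem IsCssGate.isSymplectic {v : Matrix (ι ⊕ ι) (ι ⊕ ι) (GroupRing n G)}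
    (hv : IsCssGate v) : IsSymplectic v := by
  obtain ⟨i, j, hij, r⟩ | ⟨i, c⟩ := hv
  · exact isSymplectic_cnot hij r
  · exact isSymplectic_rescale i c

theorem IsCssCircuit.isSymplectic {v : Matrix (ι ⊕ ι) (ι ⊕ ι) (GroupRing n G)}
    (hv : IsCssCircuit v) : IsSymplectic v := by
  induction hv using Submonoid.closure_induction with
  | mem w hw => exact hw.isSymplectic
  | one => exact isSymplectic_one
  | mul v w _ _ hv hw => exact hv.mul hw

/-- `A` is the action on `Z`-type operators of a CSS circuit. -/
def IsCssBlock (A : Matrix ι ι (GroupRing n G)) : Prop :=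
  ∃ B, IsCssCircuit (Matrix.fromBlocks A 0 0 B)

theorem IsCssBlock.mul {A A' : Matrix ι ι (GroupRing n G)} (h : IsCssBlock A)
    (h' : IsCssBlock A') : IsCssBlock (A * A') := by
  obtain ⟨B, hB⟩ := h
  obtain ⟨B', hB'⟩ := h'
  refine ⟨B * B', ?_⟩
  have := Submonoid.mul_mem _ hB hB'
  rw [Matrix.fromBlocks_multiply] at this
  simp only [Matrix.mul_zero, Matrix.zero_mul, add_zero, zero_add] at this
  exact this

theorem isCssBlock_one : IsCssBlock (1 : Matrix ι ι (GroupRing n G)) := by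
  refine ⟨1, ?_⟩
  rw [Matrix.fromBlocks_one]
  exact Submonoid.one_mem _

theorem isCssBlock_transvection {i j : ι} (hij : i ≠ j) (r : GroupRing n G) :
    IsCssBlock (1 + Matrix.single i j r) :=
  ⟨_, Submonoid.subset_closure (.cnot i j hij r)⟩

theorem isCssBlock_rescale (i : ι) (c : (ZMod n)ˣ) :
    IsCssBlock (Matrix.diagonal (Function.update 1 i (scalar G (c : ZMod n)))) :=
  ⟨_, Submonoid.subset_closure (.rescale i c)⟩

/-- A CSS symplectic matrix is determined by its action on `Z`-type operators. -/
theorem IsCssBlock.isCssCircuit {A B : Matrix ι ι (GroupRing n G)} (h : IsCssBlock A)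
    (hB : dagger A * B = 1) : IsCssCircuit (Matrix.fromBlocks A 0 0 B) := by
  obtain ⟨B', hB'⟩ := h
  have h1 := (isSymplectic_fromBlocks_iff A B').1 hB'.isSymplectic
  have h2 := mul_eq_one_comm.1 h1
  have : B' = B := by
    calc B' = B' * (dagger A * B) := by rw [hB, Matrix.mul_one]
      _ = B := by rw [← Matrix.mul_assoc, h2, Matrix.one_mul]
  rwa [← this]

/-- Unipotent matrices `1 + K` such that `K` maps the coordinates outside `S` to those in `S`. -/
theorem isCssBlock_unipotent (S : ι → Prop) (K : Matrix ι ι (GroupRing n G))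
    (hK : ∀ i j, K i j ≠ 0 → S i ∧ ¬ S j) : IsCssBlock (1 + K) := by
  have key : ∀ F : Finset (ι × ι), (∀ p ∈ F, S p.1 ∧ ¬ S p.2) →
      IsCssBlock (1 + ∑ p ∈ F, Matrix.single p.1 p.2 (K p.1 p.2)) := by
    intro F
    induction F using Finset.induction_on with
    | empty => intro _; simpa using isCssBlock_one
    | insert p F hp ih =>
      intro hF
      have hpS := hF p (Finset.mem_insert_self _ _)
      have h1 := ih fun q hq => hF q (Finset.mem_insert_of_mem hq)
      have hne : p.1 ≠ p.2 := fun h => hpS.2 (h ▸ hpS.1)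
      have h2 := h1.mul (isCssBlock_transvection hne (K p.1 p.2))
      -- Each term lands in the coordinates of `S` and only reads those outside `S`, so products of
      -- two terms vanish and composing the transvections just adds up the entries of `K`.
      have h0 : (∑ q ∈ F, Matrix.single q.1 q.2 (K q.1 q.2)) *
          Matrix.single p.1 p.2 (K p.1 p.2) = 0 := by
        rw [Finset.sum_mul]
        refine Finset.sum_eq_zero fun q hq => ?_
        refine Matrix.single_mul_single_of_ne (h := ?_) ..
        intro h
        exact (hF q (Finset.mem_insert_of_mem hq)).2 (h ▸ hpS.1)
      rw [Finset.sum_insert hp]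
      rw [Matrix.mul_add, Matrix.mul_one, Matrix.add_mul, Matrix.one_mul, h0, add_zero] at h2
      rwa [add_comm (Matrix.single _ _ _), ← add_assoc]
  have h := key (Finset.univ.filter fun p => K p.1 p.2 ≠ 0)
    fun p hp => hK _ _ (Finset.mem_filter.1 hp).2
  have hs : ∑ p ∈ Finset.univ.filter (fun p : ι × ι => K p.1 p.2 ≠ 0),
      Matrix.single p.1 p.2 (K p.1 p.2) = K := by
    rw [Finset.sum_filter_of_ne, Fintype.sum_prod_type, ← Matrix.matrix_eq_sum_single K]
    intro p _ hp h
    exact hp (by rw [h, Matrix.single_zero])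
  rwa [hs] at h

/-- Whitehead's lemma. -/
theorem isCssBlock_diagonal {i j : ι} (hij : i ≠ j) (a b : GroupRing n G) (hab : a * b = 1) :
    IsCssBlock (Matrix.diagonal (Function.update (Function.update 1 i a) j b)) := by
  -- On the coordinates `i`, `j` the product of three transvections is the antidiagonal matrix with
  -- entries `a` and `-b`.
  have hw : ∀ a b : GroupRing n G, a * b = 1 →
      (1 + Matrix.single i j a) * (1 + Matrix.single j i (-b)) * (1 + Matrix.single i j a) =
      1 - Matrix.single i i 1 - Matrix.single j j 1 + Matrix.single i j a - Matrix.single j i b := by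
    intro a b hab
    have hba : b * a = 1 := by rw [mul_comm, hab]
    simp only [Matrix.mul_add, Matrix.add_mul, Matrix.mul_one, mul_neg, neg_mul,
      Matrix.single_mul_single_same, Matrix.single_mul_single_of_ne _ _ _ _ hij.symm, hab, hba, one_mul]
    have hn : ∀ (k l : ι) (r : GroupRing n G), Matrix.single k l (-r) = -Matrix.single k l r :=
      fun k l r => (Matrix.singleAddMonoidHom k l).map_neg r
    rw [hn, hn, hn, hn]
    abel
  have h : ∀ a b : GroupRing n G, a * b = 1 → IsCssBlock
      (1 - Matrix.single i i 1 - Matrix.single j j 1 + Matrix.single i j a -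
        Matrix.single j i b) := by
    intro a b hab
    rw [← hw a b hab]
    exact ((isCssBlock_transvection hij _).mul (isCssBlock_transvection hij.symm _)).mul
      (isCssBlock_transvection hij _)
  -- The antidiagonal matrix for `(a, b)` times the one for `(-1, -1)` is `diag(a, b)`.
  have h2 := (h a b hab).mul (h (-1) (-1) (by ring))
  have hn : ∀ (k l : ι) (r : GroupRing n G), Matrix.single k l (-r) = -Matrix.single k l r :=
    fun k l r => (Matrix.singleAddMonoidHom k l).map_neg r
  convert h2 using 1
  simp only [Matrix.mul_add, Matrix.add_mul, Matrix.mul_sub, Matrix.sub_mul,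
      mul_neg, mul_one, one_mul,
      Matrix.single_mul_single_same, Matrix.single_mul_single_of_ne _ _ _ _ hij,
      Matrix.single_mul_single_of_ne _ _ _ _ hij.symm]
  ext k l : 2
  by_cases hkl : k = l
  · subst hkl
    by_cases hk : k = j
    · subst hk
      simp [hij]
    · by_cases hk' : k = i
      · subst hk'
        simp [hij, hij.symm]
      · simp [hk, hk', Ne.symm hk, Ne.symm hk']
  · have : ∀ (p : ι) (r : GroupRing n G), Matrix.single p p r k l = 0 := by
      intro p r
      rw [Matrix.single_apply, if_neg]
      rintro ⟨rfl, rfl⟩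
      exact hkl rfl
    simp [Matrix.diagonal_apply_ne _ hkl, Matrix.one_apply_ne hkl, this, hn]

end Symplectic

/-! ### CSS circuits have finite depth. -/

section FiniteDepth

variable {n : ℕ} {G : Type} [AddCommGroup G] {ι : Type} [Fintype ι] [DecidableEq ι]

theorem isFiniteDepthCircuit_one (η : G →+ Space) :
    IsFiniteDepthCircuit η (1 : Matrix (ι ⊕ ι) (ι ⊕ ι) (GroupRing n G)) :=
  ⟨[], by simp, fun s => by simp⟩

theorem IsFiniteDepthCircuit.mul {η : G →+ Space} {v w : Matrix (ι ⊕ ι) (ι ⊕ ι) (GroupRing n G)}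
    (hv : IsFiniteDepthCircuit η v) (hw : IsFiniteDepthCircuit η w) :
    IsFiniteDepthCircuit η (v * w) := by
  obtain ⟨l, hl, hl'⟩ := hv
  obtain ⟨k, hk, hk'⟩ := hw
  refine ⟨l ++ k, ?_, fun s => ?_⟩
  · intro f hf
    rcases List.mem_append.1 hf with h | h
    exacts [hl f h, hk f h]
  · rw [List.prod_append, LinearEquiv.mul_apply, hk', hl', Matrix.mulVec_mulVec]

/-- The action of an invertible matrix on Pauli operators. -/
noncomputable def mulVecEquiv (v w : Matrix (ι ⊕ ι) (ι ⊕ ι) (GroupRing n G)) (h : v * w = 1) :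
    (ι ⊕ ι → GroupRing n G) ≃ₗ[ZMod n] (ι ⊕ ι → GroupRing n G) :=
  LinearEquiv.ofLinearMap (v.mulVecLin.restrictScalars (ZMod n))
    (w.mulVecLin.restrictScalars (ZMod n))
    (LinearMap.ext fun s => by simp [h])
    (LinearMap.ext fun s => by simp [mul_eq_one_comm.1 h])

/-- A symplectic matrix that preserves the operators supported on each cell is one layer; the
inverse `-λ v† λ` makes it a linear equivalence. -/
theorem IsSymplectic.isFiniteDepthCircuit {η : G →+ Space}
    {v : Matrix (ι ⊕ ι) (ι ⊕ ι) (GroupRing n G)} (hv : IsSymplectic v) (cells : Setoid (ι × G))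
    (d : ℝ) (hd : ∀ a b, cells.r a b → dist (η a.2) (η b.2) ≤ d)
    (hs : ∀ a s, SupportedIn {b | cells.r a b} s → SupportedIn {b | cells.r a b} (v.mulVec s)) :
    IsFiniteDepthCircuit η v := by
  have hinv : v * (-(lam n G ι * dagger v * lam n G ι)) = 1 := by
    apply mul_eq_one_comm.1
    unfold IsSymplectic at hv
    rw [Matrix.neg_mul, Matrix.mul_assoc, Matrix.mul_assoc, ← Matrix.mul_assoc (dagger v), hv,
      lam_mul_lam, neg_neg]
  refine ⟨[mulVecEquiv v _ hinv], ?_, fun s => by simp [mulVecEquiv]⟩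
  intro f hf
  rw [List.mem_singleton] at hf
  subst hf
  exact ⟨fun s s' => hv.commutation s s', cells, d, hd, hs⟩

/-- With a monomial coefficient, the gate only couples the qudit `(j, h)` to `(i, g + h)`. As `i ≠
j` these pairs are disjoint, and they are the nontrivial fibres of `key`; their diameter is the
length of `η g`. -/
theorem isFiniteDepthCircuit_cnot_single (η : G →+ Space) {i j : ι} (hij : i ≠ j) (g : G)
    (c : ZMod n) :
    IsFiniteDepthCircuit η (Matrix.fromBlocks
        (1 + Matrix.single i j (AddMonoidAlgebra.single g c : GroupRing n G)) 0 0
        (1 - Matrix.single j i (antipode (AddMonoidAlgebra.single g c)))) := by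
  let key : ι × G → ι × G := fun a => if a.1 = j then (i, g + a.2) else a
  have hkj : ∀ h, key (j, h) = (i, g + h) := fun h => if_pos rfl
  have hk : ∀ k h, k ≠ j → key (k, h) = (k, h) := fun k h hkj => if_neg hkj
  refine (isSymplectic_cnot hij _).isFiniteDepthCircuit (Setoid.ker key) ‖η g‖ ?_ ?_
  · rintro ⟨k, a⟩ ⟨l, b⟩ hab
    replace hab : key (k, a) = key (l, b) := hab
    by_cases hkj' : k = j <;> by_cases hlj : l = j
    · subst hkj' hlj
      rw [hkj, hkj, Prod.mk.injEq, add_right_inj] at hab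
      simp [hab.2]
    · subst hkj'
      rw [hkj, hk _ _ hlj, Prod.mk.injEq] at hab
      simp [← hab.2, dist_eq_norm]
    · subst hlj
      rw [hkj, hk _ _ hkj', Prod.mk.injEq] at hab
      simp [hab.2, dist_eq_norm]
    · rw [hk _ _ hkj', hk _ _ hlj, Prod.mk.injEq] at hab
      simp [hab.2]
  · rintro a s hs k h hkh
    change key a = key (k, h)
    have hs' : ∀ k h, (s (Sum.inl k)).coeff h ≠ 0 ∨ (s (Sum.inr k)).coeff h ≠ 0 →
      key a = key (k, h) := hs
    have hz : ∀ k, (Matrix.fromBlocks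
        (1 + Matrix.single i j (AddMonoidAlgebra.single g c : GroupRing n G)) 0 0
        (1 - Matrix.single j i (antipode (AddMonoidAlgebra.single g c)))).mulVec s (Sum.inl k) =
        s (Sum.inl k) + if k = i then AddMonoidAlgebra.single g c * s (Sum.inl j) else 0 := by
      intro k
      rw [Matrix.fromBlocks_mulVec]
      by_cases hk : k = i
      · subst hk
        simp [Matrix.add_mulVec, Matrix.single_mulVec]
      · simp [Matrix.add_mulVec, Matrix.single_mulVec, hk]
    have hx : ∀ k, (Matrix.fromBlocks
        (1 + Matrix.single i j (AddMonoidAlgebra.single g c : GroupRing n G)) 0 0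
        (1 - Matrix.single j i (antipode (AddMonoidAlgebra.single g c)))).mulVec s (Sum.inr k) =
        s (Sum.inr k) - if k = j then AddMonoidAlgebra.single (-g) c * s (Sum.inr i) else 0 := by
      intro k
      rw [Matrix.fromBlocks_mulVec]
      by_cases hk : k = j
      · subst hk
        simp [Matrix.sub_mulVec, Matrix.single_mulVec]
      · simp [Matrix.sub_mulVec, Matrix.single_mulVec, hk]
    by_cases h1 : (s (Sum.inl k)).coeff h ≠ 0 ∨ (s (Sum.inr k)).coeff h ≠ 0
    · exact hs' k h h1
    push Not at h1
    rw [hz, hx, AddMonoidAlgebra.coeff_add, AddMonoidAlgebra.coeff_sub, Finsupp.add_apply,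
      Finsupp.sub_apply, h1.1, h1.2, zero_add, zero_sub, neg_ne_zero] at hkh
    rcases hkh with hkh | hkh
    · by_cases hki : k = i
      · subst hki
        rw [if_pos rfl] at hkh
        have h2 : (s (Sum.inl j)).coeff (-g + h) ≠ 0 := by
          intro h0
          apply hkh
          rw [AddMonoidAlgebra.coeff_single_mul_apply, h0, mul_zero]
        rw [hs' j _ (Or.inl h2), hkj, hk _ _ hij, add_neg_cancel_left]
      · simp [hki] at hkh
    · by_cases hkj' : k = j
      · subst hkj'
        rw [if_pos rfl] at hkh
        have h2 : (s (Sum.inr i)).coeff (g + h) ≠ 0 := by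
          intro h0
          apply hkh
          rw [AddMonoidAlgebra.coeff_single_mul_apply, neg_neg, h0, mul_zero]
        rw [hs' i _ (Or.inr h2), hkj, hk _ _ hij]
      · simp [hkj'] at hkh

/-- For fixed `i ≠ j` elementary matrices square to zero, so composing gates adds their
coefficients: a polynomial coefficient costs one layer for each of its terms. -/
theorem isFiniteDepthCircuit_cnot (η : G →+ Space) {i j : ι} (hij : i ≠ j) (r : GroupRing n G) :
    IsFiniteDepthCircuit η (Matrix.fromBlocks (1 + Matrix.single i j r) 0 0
        (1 - Matrix.single j i (antipode r))) := by
  induction r using AddMonoidAlgebra.induction_linear with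
  | zero => simpa using isFiniteDepthCircuit_one η
  | add r r' hr hr' =>
    convert hr.mul hr' using 1
    rw [Matrix.fromBlocks_multiply, Matrix.fromBlocks_inj]
    simp only [Matrix.mul_zero, Matrix.zero_mul, add_zero, zero_add, true_and, map_add,
      Matrix.single_add, Matrix.add_mul, Matrix.mul_add, Matrix.mul_sub, Matrix.sub_mul,
      Matrix.mul_one, Matrix.one_mul, Matrix.single_mul_single_of_ne _ _ _ _ hij,
      Matrix.single_mul_single_of_ne _ _ _ _ hij.symm]
    refine ⟨?_, ?_, ?_⟩
    · abel
    · simp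
    · abel
  | single g c => exact isFiniteDepthCircuit_cnot_single η hij g c

theorem isFiniteDepthCircuit_rescale (η : G →+ Space) (i : ι) (c : (ZMod n)ˣ) :
    IsFiniteDepthCircuit η (Matrix.fromBlocks
        (Matrix.diagonal (Function.update 1 i (scalar G (c : ZMod n)))) 0 0
        (Matrix.diagonal (Function.update 1 i (scalar G ((c⁻¹ : (ZMod n)ˣ) : ZMod n))))) := by
  refine (isSymplectic_rescale i c).isFiniteDepthCircuit ⊥ 0 ?_ ?_
  · rintro a b (rfl : a = b)
    simp
  · rintro a s hs k h hkh
    have hmul : ∀ (d : ZMod n) (r : GroupRing n G) (h : G), r.coeff h = 0 →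
        ((Function.update 1 i (scalar G d) : ι → GroupRing n G) k * r).coeff h = 0 := by
      intro d r h hr
      by_cases hk : k = i
      · subst hk
        rw [Function.update_self, scalar, AddMonoidAlgebra.coeff_single_mul_apply]
        simp [hr]
      · rw [Function.update_of_ne hk]
        simp [hr]
    refine hs k h ?_
    contrapose! hkh
    rw [Matrix.fromBlocks_mulVec]
    simp only [Matrix.zero_mulVec, add_zero, zero_add, Sum.elim_inl, Sum.elim_inr,
      Matrix.mulVec_diagonal]
    exact ⟨hmul _ _ _ hkh.1, hmul _ _ _ hkh.2⟩

theorem IsCssCircuit.isFiniteDepthCircuit (η : G →+ Space)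
    {v : Matrix (ι ⊕ ι) (ι ⊕ ι) (GroupRing n G)} (hv : IsCssCircuit v) :
    IsFiniteDepthCircuit η v := by
  induction hv using Submonoid.closure_induction with
  | mem w hw =>
    obtain ⟨i, j, hij, r⟩ | ⟨i, c⟩ := hw
    · exact isFiniteDepthCircuit_cnot η hij r
    · exact isFiniteDepthCircuit_rescale η i c
  | one => exact isFiniteDepthCircuit_one η
  | mul v w _ _ hv hw => exact hv.mul hw

end FiniteDepth

/-! ### Matrix identities over a general commutative ring -/

section Identities

variable {A : Type} [CommRing A]

/-- The action of the symplectic transformation on `Z`-type operators, in terms of the inverses of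
the variables. -/
def vTop (X' Y' Z' : A) : Matrix (Fin 8) (Fin 8) A :=
  !![2, 0, 0, 0, 0, 0, 0, 0;
     2, 1, 0, 0, 0, 0, 1 + Z', 1 + Y';
     2, 0, 1, 0, 0, 1 + Z', 0, 1 + X';
     2, 0, 0, 1, 0, 1 + Y', 1 + X', 0;
     2, 1, 1, 1, 1, Y' + Z', Z' + X', X' + Y';
     2 * (Y' * Z'), 0, 0, 0, 0, 2 * (Y' * Z'), 0, 0;
     2 * (X' * Z'), 0, 0, 0, 0, 0, 2 * (X' * Z'), 0;
     2 * (X' * Y'), 0, 0, 0, 0, 0, 0, 2 * (X' * Y')]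

/-- The action of the symplectic transformation on `X`-type operators. -/
def vBottom (X Y Z X' Y' Z' h : A) : Matrix (Fin 8) (Fin 8) A :=
  !![h, h * (Y + Z), h * (Z + X), h * (X + Y), -1, -h, -h, -h;
     0, 1, 0, 0, -1, 0, 0, 0;
     0, 0, 1, 0, -1, 0, 0, 0;
     0, 0, 0, 1, -1, 0, 0, 0;
     0, 0, 0, 0, 1, 0, 0, 0;
     0, 0, -(h * (Y' * Z') * (1 + Z)), -(h * (Y' * Z') * (1 + Y)), Y' * Z', h * (Y' * Z'), 0, 0;
     0, -(h * (X' * Z') * (1 + Z)), 0, -(h * (X' * Z') * (1 + X)), X' * Z', 0, h * (X' * Z'), 0;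
     0, -(h * (X' * Y') * (1 + Y)), -(h * (X' * Y') * (1 + X)), 0, X' * Y', 0, 0, h * (X' * Y')]

/-- A block of the checkerboard excitation map, with a sign `s` on the second half. -/
def eBlock (s X Y Z X' Y' Z' : A) : Matrix (Fin 4) (Fin 8) A :=
  !![1, 1, 1, 1, s, s * (Y * Z), s * (X * Z), s * (X * Y);
     Y' * Z', 1, Y', Z', s, s, s * X, s * X;
     X' * Z', X', 1, Z', s, s * Y, s, s * Y;
     X' * Y', X', Y', 1, s, s * Z, s * Z, s]

/-- The change of basis of the stabilizers of the first kind. -/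
def uTop (h : A) : Matrix (Fin 4) (Fin 4) A :=
  !![1, 0, 0, 0;
     -h, -h, h, h;
     -h, h, -h, h;
     -h, h, h, -h]

/-- The change of basis of the stabilizers of the second kind. -/
def uBottom (X Y Z : A) : Matrix (Fin 4) (Fin 4) A :=
  !![2, 0, 0, 0;
     -1, -(Y * Z), X * Z, X * Y;
     -1, Y * Z, -(X * Z), X * Y;
     -1, Y * Z, X * Z, -(X * Y)]

/-- The transformed stabilizers of the first kind. -/
def tTop (X' Y' Z' : A) : Matrix (Fin 4) (Fin 8) A :=
  !![0, 0, 0, 0, -1, 0, 0, 0;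
     0, -(1 - X'), 0, 0, 0, (1 - Y') * (1 - Z'), 0, 0;
     0, 0, -(1 - Y'), 0, 0, 0, (1 - Z') * (1 - X'), 0;
     0, 0, 0, -(1 - Z'), 0, 0, 0, (1 - X') * (1 - Y')]

/-- The transformed stabilizers of the second kind. -/
def tBottom (X Y Z : A) : Matrix (Fin 4) (Fin 8) A :=
  !![1, 0, 0, 0, 0, 0, 0, 0;
     0, -((1 - Y) * (1 - Z)), 0, 0, 0, -(1 - X), 0, 0;
     0, 0, -((1 - Z) * (1 - X)), 0, 0, 0, -(1 - Y), 0;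
     0, 0, 0, -((1 - X) * (1 - Y)), 0, 0, 0, -(1 - Z)]

variable {X X' Y Y' Z Z' h : A}

set_option maxHeartbeats 4000000 in
-- The inverses `X'`, `Y'`, `Z'` and the half `h` are independent letters with relations, so every
-- entry is a polynomial identity modulo these relations; the group ring is substituted afterwards.
theorem uTop_mul_eBlock_mul_vTop (hX : X * X' = 1) (hY : Y * Y' = 1) (hZ : Z * Z' = 1)
    (hh : 2 * h = 1) :
    uTop h * eBlock (-1) X Y Z X' Y' Z' * vTop X' Y' Z' = tTop X' Y' Z' := by
  ext i j
  fin_cases i <;> fin_cases j <;>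
    (simp only [Matrix.mul_apply, Fin.sum_univ_four, Fin.sum_univ_eight, Matrix.transpose_apply,
      Matrix.one_apply, Matrix.add_apply, Fin.reduceFinMk, Fin.zero_eta, Fin.isValue, Fin.mk_one,
      Fin.reduceEq, if_true, if_false]
     simp only [uTop, eBlock, vTop, tTop, Matrix.of_apply, Matrix.cons_val]
     grind)

set_option maxHeartbeats 4000000 in
theorem uBottom_mul_eBlock_mul_vBottom (hX : X * X' = 1) (hY : Y * Y' = 1) (hZ : Z * Z' = 1)
    (hh : 2 * h = 1) :
    uBottom X Y Z * eBlock 1 X Y Z X' Y' Z' * vBottom X Y Z X' Y' Z' h = tBottom X Y Z := by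
  ext i j
  fin_cases i <;> fin_cases j <;>
    (simp only [Matrix.mul_apply, Fin.sum_univ_four, Fin.sum_univ_eight, Matrix.transpose_apply,
      Matrix.one_apply, Matrix.add_apply, Fin.reduceFinMk, Fin.zero_eta, Fin.isValue, Fin.mk_one,
      Fin.reduceEq, if_true, if_false]
     simp only [uBottom, eBlock, vBottom, tBottom, Matrix.of_apply, Matrix.cons_val]
     grind)

set_option maxHeartbeats 4000000 in
-- The antipode exchanges variables and inverses, so the transpose of `vTop X Y Z` is the conjugate
-- transpose of `vTop X' Y' Z'`: this is the symplectic condition for `v`.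
theorem vTop_transpose_mul_vBottom (hX : X * X' = 1) (hY : Y * Y' = 1) (hZ : Z * Z' = 1)
    (hh : 2 * h = 1) :
    (vTop X Y Z).transpose * vBottom X Y Z X' Y' Z' h = 1 := by
  ext i j
  fin_cases i <;> fin_cases j <;>
    (simp only [Matrix.mul_apply, Fin.sum_univ_four, Fin.sum_univ_eight, Matrix.transpose_apply,
      Matrix.one_apply, Matrix.add_apply, Fin.reduceFinMk, Fin.zero_eta, Fin.isValue, Fin.mk_one,
      Fin.reduceEq, if_true, if_false]
     simp only [vTop, vBottom, Matrix.of_apply, Matrix.cons_val]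
     grind)

set_option maxHeartbeats 1000000 in
theorem isUnit_uTop (hh : 2 * h = 1) : IsUnit (uTop h) := by
  refine IsUnit.of_mul_eq_one !![1, 0, 0, 0; 1, 0, 1, 1; 1, 1, 0, 1; 1, 1, 1, 0] ?_
  ext i j
  fin_cases i <;> fin_cases j <;>
    (simp only [Matrix.mul_apply, Fin.sum_univ_four, Fin.sum_univ_eight, Matrix.transpose_apply,
      Matrix.one_apply, Matrix.add_apply, Fin.reduceFinMk, Fin.zero_eta, Fin.isValue, Fin.mk_one,
      Fin.reduceEq, if_true, if_false]
     simp only [uTop, Matrix.of_apply, Matrix.cons_val]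
     grind)

set_option maxHeartbeats 1000000 in
theorem isUnit_uBottom (hX : X * X' = 1) (hY : Y * Y' = 1) (hZ : Z * Z' = 1) (hh : 2 * h = 1) :
    IsUnit (uBottom X Y Z) := by
  refine IsUnit.of_mul_eq_one !![h, 0, 0, 0;
    h * (Y' * Z'), 0, h * (Y' * Z'), h * (Y' * Z');
    h * (X' * Z'), h * (X' * Z'), 0, h * (X' * Z');
    h * (X' * Y'), h * (X' * Y'), h * (X' * Y'), 0] ?_
  ext i j
  fin_cases i <;> fin_cases j <;>
    (simp only [Matrix.mul_apply, Fin.sum_univ_four, Fin.sum_univ_eight, Matrix.transpose_apply,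
      Matrix.one_apply, Matrix.add_apply, Fin.reduceFinMk, Fin.zero_eta, Fin.isValue, Fin.mk_one,
      Fin.reduceEq, if_true, if_false]
     simp only [uBottom, Matrix.of_apply, Matrix.cons_val]
     grind)

/-- The addition of rows `1`, `2`, `3` to row `4`. -/
def rowFactor : Matrix (Fin 8) (Fin 8) A :=
  !![0, 0, 0, 0, 0, 0, 0, 0;
     0, 0, 0, 0, 0, 0, 0, 0;
     0, 0, 0, 0, 0, 0, 0, 0;
     0, 0, 0, 0, 0, 0, 0, 0;
     0, 1, 1, 1, 0, 0, 0, 0;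
     0, 0, 0, 0, 0, 0, 0, 0;
     0, 0, 0, 0, 0, 0, 0, 0;
     0, 0, 0, 0, 0, 0, 0, 0]

/-- The addition of multiples of rows `0`, `5`, `6`, `7` to rows `1`, `2`, `3`, `4`. -/
def midFactor (X Y Z X' Y' Z' h : A) : Matrix (Fin 8) (Fin 8) A :=
  !![0, 0, 0, 0, 0, 0, 0, 0;
     1 - h * (2 + Z' + Y'), 0, 0, 0, 0, 0, h * (X * Z) * (1 + Z'), h * (X * Y) * (1 + Y');
     1 - h * (2 + Z' + X'), 0, 0, 0, 0, h * (Y * Z) * (1 + Z'), 0, h * (X * Y) * (1 + X');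
     1 - h * (2 + X' + Y'), 0, 0, 0, 0, h * (Y * Z) * (1 + Y'), h * (X * Z) * (1 + X'), 0;
     1, 0, 0, 0, 0, -(Y * Z), -(X * Z), -(X * Y);
     0, 0, 0, 0, 0, 0, 0, 0;
     0, 0, 0, 0, 0, 0, 0, 0;
     0, 0, 0, 0, 0, 0, 0, 0]

/-- The addition of a multiple of row `0` to rows `5`, `6`, `7`. -/
def colFactor (m : A) : Matrix (Fin 8) (Fin 8) A :=
  !![0, 0, 0, 0, 0, 0, 0, 0;
     0, 0, 0, 0, 0, 0, 0, 0;
     0, 0, 0, 0, 0, 0, 0, 0;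
     0, 0, 0, 0, 0, 0, 0, 0;
     0, 0, 0, 0, 0, 0, 0, 0;
     m, 0, 0, 0, 0, 0, 0, 0;
     m, 0, 0, 0, 0, 0, 0, 0;
     m, 0, 0, 0, 0, 0, 0, 0]

set_option maxHeartbeats 4000000 in
-- Gaussian elimination with pivots in columns `0`, `5`, `6`, `7`. The free factor `m` on column `0`
-- is later chosen so that the diagonal part has determinant a unit of `ℤ_n`; the outer factors have
-- the shape required by `isCssBlock_unipotent`.
theorem vTop_eq_mul (hX : X * X' = 1) (hY : Y * Y' = 1) (hZ : Z * Z' = 1) (hh : 2 * h = 1)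
    (m : A) :
    vTop X' Y' Z' * Matrix.diagonal ![m, 1, 1, 1, 1, 1, 1, 1] =
      (1 + rowFactor) * ((1 + midFactor X Y Z X' Y' Z' h) *
        (Matrix.diagonal ![2 * m, 1, 1, 1, 1, 2 * (Y' * Z'), 2 * (X' * Z'), 2 * (X' * Y')] *
          (1 + colFactor m))) := by
  have h1 : Matrix.diagonal ![2 * m, 1, 1, 1, 1, 2 * (Y' * Z'), 2 * (X' * Z'), 2 * (X' * Y')] *
      (1 + colFactor m) =
    !![2 * m, 0, 0, 0, 0, 0, 0, 0;
     0, 1, 0, 0, 0, 0, 0, 0;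
     0, 0, 1, 0, 0, 0, 0, 0;
     0, 0, 0, 1, 0, 0, 0, 0;
     0, 0, 0, 0, 1, 0, 0, 0;
     2 * (Y' * Z') * m, 0, 0, 0, 0, 2 * (Y' * Z'), 0, 0;
     2 * (X' * Z') * m, 0, 0, 0, 0, 0, 2 * (X' * Z'), 0;
     2 * (X' * Y') * m, 0, 0, 0, 0, 0, 0, 2 * (X' * Y')] := by
    ext i j
    rw [Matrix.diagonal_mul]
    fin_cases i <;> fin_cases j <;> simp [colFactor]
  have h2 : (1 + midFactor X Y Z X' Y' Z' h) *
    !![2 * m, 0, 0, 0, 0, 0, 0, 0;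
     0, 1, 0, 0, 0, 0, 0, 0;
     0, 0, 1, 0, 0, 0, 0, 0;
     0, 0, 0, 1, 0, 0, 0, 0;
     0, 0, 0, 0, 1, 0, 0, 0;
     2 * (Y' * Z') * m, 0, 0, 0, 0, 2 * (Y' * Z'), 0, 0;
     2 * (X' * Z') * m, 0, 0, 0, 0, 0, 2 * (X' * Z'), 0;
     2 * (X' * Y') * m, 0, 0, 0, 0, 0, 0, 2 * (X' * Y')] =
    !![2 * m, 0, 0, 0, 0, 0, 0, 0;
     2 * m, 1, 0, 0, 0, 0, 1 + Z', 1 + Y';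
     2 * m, 0, 1, 0, 0, 1 + Z', 0, 1 + X';
     2 * m, 0, 0, 1, 0, 1 + Y', 1 + X', 0;
     -(4 * m), 0, 0, 0, 1, -2, -2, -2;
     2 * (Y' * Z') * m, 0, 0, 0, 0, 2 * (Y' * Z'), 0, 0;
     2 * (X' * Z') * m, 0, 0, 0, 0, 0, 2 * (X' * Z'), 0;
     2 * (X' * Y') * m, 0, 0, 0, 0, 0, 0, 2 * (X' * Y')] := by
    rw [Matrix.add_mul, Matrix.one_mul]
    ext i j
    fin_cases i <;> fin_cases j <;>
    (simp only [Matrix.mul_apply, Fin.sum_univ_four, Fin.sum_univ_eight, Matrix.transpose_apply,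
      Matrix.one_apply, Matrix.add_apply, Fin.reduceFinMk, Fin.zero_eta, Fin.isValue, Fin.mk_one,
      Fin.reduceEq, if_true, if_false]
     simp only [midFactor, Matrix.of_apply, Matrix.cons_val]
     grind)
  rw [h1, h2, Matrix.add_mul, Matrix.one_mul]
  ext i j
  rw [Matrix.mul_diagonal]
  fin_cases i <;> fin_cases j <;>
    (simp only [Matrix.mul_apply, Fin.sum_univ_four, Fin.sum_univ_eight, Matrix.transpose_apply,
      Matrix.one_apply, Matrix.add_apply, Fin.reduceFinMk, Fin.zero_eta, Fin.isValue, Fin.mk_one,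
      Fin.reduceEq, if_true, if_false]
     simp only [vTop, rowFactor, Matrix.of_apply, Matrix.cons_val]
     ring)

end Identities

/-! ### The explicit matrices `u` and `v`. -/

section Models

variable (n : ℕ)

theorem antipode_dd (μ : Fin 3) : antipode (dd n μ) = 1 - varInv n μ := by
  simp [dd]

theorem antipode_dd₂ (μ ν : Fin 3) :
    antipode (dd₂ n μ ν) = (1 - varInv n μ) * (1 - varInv n ν) := by
  simp [dd₂, antipode_dd]

theorem gg_zero : gg n 0 = var n 1 + var n 2 := rfl

theorem gg_one : gg n 1 = var n 2 + var n 0 := rfl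

theorem gg_two : gg n 2 = var n 0 + var n 1 := rfl

theorem vMatrix_eq : vMatrix n = Matrix.fromBlocks (vTop (varInv n 0) (varInv n 1) (varInv n 2)) 0 0
    (vBottom (var n 0) (var n 1) (var n 2) (varInv n 0) (varInv n 1) (varInv n 2) (half n)) := by
  simp only [vMatrix, vTop, vBottom, ff, map_one, gg_zero, gg_one, gg_two, map_add, antipode_var,
    mon_eq, Pi.single_zero, mono_zero, one_mul, mul_one, mono_single_neg_one]

theorem checkerboardCode_eq : checkerboardCode n = Matrix.fromBlocks
    (eBlock (-1) (var n 0) (var n 1) (var n 2) (varInv n 0) (varInv n 1) (varInv n 2)) 0 0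
    (eBlock 1 (var n 0) (var n 1) (var n 2) (varInv n 0) (varInv n 1) (varInv n 2)) := by
  simp only [checkerboardCode, eBlock, mon_eq, Pi.single_zero, mono_zero, one_mul, mul_one,
    mono_single_neg_one, mono_single_one, neg_one_mul]

theorem uMatrix_eq : uMatrix n = Matrix.fromBlocks (uTop (half n)) 0 0
    (uBottom (var n 0) (var n 1) (var n 2)) := by
  simp only [uMatrix, uTop, uBottom, mon_eq, Pi.single_zero, mono_zero, one_mul, mul_one,
    mono_single_one]

theorem transformedCode_eq : transformedCode n = Matrix.fromBlocks
    (tTop (varInv n 0) (varInv n 1) (varInv n 2)) 0 0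
    (tBottom (var n 0) (var n 1) (var n 2)) := by
  simp only [transformedCode, tTop, tBottom, antipode_dd, antipode_dd₂]
  rfl

variable {n}

theorem uMatrix_mul_checkerboardCode_mul_vMatrix (hn : Odd n) :
    uMatrix n * checkerboardCode n * vMatrix n = transformedCode n := by
  rw [uMatrix_eq, checkerboardCode_eq, vMatrix_eq, transformedCode_eq, Matrix.fromBlocks_multiply,
    Matrix.fromBlocks_multiply]
  simp only [Matrix.mul_zero, Matrix.zero_mul, add_zero, zero_add]
  rw [uTop_mul_eBlock_mul_vTop (var_mul_varInv n 0) (var_mul_varInv n 1) (var_mul_varInv n 2)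
      (two_mul_half n hn),
    uBottom_mul_eBlock_mul_vBottom (var_mul_varInv n 0) (var_mul_varInv n 1) (var_mul_varInv n 2)
      (two_mul_half n hn)]

theorem isUnit_fromBlocks {A α β : Type} [CommRing A] [Fintype α] [Fintype β] [DecidableEq α]
    [DecidableEq β] {M : Matrix α α A} {N : Matrix β β A} (hM : IsUnit M) (hN : IsUnit N) :
    IsUnit (Matrix.fromBlocks M 0 0 N) := by
  obtain ⟨M', hM'⟩ := hM.exists_right_inv
  obtain ⟨N', hN'⟩ := hN.exists_right_inv
  refine IsUnit.of_mul_eq_one (Matrix.fromBlocks M' 0 0 N') ?_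
  rw [Matrix.fromBlocks_multiply, ← Matrix.fromBlocks_one]
  simp [hM', hN']

theorem isUnit_uMatrix (hn : Odd n) : IsUnit (uMatrix n) := by
  rw [uMatrix_eq]
  exact isUnit_fromBlocks (isUnit_uTop (two_mul_half n hn)) (isUnit_uBottom (var_mul_varInv n 0)
    (var_mul_varInv n 1) (var_mul_varInv n 2) (two_mul_half n hn))

theorem dagger_vTop : dagger (vTop (varInv n 0) (varInv n 1) (varInv n 2)) =
    (vTop (var n 0) (var n 1) (var n 2)).transpose := by
  rw [dagger, Matrix.transpose_map]
  congr 1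
  have h2 : antipode (2 : R n) = 2 := map_ofNat _ 2
  ext i j : 2
  rw [Matrix.map_apply]
  fin_cases i <;> fin_cases j <;>
    (simp only [Fin.reduceFinMk, Fin.zero_eta, Fin.isValue, Fin.mk_one]
     simp only [vTop, Matrix.of_apply, Matrix.cons_val, map_add, map_mul, map_one, map_zero, h2,
       antipode_varInv])

theorem isSymplectic_vMatrix (hn : Odd n) : IsSymplectic (vMatrix n) := by
  rw [vMatrix_eq, isSymplectic_fromBlocks_iff, dagger_vTop]
  exact vTop_transpose_mul_vBottom (var_mul_varInv n 0) (var_mul_varInv n 1) (var_mul_varInv n 2)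
    (two_mul_half n hn)

theorem isSymplectic_translateQudit {G ι : Type} [AddCommGroup G] [Fintype ι] [DecidableEq ι]
    (i : ι) (g : G) : IsSymplectic (translateQudit n i g) := by
  rw [translateQudit, isSymplectic_fromBlocks_iff, dagger_diagonal, Matrix.diagonal_mul_diagonal,
    ← Matrix.diagonal_one]
  congr 1
  funext k
  by_cases hk : k = i
  · subst hk
    rw [Function.update_self, antipode_mono, mul_comm, mono_mul_mono_neg]
  · simp [hk]

theorem isCssBlock_scale {G ι : Type} [AddCommGroup G] [Fintype ι] [DecidableEq ι] (i : ι)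
    (r : GroupRing n G) (c : ZMod n) (hc : IsUnit c) (hr : scalar G c = r) :
    IsCssBlock (Matrix.diagonal (Function.update 1 i r)) := by
  obtain ⟨c, rfl⟩ := hc
  rw [← hr]
  exact isCssBlock_rescale i c

/-- The translation of the first qudit, as a product of variables. -/
theorem mono_two_two_two : mono n (![2, 2, 2] : Lattice) =
    (var n 1 * var n 2) * (var n 0 * var n 2) * (var n 0 * var n 1) := by
  simp only [var, ← mono_add]
  congr 1
  decide

/-- All factors of `vTop_eq_mul` are CSS blocks once `m = x²y²z²`: this monomial is the inverse of
the product of the monomials on the diagonal at the qudits `5`, `6`, `7`. -/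
theorem isCssBlock_vTop (hn : Odd n) :
    IsCssBlock (vTop (varInv n 0) (varInv n 1) (varInv n 2) *
      Matrix.diagonal (Function.update 1 0 (mono n (![2, 2, 2] : Lattice)))) := by
  have hX := var_mul_varInv n 0
  have hY := var_mul_varInv n 1
  have hZ := var_mul_varInv n 2
  have hd : (Function.update 1 0 (mono n (![2, 2, 2] : Lattice)) : Fin 8 → R n) =
      ![mono n (![2, 2, 2] : Lattice), 1, 1, 1, 1, 1, 1, 1] := by
    funext i
    fin_cases i <;> rfl
  have h2 : IsUnit (2 : ZMod n) := by
    have := (ZMod.isUnit_iff_coprime 2 n).2 (Nat.coprime_two_left.2 hn)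
    exact_mod_cast this
  rw [hd, vTop_eq_mul hX hY hZ (two_mul_half n hn)]
  refine IsCssBlock.mul ?_ (IsCssBlock.mul ?_ (IsCssBlock.mul ?_ ?_))
  · refine isCssBlock_unipotent (fun i => i = 4) _ fun i j hij => ?_
    fin_cases i <;> fin_cases j <;> first | decide | exact absurd rfl hij
  · refine isCssBlock_unipotent (fun i => i = 1 ∨ i = 2 ∨ i = 3 ∨ i = 4) _ fun i j hij => ?_
    fin_cases i <;> fin_cases j <;> first | decide | exact absurd rfl hij
  · have hs : ∀ i : Fin 8, IsCssBlock (Matrix.diagonal (Function.update 1 i (2 : R n))) :=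
      fun i => isCssBlock_scale i 2 2 h2 scalar_two
    have hw : ∀ (j : Fin 8) (a b : R n), 0 ≠ j → a * b = 1 → IsCssBlock (Matrix.diagonal
        (Function.update (Function.update 1 0 a) j b)) :=
      fun j a b hj hab => isCssBlock_diagonal hj a b hab
    -- Four rescalings by `2`, then three Whitehead pairs: each of the monomials `y⁻¹z⁻¹`, `x⁻¹z⁻¹`,
    -- `x⁻¹y⁻¹` on a qudit `5`, `6`, `7` is balanced by its inverse on qudit `0`, where the inverses
    -- multiply to `x²y²z²`.
    have h := ((((((hs 0).mul (hs 5)).mul (hs 6)).mul (hs 7)).mul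
      (hw 5 (var n 1 * var n 2) (varInv n 1 * varInv n 2) (by decide)
        (by rw [mul_mul_mul_comm, hY, hZ, one_mul]))).mul
      (hw 6 (var n 0 * var n 2) (varInv n 0 * varInv n 2) (by decide)
        (by rw [mul_mul_mul_comm, hX, hZ, one_mul]))).mul
      (hw 7 (var n 0 * var n 1) (varInv n 0 * varInv n 1) (by decide)
        (by rw [mul_mul_mul_comm, hX, hY, one_mul]))
    simp only [Matrix.diagonal_mul_diagonal] at h
    convert h using 2
    rw [mono_two_two_two]
    funext i
    fin_cases i <;> simp [Function.update] 
    ring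
  · refine isCssBlock_unipotent (fun i => i = 5 ∨ i = 6 ∨ i = 7) _ fun i j hij => ?_
    fin_cases i <;> fin_cases j <;> first | decide | exact absurd rfl hij

theorem isCssCircuit_vMatrix_mul_translateQudit (hn : Odd n) :
    IsCssCircuit (vMatrix n * translateQudit n (0 : Fin 8) (![2, 2, 2] : Lattice)) := by
  have hs := (isSymplectic_vMatrix hn).mul
    (isSymplectic_translateQudit (n := n) (0 : Fin 8) (![2, 2, 2] : Lattice))
  rw [vMatrix_eq, translateQudit, Matrix.fromBlocks_multiply] at hs ⊢
  simp only [Matrix.mul_zero, Matrix.zero_mul, add_zero, zero_add] at hs ⊢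
  exact (isCssBlock_vTop hn).isCssCircuit ((isSymplectic_fromBlocks_iff _ _).1 hs)

end Models

/-! ### From the transformed code to the decoupled anisotropic codes. -/

section Models

/-- The labelling of the stabilizers of the decoupled code. -/
def stabLabel : (Fin 1 ⊕ Fin 1) ⊕ (Fin 2 ⊕ (Fin 2 ⊕ Fin 2)) ≃ Fin 4 ⊕ Fin 4 where
  toFun := Sum.elim (Sum.elim (fun _ => .inl 0) (fun _ => .inr 0))
    (Sum.elim ![.inr 1, .inl 1] (Sum.elim ![.inr 2, .inl 2] ![.inr 3, .inl 3]))
  invFun := Sum.elim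
    ![.inl (.inl 0), .inr (.inl 1), .inr (.inr (.inl 1)), .inr (.inr (.inr 1))]
    ![.inl (.inr 0), .inr (.inl 0), .inr (.inr (.inl 0)), .inr (.inr (.inr 0))]
  left_inv := by decide
  right_inv := by decide

/-- The labelling of the qudits of the decoupled code. -/
def quditLabel : (Fin 1 ⊕ Fin 1) ⊕ (Fin 2 ⊕ (Fin 2 ⊕ Fin 2)) ≃ Fin 8 where
  toFun := Sum.elim (Sum.elim (fun _ => 4) (fun _ => 0))
    (Sum.elim ![5, 1] (Sum.elim ![6, 2] ![7, 3]))
  invFun := ![.inl (.inr 0), .inr (.inl 1), .inr (.inr (.inl 1)), .inr (.inr (.inr 1)),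
    .inl (.inl 0), .inr (.inl 0), .inr (.inr (.inl 0)), .inr (.inr (.inr 0))]
  left_inv := by decide
  right_inv := by decide

/-- The signs of the stabilizers of the decoupled code. -/
def stabSign : Fin 4 ⊕ Fin 4 → ℤˣ := Sum.elim 1 ![1, -1, -1, -1]

/-- The signs of the qudit operators of the decoupled code. -/
def quditSign : Fin 8 → ℤˣ := ![1, 1, 1, 1, 1, -1, -1, -1]

variable (n : ℕ)

theorem signed_transformedCode : (Matrix.of fun i j =>
    (((stabSign i : ℤ) * (quditSign (Sum.elim id id j) : ℤ) : ℤ) : R n) * transformedCode n i j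
      ).submatrix stabLabel (Sum.map quditLabel quditLabel) = decoupledCode n := by
  ext i j : 2
  rcases i with (i | i) | (i | (i | i)) <;>
    rcases j with ((j | j) | (j | (j | j))) | ((j | j) | (j | (j | j))) <;>
    fin_cases i <;> fin_cases j <;>
    simp [stabLabel, quditLabel, stabSign, quditSign, transformedCode, decoupledCode, stackCodes,
      anisotropicCode, ancillaX, ancillaZ]

theorem sameUpToLabelsAndSigns_transformedCode :
    SameUpToLabelsAndSigns (transformedCode n) (decoupledCode n) :=
  ⟨stabLabel, quditLabel, stabSign, quditSign, signed_transformedCode n⟩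

/-- The translation of the ancilla stabilizer that compensates the translation of the ancilla. -/
noncomputable def translateStab : Matrix (Fin 4 ⊕ Fin 4) (Fin 4 ⊕ Fin 4) (R n) :=
  Matrix.fromBlocks 1 0 0 (Matrix.diagonal ![mono n (-![2, 2, 2] : Lattice), 1, 1, 1])

/-- The change of basis of the stabilizers that decouples the checkerboard code. -/
noncomputable def decouplingStab : Matrix (Fin 4 ⊕ Fin 4) (Fin 4 ⊕ Fin 4) (R n) :=
  Matrix.diagonal (fun i => ((stabSign i : ℤ) : R n)) *
    (translateStab n * uMatrix n)

/-- The circuit that decouples the checkerboard code. -/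
noncomputable def decouplingCircuit : Matrix (Fin 8 ⊕ Fin 8) (Fin 8 ⊕ Fin 8) (R n) :=
  vMatrix n * translateQudit n (0 : Fin 8) (![2, 2, 2] : Lattice) *
    Matrix.fromBlocks (Matrix.diagonal fun i => ((quditSign i : ℤ) : R n)) 0 0
      (Matrix.diagonal fun i => ((quditSign i : ℤ) : R n))

variable {n}

theorem decoupling (hn : Odd n) :
    (decouplingStab n * checkerboardCode n * decouplingCircuit n).submatrix stabLabel
      (Sum.map quditLabel quditLabel) = decoupledCode n := by
  rw [← signed_transformedCode]
  congr 1
  have h1 : decouplingStab n * checkerboardCode n * decouplingCircuit n =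
      Matrix.diagonal (fun i => ((stabSign i : ℤ) : R n)) *
        (translateStab n * transformedCode n *
          translateQudit n (0 : Fin 8) (![2, 2, 2] : Lattice)) *
        Matrix.diagonal (fun j : Fin 8 ⊕ Fin 8 => ((quditSign (Sum.elim id id j) : ℤ) : R n)) := by
    rw [← uMatrix_mul_checkerboardCode_mul_vMatrix hn, decouplingStab, decouplingCircuit,
      Matrix.fromBlocks_diagonal]
    simp only [Matrix.mul_assoc]
    congr! 8 with i
    cases i <;> rfl
  -- The only nonzero entry in the column of the `Z`- or `X`-operator of qudit `0` is the `1` in the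
  -- row of its own ancilla stabilizer, so translating the qudit and translating that stabilizer
  -- back cancel.
  have h2 : translateStab n * transformedCode n *
      translateQudit n (0 : Fin 8) (![2, 2, 2] : Lattice) = transformedCode n := by
    have hm := mono_mul_mono_neg (n := n) (![2, 2, 2] : Lattice)
    rw [translateStab, transformedCode_eq, translateQudit, Matrix.fromBlocks_multiply,
      Matrix.fromBlocks_multiply]
    simp only [Matrix.mul_zero, Matrix.zero_mul, add_zero, zero_add, Matrix.one_mul]
    congr 1
    · ext i j : 2
      rw [Matrix.mul_diagonal]
      fin_cases i <;> fin_cases j <;> simp [tTop]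
    · ext i j : 2
      rw [Matrix.mul_diagonal, Matrix.diagonal_mul]
      fin_cases i <;> fin_cases j <;> simp [tBottom]
      simpa [mul_comm] using hm
  rw [h1, h2]
  ext i j : 1
  rw [Matrix.mul_diagonal, Matrix.diagonal_mul, Matrix.of_apply]
  rw [Int.cast_mul]
  exact mul_right_comm _ _ _

theorem isUnit_decouplingStab (hn : Odd n) : IsUnit (decouplingStab n) := by
  have hm := mono_mul_mono_neg (n := n) (![2, 2, 2] : Lattice)
  refine IsUnit.mul ?_ (IsUnit.mul (isUnit_fromBlocks isUnit_one ?_) (isUnit_uMatrix hn))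
  · refine IsUnit.of_mul_eq_one (Matrix.diagonal fun i => ((stabSign i : ℤ) : R n)) ?_
    rw [Matrix.diagonal_mul_diagonal, ← Matrix.diagonal_one]
    congr 1
    funext i
    rw [← Int.cast_mul, ← Units.val_mul, Int.units_mul_self]
    simp
  · refine IsUnit.of_mul_eq_one
      (Matrix.diagonal ![mono n (![2, 2, 2] : Lattice), 1, 1, 1]) ?_
    rw [Matrix.diagonal_mul_diagonal, ← Matrix.diagonal_one]
    congr 1
    funext i
    fin_cases i
    · exact (mul_comm _ _).trans hm
    all_goals exact one_mul 1

/-- A sign is a unit of `ℤ_n` equal to its own inverse, so the matrix is a product of rescalings,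
one coordinate at a time. -/
theorem isCssCircuit_signs {ι : Type} [Fintype ι] [DecidableEq ι] (b : ι → ℤˣ) :
    IsCssCircuit (Matrix.fromBlocks (Matrix.diagonal fun i => ((b i : ℤ) : R n)) 0 0
      (Matrix.diagonal fun i => ((b i : ℤ) : R n))) := by
  have key : ∀ s : Finset ι, IsCssBlock
      (Matrix.diagonal fun i => if i ∈ s then ((b i : ℤ) : R n) else 1) := by
    intro s
    induction s using Finset.induction_on with
    | empty => simpa using isCssBlock_one
    | insert i s hi ih =>
      have h : IsCssBlock (Matrix.diagonal (Function.update 1 i ((b i : ℤ) : R n))) := by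
        rcases Int.units_eq_one_or (b i) with h | h
        · simpa [h] using isCssBlock_one
        · refine isCssBlock_scale i _ (-1) isUnit_one.neg ?_
          rw [scalar_neg_one, h]
          simp
      have h' := h.mul ih
      rw [Matrix.diagonal_mul_diagonal] at h'
      convert h' using 2
      funext k
      by_cases hk : k = i
      · subst hk
        simp [hi]
      · simp [hk]
  have h := key Finset.univ
  simp only [Finset.mem_univ, if_true] at h
  refine h.isCssCircuit ?_
  rw [dagger_diagonal, Matrix.diagonal_mul_diagonal, ← Matrix.diagonal_one]
  congr 1
  funext i
  rw [map_intCast, ← Int.cast_mul, ← Units.val_mul, Int.units_mul_self]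
  simp

theorem isCssCircuit_decouplingCircuit (hn : Odd n) : IsCssCircuit (decouplingCircuit n) :=
  Submonoid.mul_mem _ (isCssCircuit_vMatrix_mul_translateQudit hn) (isCssCircuit_signs _)

theorem finiteDepthEquivalent_checkerboardCode (hn : Odd n) :
    FiniteDepthEquivalent embed (checkerboardCode n) (decoupledCode n) :=
  ⟨stabLabel, quditLabel, decouplingStab n, decouplingCircuit n, isUnit_decouplingStab hn,
    (isCssCircuit_decouplingCircuit hn).isFiniteDepthCircuit embed, decoupling hn⟩

end Models

/-! ### Laurent polynomials: divisibility by `Δ` and augmentation. -/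

section Laurent

variable {n : ℕ}

theorem coeff_mono_mul {G : Type} [AddCommGroup G] (g h : G) (f : GroupRing n G) :
    (mono n g * f).coeff h = f.coeff (-g + h) := by
  rw [mono, AddMonoidAlgebra.coeff_single_mul_apply, one_mul]

theorem coeff_antipode {G : Type} [AddCommGroup G] (f : GroupRing n G) (g : G) :
    (antipode f).coeff g = f.coeff (-g) := by
  induction f using AddMonoidAlgebra.induction_linear with
  | zero => simp
  | add f g hf hg => simp [hf, hg]
  | single h c =>
    rw [antipode_single, AddMonoidAlgebra.coeff_single, AddMonoidAlgebra.coeff_single,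
      Finsupp.single_apply, Finsupp.single_apply]
    simp only [neg_eq_iff_eq_neg]

/-- A Laurent polynomial has finitely many coefficients. -/
theorem exists_coeff_eq_zero (f : LaurentPolynomial (ZMod n)) :
    ∃ m : ℤ, 0 < m ∧ ∀ i : ℤ, m ≤ |i| → f.coeff i = 0 := by
  refine ⟨∑ i ∈ f.coeff.support, |i| + 1, by positivity, fun i hi => ?_⟩
  by_contra h
  have h1 : |i| ≤ ∑ i ∈ f.coeff.support, |i| :=
    Finset.single_le_sum (f := fun i : ℤ => |i|) (fun j _ => abs_nonneg j)
      (Finsupp.mem_support_iff.2 h)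
  omega

/-- A Laurent polynomial invariant under a translation is zero. -/
theorem eq_zero_of_mono_mul_eq (k : ℤ) (hk : k ≠ 0) (f : LaurentPolynomial (ZMod n))
    (h : mono n k * f = f) : f = 0 := by
  have h1 : ∀ i, f.coeff i = f.coeff (-k + i) := fun i => by rw [← coeff_mono_mul, h]
  have h2 : ∀ (m : ℕ) (i : ℤ), f.coeff (i - m * k) = f.coeff i := by
    intro m
    induction m with
    | zero => simp
    | succ m ih =>
      intro i
      rw [← ih i, h1 (i - m * k)]
      congr 1
      push_cast
      ring
  obtain ⟨m, hm0, hm⟩ := exists_coeff_eq_zero f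
  ext i
  -- After `m + |i|` periods the index has absolute value at least `m`, where the coefficients
  -- vanish.
  rw [← h2 (m.toNat + i.natAbs) i, hm]
  · rfl
  · have h3 : (1 : ℤ) ≤ |k| := Int.one_le_abs hk
    have h4 : |((m.toNat + i.natAbs : ℕ) : ℤ) * k| = (m + |i|) * |k| := by
      rw [abs_mul, Nat.abs_cast]
      push_cast
      rw [Int.toNat_of_nonneg hm0.le]
    have h5 := abs_sub_abs_le_abs_sub (((m.toNat + i.natAbs : ℕ) : ℤ) * k) i
    rw [abs_sub_comm]
    nlinarith [abs_nonneg i]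

theorem antipode_delta : antipode (delta n) = deltaBar n := by
  simp [delta, deltaBar]

theorem antipode_deltaBar : antipode (deltaBar n) = delta n := by
  simp [delta, deltaBar]

/-- `Δ` and `Δ̄` are associates: divisibility by one is divisibility by the other, at the price of
the unit `-t`. -/
theorem delta_eq : delta n = -mono n (1 : ℤ) * deltaBar n := by
  have h := mono_mul_mono_neg (n := n) (1 : ℤ)
  rw [deltaBar, delta]
  linear_combination -h

/-- If `f Δ = 0` then `f = t f`, and a Laurent polynomial invariant under a shift vanishes; this
holds although `ℤ_n` may have zero divisors. -/
theorem eq_zero_of_mul_delta (f : LaurentPolynomial (ZMod n)) (h : f * delta n = 0) : f = 0 := by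
  refine eq_zero_of_mono_mul_eq 1 one_ne_zero f ?_
  rw [delta] at h
  linear_combination -h

theorem eq_zero_of_mul_deltaBar (f : LaurentPolynomial (ZMod n)) (h : f * deltaBar n = 0) :
    f = 0 := by
  refine eq_zero_of_mono_mul_eq (-1) (by norm_num) f ?_
  rw [deltaBar] at h
  linear_combination -h

theorem augment_single (k : ℤ) (c : ZMod n) :
    augment n (AddMonoidAlgebra.single k c) = c := by
  rw [augment, AddMonoidAlgebra.lift_single]
  simp

@[simp] theorem augment_mono (k : ℤ) : augment n (mono n k) = 1 := by
  rw [augment, mono, AddMonoidAlgebra.lift_single]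
  simp

theorem augment_delta : augment n (delta n) = 0 := by
  simp [delta]

theorem augment_deltaBar : augment n (deltaBar n) = 0 := by
  simp [deltaBar]

theorem delta_dvd_one_sub_mono (k : ℤ) : delta n ∣ 1 - mono n k := by
  have hnat : ∀ m : ℕ, delta n ∣ 1 - mono n (m : ℤ) := by
    intro m
    induction m with
    | zero => simp
    | succ m ih =>
      have : 1 - mono n ((m + 1 : ℕ) : ℤ) = (1 - mono n (m : ℤ)) + mono n (m : ℤ) * delta n := by
        rw [Nat.cast_succ, mono_add, delta]
        ring
      rw [this]
      exact dvd_add ih (dvd_mul_left _ _)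
  obtain ⟨m, rfl | rfl⟩ := k.eq_nat_or_neg
  · exact hnat m
  · have h := mono_mul_mono_neg (n := n) (m : ℤ)
    have : 1 - mono n (-(m : ℤ)) = -mono n (-(m : ℤ)) * (1 - mono n (m : ℤ)) := by
      linear_combination -h
    rw [this]
    exact (hnat m).mul_left _

/-- By linearity it is enough to treat monomials, where `Δ` divides `1 - t^k`. So the kernel of the
augmentation is the ideal generated by `Δ`. -/
theorem delta_dvd_sub_augment (f : LaurentPolynomial (ZMod n)) :
    delta n ∣ f - scalar ℤ (augment n f) := by
  induction f using AddMonoidAlgebra.induction_linear with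
  | zero => simp [scalar]
  | add f g hf hg =>
    have hs : scalar ℤ (augment n f + augment n g) =
        scalar ℤ (augment n f) + scalar ℤ (augment n g) := AddMonoidAlgebra.single_add ..
    rw [map_add, hs, add_sub_add_comm]
    exact dvd_add hf hg
  | single k c =>
    have h1 : (AddMonoidAlgebra.single k c : LaurentPolynomial (ZMod n)) =
        scalar ℤ c * mono n k := by
      rw [scalar, mono, AddMonoidAlgebra.single_mul_single, zero_add, mul_one]
    rw [augment_single, h1]
    have : scalar ℤ c * mono n k - scalar ℤ c = -scalar ℤ c * (1 - mono n k) := by ring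
    rw [this]
    exact (delta_dvd_one_sub_mono k).mul_left _

theorem delta_dvd_of_augment (f : LaurentPolynomial (ZMod n)) (h : augment n f = 0) :
    delta n ∣ f := by
  have := delta_dvd_sub_augment f
  rwa [h, scalar, AddMonoidAlgebra.single_zero, sub_zero] at this

/-- The possible divisors. -/
def IsDivisor (d : LaurentPolynomial (ZMod n)) : Prop := d = delta n ∨ d = deltaBar n

theorem IsDivisor.eq_zero {d : LaurentPolynomial (ZMod n)} (hd : IsDivisor d)
    (f : LaurentPolynomial (ZMod n)) (h : f * d = 0) : f = 0 := by
  rcases hd with rfl | rfl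
  exacts [eq_zero_of_mul_delta f h, eq_zero_of_mul_deltaBar f h]

theorem IsDivisor.augment_eq {d : LaurentPolynomial (ZMod n)} (hd : IsDivisor d) :
    augment n d = 0 := by
  rcases hd with rfl | rfl
  exacts [augment_delta, augment_deltaBar]

theorem IsDivisor.exists_mul {d : LaurentPolynomial (ZMod n)} (hd : IsDivisor d)
    (f : LaurentPolynomial (ZMod n)) (h : augment n f = 0) : ∃ q, f = q * d := by
  obtain ⟨q, hq⟩ := delta_dvd_of_augment f h
  rcases hd with rfl | rfl
  · exact ⟨q, by rw [hq, mul_comm]⟩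
  · refine ⟨-mono n 1 * q, ?_⟩
    rw [hq, delta_eq]
    ring

/-- The divisors are not zero divisors, so the quotient selected by choice is the only one. -/
theorem IsDivisor.divide_mul {d : LaurentPolynomial (ZMod n)} (hd : IsDivisor d)
    (f : LaurentPolynomial (ZMod n)) : divide (f * d) d = f := by
  have h : ∃ q, f * d = q * d := ⟨f, rfl⟩
  rw [divide, dif_pos h]
  have hc := h.choose_spec
  refine (sub_eq_zero.1 (hd.eq_zero _ ?_)).symm
  rw [sub_mul, ← hc, sub_self]

theorem IsDivisor.coeff_zero {d : LaurentPolynomial (ZMod n)} (hd : IsDivisor d) :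
    d.coeff 0 = 1 := by
  have h : ∀ k : ℤ, k ≠ 0 → (1 - mono n k).coeff 0 = 1 := by
    intro k hk
    rw [AddMonoidAlgebra.one_def, mono, AddMonoidAlgebra.coeff_sub, AddMonoidAlgebra.coeff_single,
      AddMonoidAlgebra.coeff_single, Finsupp.sub_apply, Finsupp.single_eq_same,
      Finsupp.single_eq_of_ne hk.symm, sub_zero]
  rcases hd with rfl | rfl
  exacts [h 1 one_ne_zero, h (-1) (by norm_num)]

end Laurent

/-! ### Projections of the group ring onto one direction, and their sections. -/

section Projection

variable (n : ℕ)

@[simp] theorem proj_single (μ : Fin 3) (g : Lattice) (c : ZMod n) :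
    proj n μ (AddMonoidAlgebra.single g c) = AddMonoidAlgebra.single (g μ) c := by
  simp [proj, AddMonoidAlgebra.mapDomain_single]

@[simp] theorem proj_mono (μ : Fin 3) (g : Lattice) : proj n μ (mono n g) = mono n (g μ) :=
  proj_single n μ g 1

/-- The inclusion `ℤ_n[t^±] → ℤ_n[x^±, y^±, z^±]` that sends `t` to `μ`. -/
noncomputable def incl (μ : Fin 3) : LaurentPolynomial (ZMod n) →+* R n :=
  AddMonoidAlgebra.mapDomainRingHom (ZMod n) (AddMonoidHom.single (fun _ : Fin 3 => ℤ) μ)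

@[simp] theorem incl_single (μ : Fin 3) (k : ℤ) (c : ZMod n) :
    incl n μ (AddMonoidAlgebra.single k c) = AddMonoidAlgebra.single (Pi.single μ k) c := by
  rw [incl, AddMonoidAlgebra.mapDomainRingHom_apply, AddMonoidAlgebra.mapDomain_single]
  rfl

@[simp] theorem proj_incl (μ : Fin 3) (f : LaurentPolynomial (ZMod n)) :
    proj n μ (incl n μ f) = f := by
  induction f using AddMonoidAlgebra.induction_linear with
  | zero => simp
  | add f g hf hg => simp [hf, hg]
  | single k c => rw [incl_single, proj_single, Pi.single_eq_same]

theorem proj_incl_of_ne {μ ν : Fin 3} (h : ν ≠ μ) (f : LaurentPolynomial (ZMod n)) :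
    proj n ν (incl n μ f) = scalar ℤ (augment n f) := by
  induction f using AddMonoidAlgebra.induction_linear with
  | zero => simp [scalar]
  | add f g hf hg =>
    rw [map_add, map_add, hf, hg, map_add]
    exact (AddMonoidAlgebra.single_add ..).symm
  | single k c =>
    rw [incl_single, proj_single, Pi.single_eq_of_ne h, augment_single]
    rfl

end Projection

/-! ### Coordinate planes -/

section Planes

theorem mem_plane (μ : Fin 3) (v : Space) : v ∈ plane μ ↔ v μ = 0 := by
  rw [plane, Submodule.mem_orthogonal_singleton_iff_inner_right, axis,
    EuclideanSpace.inner_single_left]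
  simp

theorem plane_injective : Function.Injective plane := by
  intro μ ν h
  by_contra hne
  have h1 : axis μ ∈ plane ν := by
    rw [mem_plane, axis]
    simp [Ne.symm hne]
  rw [← h, mem_plane, axis] at h1
  simp at h1

@[simp] theorem embed_apply (g : Lattice) (μ : Fin 3) : embed g μ = g μ := rfl

theorem embed_single (μ : Fin 3) : embed (Pi.single μ 1) = axis μ := by
  ext ν
  rw [embed_apply, axis]
  by_cases h : ν = μ
  · subst h
    simp
  · simp [h]

/-- The translations that preserve the coordinate planes with normals in `s`. -/
def coordSubgroup (s : Finset (Fin 3)) : AddSubgroup Lattice where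
  carrier := {g | ∀ μ ∈ s, g μ = 0}
  zero_mem' := fun _ _ => rfl
  add_mem' := fun {g h} hg hh μ hμ => by rw [Pi.add_apply, hg μ hμ, hh μ hμ, add_zero]
  neg_mem' := fun {g} hg μ hμ => by rw [Pi.neg_apply, hg μ hμ, neg_zero]

/-- A coordinate subgroup is free on the remaining coordinates. -/
noncomputable def coordSubgroupEquiv (s : Finset (Fin 3)) :
    coordSubgroup s ≃+ ({μ // μ ∉ s} → ℤ) where
  toFun g μ := g.1 μ.1
  invFun f := ⟨fun μ => if h : μ ∉ s then f ⟨μ, h⟩ else 0, fun μ hμ => dif_neg (not_not.2 hμ)⟩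
  left_inv g := by
    ext μ
    by_cases h : μ ∉ s
    · exact dif_pos h
    · exact (dif_neg h).trans (g.2 μ (not_not.1 h)).symm
  right_inv f := by
    funext μ
    exact dif_pos μ.2
  map_add' _ _ := rfl

/-- The subgroup is free on the `3 - s.card` remaining coordinates, and the rank is an invariant. -/
theorem nonempty_coordSubgroup_equiv (s : Finset (Fin 3)) (k : ℕ) :
    Nonempty (coordSubgroup s ≃+ (Fin k → ℤ)) ↔ s.card + k = 3 := by
  have hc : Fintype.card {μ // μ ∉ s} = 3 - s.card := by
    rw [Fintype.card_subtype_compl, Fintype.card_coe, Fintype.card_fin]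
  have hs : s.card ≤ 3 := s.card_le_univ
  constructor
  · rintro ⟨e⟩
    have h := ((coordSubgroupEquiv s).symm.trans e).toIntLinearEquiv.finrank_eq
    rw [Module.finrank_fintype_fun_eq_card, Module.finrank_fintype_fun_eq_card, Fintype.card_fin,
      hc] at h
    omega
  · intro h
    have e := Fintype.equivFinOfCardEq (n := k) (hc.trans (by omega))
    exact ⟨(coordSubgroupEquiv s).trans
      (LinearEquiv.funCongrLeft ℤ ℤ e.symm).toAddEquiv⟩

theorem span_embed_coordSubgroup (μ : Fin 3) :
    Submodule.span ℝ (embed '' (coordSubgroup {μ} : Set Lattice)) = plane μ := by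
  apply le_antisymm
  · rw [Submodule.span_le]
    rintro _ ⟨g, hg, rfl⟩
    rw [SetLike.mem_coe, mem_plane, embed_apply, hg μ (Finset.mem_singleton_self _), Int.cast_zero]
  · intro v hv
    rw [mem_plane] at hv
    have hsum : v = ∑ ν, v ν • axis ν := by
      ext i
      simp [axis, Fin.sum_univ_three]
      fin_cases i <;> simp
    rw [hsum]
    refine Submodule.sum_mem _ fun ν _ => ?_
    by_cases h : ν = μ
    · rw [h, hv, zero_smul]
      exact Submodule.zero_mem _
    · refine Submodule.smul_mem _ _ (Submodule.subset_span ⟨Pi.single ν 1, ?_, embed_single ν⟩)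
      intro κ hκ
      rw [Finset.mem_singleton.1 hκ, Pi.single_eq_of_ne (Ne.symm h)]

end Planes

/-! ### Mobility of sectors, and data whose generators come in pairs. -/

namespace PlaneChargeData

variable {n : ℕ} {I J : Type} [Fintype I] (D : PlaneChargeData n I J)

theorem smul_apply (r : GroupRing n Lattice) (x : D.sectors) (i : I) :
    (r • x).1 i = proj n (D.dir i) r * x.1 i := rfl

/-- The set of normal directions of the planes in which the components of `x` live. -/
noncomputable def support (x : D.sectors) : Finset (Fin 3) :=
  Finset.univ.filter fun μ => ∃ i, D.dir i = μ ∧ x.1 i ≠ 0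

theorem mem_support {x : D.sectors} {μ : Fin 3} :
    μ ∈ D.support x ↔ ∃ i, D.dir i = μ ∧ x.1 i ≠ 0 := by
  simp [support]

/-- On a coordinate of direction `μ`, `g` multiplies by `t ^ g μ`, which fixes a nonzero Laurent
polynomial only if `g μ = 0`. Mobility is therefore read off from the number of directions in the
support. -/
theorem stab_eq (x : D.sectors) : D.toPTheory.stab x = coordSubgroup (D.support x) := by
  ext g
  change mono n g • x = x ↔ ∀ μ ∈ D.support x, g μ = 0
  constructor
  · intro h μ hμ
    obtain ⟨i, rfl, hi⟩ := D.mem_support.1 hμ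
    by_contra hg
    refine hi (eq_zero_of_mono_mul_eq _ hg _ ?_)
    have h1 : (mono n g • x).1 i = x.1 i := by rw [h]
    rwa [smul_apply, proj_mono] at h1
  · intro h
    apply Subtype.ext
    funext i
    rw [smul_apply, proj_mono]
    by_cases hi : x.1 i = 0
    · rw [hi, mul_zero]
    · rw [h (D.dir i) (D.mem_support.2 ⟨i, rfl, hi⟩), mono_zero, one_mul]

theorem isPlanon_iff (x : D.sectors) :
    D.toPTheory.IsPlanon x ↔ ∃ μ, D.support x = {μ} := by
  unfold PTheory.IsPlanon
  rw [stab_eq, nonempty_coordSubgroup_equiv, ← Finset.card_eq_one]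
  omega

theorem orientation_eq {x : D.sectors} {μ : Fin 3} (h : D.support x = {μ}) :
    D.toPTheory.orientation x = plane μ := by
  unfold PTheory.orientation
  rw [stab_eq, h, span_embed_coordSubgroup]

theorem exists_eq_plane {a : Submodule ℝ Space} (ha : a ∈ D.toPTheory.orientations) :
    ∃ μ, a = plane μ := by
  obtain ⟨p, hp, rfl⟩ := ha
  obtain ⟨μ, hμ⟩ := (D.isPlanon_iff p).1 hp
  exact ⟨μ, D.orientation_eq hμ⟩

theorem support_eq_singleton {x : D.sectors} {μ : Fin 3} (hx : x ≠ 0)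
    (h : ∀ i, D.dir i ≠ μ → x.1 i = 0) : D.support x = {μ} := by
  have h1 : ∃ i, x.1 i ≠ 0 := by
    by_contra! h0
    exact hx (Subtype.ext (funext h0))
  obtain ⟨i, hi⟩ := h1
  have h2 : ∀ j, x.1 j ≠ 0 → D.dir j = μ := fun j hj => by
    by_contra hd
    exact hj (h j hd)
  ext ν
  rw [mem_support, Finset.mem_singleton]
  constructor
  · rintro ⟨j, rfl, hj⟩
    exact h2 j hj
  · rintro rfl
    exact ⟨i, h2 i hi, hi⟩

theorem plane_mem_orientations {x : D.sectors} {μ : Fin 3} (hx : x ≠ 0)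
    (h : ∀ i, D.dir i ≠ μ → x.1 i = 0) : plane μ ∈ D.toPTheory.orientations :=
  ⟨x, (D.isPlanon_iff x).2 ⟨μ, D.support_eq_singleton hx h⟩,
    D.orientation_eq (D.support_eq_singleton hx h)⟩

/-- The planons of one orientation, together with `0`, already form a submodule, so taking the span
adds nothing else. -/
theorem mem_planons_iff (x : D.sectors) (μ : Fin 3) :
    x ∈ D.toPTheory.planons (plane μ) ↔ ∀ i, D.dir i ≠ μ → x.1 i = 0 := by
  constructor
  · intro hx
    have key : ∀ y : D.toPTheory.S, y ∈ D.toPTheory.planons (plane μ) →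
        ∀ i, D.dir i ≠ μ → (show D.sectors from y).1 i = 0 := by
      intro y hy
      refine Submodule.span_induction (p := fun (z : D.toPTheory.S) _ => ∀ i, D.dir i ≠ μ →
        (show D.sectors from z).1 i = 0) ?_ ?_ ?_ ?_ hy
      · rintro p ⟨hp, hpo⟩ i hi
        obtain ⟨ν, hν⟩ := (D.isPlanon_iff p).1 hp
        rw [D.orientation_eq hν] at hpo
        have hνμ := plane_injective hpo
        subst hνμ
        by_contra h0
        have := D.mem_support.2 ⟨i, rfl, h0⟩
        rw [hν, Finset.mem_singleton] at this
        exact hi this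
      · intro i _
        rfl
      · intro p q _ _ hp hq i hi
        change (show D.sectors from p).1 i + (show D.sectors from q).1 i = 0
        rw [hp i hi, hq i hi, add_zero]
      · intro r p _ hp i hi
        change proj n (D.dir i) r * (show D.sectors from p).1 i = 0
        rw [hp i hi, mul_zero]
    exact key x hx
  · intro h
    by_cases hx : x = 0
    · rw [hx]
      exact Submodule.zero_mem _
    · have hs := D.support_eq_singleton hx h
      exact Submodule.subset_span ⟨(D.isPlanon_iff x).2 ⟨μ, hs⟩, D.orientation_eq hs⟩

theorem normal_plane (μ : Fin 3) : D.toPTheory.normal (plane μ) = axis μ := by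
  change (∑ ν, if plane μ = plane ν then axis ν else 0) = axis μ
  simp [plane_injective.eq_iff]

theorem form_plane (μ : Fin 3) (p x : D.sectors) :
    D.toPTheory.form (plane μ) p x = (D.pairing μ p.1 x.1).coeff 0 := by
  change (∑ ν, if plane μ = plane ν then (D.pairing ν p.1 x.1).coeff 0 else 0) = _
  simp [plane_injective.eq_iff]

/-- Data in which the generators are paired by an involution `σ`, and `sgn` gives the signs of the
statistics. -/
structure IsPaired (D : PlaneChargeData n I J) (σ : I → I) (sgn : I → ℤˣ) : Prop where
  involutive : ∀ i, σ (σ i) = i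
  dir_eq : ∀ i, D.dir (σ i) = D.dir i
  sgn_eq : ∀ i, sgn (σ i) = sgn i
  isDivisor : ∀ i, IsDivisor (D.divisor i)
  divisor_eq : ∀ i, D.divisor (σ i) = antipode (n := n) (G := ℤ) (D.divisor i)
  stat_eq : ∀ i j, D.stat i j = if j = σ i then ((sgn i : ℤ) : LaurentPolynomial (ZMod n)) else 0
  independent : ∀ (μ : Fin 3) (c : I → ZMod n), (∀ i, D.dir i ≠ μ → c i = 0) →
    (∀ j, ∑ i, c i * D.constraint i j = 0) → ∀ i, c i = 0

namespace IsPaired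

variable {D} {σ : I → I} {sgn : I → ℤˣ}

theorem pairing_eq (hD : D.IsPaired σ sgn) (μ : Fin 3) (p x : D.Q) : D.pairing μ p x = ∑ i, if D.dir i = μ then
    divide (p i) (D.divisor i) * ((sgn i : ℤ) : LaurentPolynomial (ZMod n)) *
      antipode (n := n) (G := ℤ) (x (σ i)) else 0 := by
  unfold pairing
  refine Finset.sum_congr rfl fun i _ => ?_
  rw [Finset.sum_eq_single (σ i)]
  · simp only [hD.dir_eq, and_self, hD.stat_eq, if_true]
  · intro j _ hj
    rw [hD.stat_eq, if_neg hj]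
    simp
  · intro h
    exact absurd (Finset.mem_univ _) h

/-- The augmentations of the coordinates satisfy all constraints and are concentrated in one
direction, so `independent` makes them vanish, and a coordinate of augmentation zero is a multiple
of the divisor. -/
theorem exists_quotient (hD : D.IsPaired σ sgn) {μ : Fin 3} {p : D.sectors}
    (hp : ∀ i, D.dir i ≠ μ → p.1 i = 0) (i : I) :
    ∃ q, p.1 i = q * D.divisor i := by
  refine (hD.isDivisor i).exists_mul _ ?_
  refine hD.independent μ (fun i => augment n (p.1 i)) (fun i hi => ?_) (fun j => ?_) i
  · simp only [hp i hi, map_zero]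
  · exact congrFun p.2 j

end IsPaired

end PlaneChargeData

/-! ### The laws of a p-theory for paired data. -/

namespace PlaneChargeData

variable {n : ℕ} {I J : Type} [Fintype I] {D : PlaneChargeData n I J}

namespace IsPaired

variable {σ : I → I} {sgn : I → ℤˣ}

/-- This trades the choice in `divide` for arbitrary explicit quotients; every later computation of
the statistics goes through it. -/
theorem pairing_of_quotient (hD : D.IsPaired σ sgn) {μ : Fin 3} {p : D.Q}
    {a : I → LaurentPolynomial (ZMod n)} (ha : ∀ i, D.dir i = μ → p i = a i * D.divisor i)
    (x : D.Q) : D.pairing μ p x = ∑ i, if D.dir i = μ then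
      a i * ((sgn i : ℤ) : LaurentPolynomial (ZMod n)) *
        antipode (n := n) (G := ℤ) (x (σ i)) else 0 := by
  rw [hD.pairing_eq]
  refine Finset.sum_congr rfl fun i _ => ?_
  split_ifs with h
  · rw [ha i h, (hD.isDivisor i).divide_mul]
  · rfl

theorem pairing_add_left (hD : D.IsPaired σ sgn) {μ : Fin 3} {p q : D.sectors}
    (hp : ∀ i, D.dir i ≠ μ → p.1 i = 0) (hq : ∀ i, D.dir i ≠ μ → q.1 i = 0) (x : D.Q) :
    D.pairing μ (p + q).1 x = D.pairing μ p.1 x + D.pairing μ q.1 x := by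
  choose a ha using hD.exists_quotient hp
  choose b hb using hD.exists_quotient hq
  have hab : ∀ i, (p + q).1 i = (a i + b i) * D.divisor i := fun i => by
    rw [add_mul, ← ha, ← hb]
    rfl
  rw [hD.pairing_of_quotient (fun i _ => ha i), hD.pairing_of_quotient (fun i _ => hb i),
    hD.pairing_of_quotient (fun i _ => hab i), ← Finset.sum_add_distrib]
  refine Finset.sum_congr rfl fun i _ => ?_
  split_ifs
  · ring
  · rw [add_zero]

theorem pairing_add_right (hD : D.IsPaired σ sgn) (μ : Fin 3) (p x y : D.Q) :
    D.pairing μ p (x + y) = D.pairing μ p x + D.pairing μ p y := by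
  rw [hD.pairing_eq, hD.pairing_eq, hD.pairing_eq, ← Finset.sum_add_distrib]
  refine Finset.sum_congr rfl fun i _ => ?_
  have h : (x + y) (σ i) = x (σ i) + y (σ i) := rfl
  split_ifs
  · rw [h, map_add, mul_add]
  · rw [add_zero]

theorem pairing_smul_left (hD : D.IsPaired σ sgn) {μ : Fin 3} {p : D.sectors}
    (hp : ∀ i, D.dir i ≠ μ → p.1 i = 0) (r : R n) (x : D.Q) :
    D.pairing μ (r • p).1 x = proj n μ r * D.pairing μ p.1 x := by
  choose a ha using hD.exists_quotient hp
  have hr : ∀ i, D.dir i = μ → (r • p).1 i = (proj n μ r * a i) * D.divisor i := fun i hi => by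
    rw [mul_assoc, ← ha, smul_apply, hi]
  rw [hD.pairing_of_quotient (fun i _ => ha i), hD.pairing_of_quotient hr, Finset.mul_sum]
  refine Finset.sum_congr rfl fun i _ => ?_
  split_ifs
  · ring
  · rw [mul_zero]

theorem pairing_smul_right (hD : D.IsPaired σ sgn) (μ : Fin 3) (p : D.Q) (r : R n)
    (x : D.sectors) :
    D.pairing μ p (r • x).1 = antipode (proj n μ r) * D.pairing μ p x.1 := by
  rw [hD.pairing_eq, hD.pairing_eq, Finset.mul_sum]
  refine Finset.sum_congr rfl fun i _ => ?_
  split_ifs with h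
  · rw [smul_apply, hD.dir_eq, h, map_mul]
    ring
  · rw [mul_zero]

/-- After reindexing by `σ`, both sides are sums of a quotient for `p`, the antipode of a quotient
for `q`, a sign and a divisor; they agree because the paired divisors are antipodal and the paired
signs are equal. -/
theorem pairing_symm (hD : D.IsPaired σ sgn) {μ : Fin 3} {p q : D.sectors}
    (hp : ∀ i, D.dir i ≠ μ → p.1 i = 0) (hq : ∀ i, D.dir i ≠ μ → q.1 i = 0) :
    D.pairing μ p.1 q.1 = antipode (D.pairing μ q.1 p.1) := by
  choose a ha using hD.exists_quotient hp
  choose b hb using hD.exists_quotient hq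
  have hinv : Function.Involutive σ := hD.involutive
  rw [hD.pairing_of_quotient (fun i _ => ha i), hD.pairing_of_quotient (fun i _ => hb i), map_sum,
    ← Equiv.sum_comp (hinv.toPerm)]
  refine Finset.sum_congr rfl fun i _ => ?_
  rw [Function.Involutive.coe_toPerm, hD.dir_eq, hD.sgn_eq, hD.involutive]
  split_ifs
  · rw [ha (σ i), hb i, hD.divisor_eq]
    simp only [map_mul, antipode_antipode, map_intCast]
    ring
  · simp

theorem form_add_left (hD : D.IsPaired σ sgn) {μ : Fin 3} {p q : D.sectors}
    (hp : ∀ i, D.dir i ≠ μ → p.1 i = 0) (hq : ∀ i, D.dir i ≠ μ → q.1 i = 0) (x : D.sectors) :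
    D.toPTheory.form (plane μ) (p + q) x =
      D.toPTheory.form (plane μ) p x + D.toPTheory.form (plane μ) q x := by
  rw [D.form_plane, D.form_plane, D.form_plane, hD.pairing_add_left hp hq,
    AddMonoidAlgebra.coeff_add, Finsupp.add_apply]

theorem form_add_right (hD : D.IsPaired σ sgn) (μ : Fin 3) (p x y : D.sectors) :
    D.toPTheory.form (plane μ) p (x + y) =
      D.toPTheory.form (plane μ) p x + D.toPTheory.form (plane μ) p y := by
  have h : (x + y).1 = x.1 + y.1 := rfl
  rw [D.form_plane, D.form_plane, D.form_plane, h, hD.pairing_add_right,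
    AddMonoidAlgebra.coeff_add, Finsupp.add_apply]

theorem form_smul_smul (hD : D.IsPaired σ sgn) {μ : Fin 3} {p : D.sectors}
    (hp : ∀ i, D.dir i ≠ μ → p.1 i = 0) (x : D.sectors) (g : Lattice) :
    D.toPTheory.form (plane μ) (mono n g • p) (mono n g • x) =
      D.toPTheory.form (plane μ) p x := by
  rw [D.form_plane, D.form_plane, hD.pairing_smul_left hp, hD.pairing_smul_right, proj_mono,
    antipode_mono, ← mul_assoc, mono_mul_mono_neg, one_mul]

theorem form_symm (hD : D.IsPaired σ sgn) {μ : Fin 3} {p q : D.sectors}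
    (hp : ∀ i, D.dir i ≠ μ → p.1 i = 0) (hq : ∀ i, D.dir i ≠ μ → q.1 i = 0) :
    D.toPTheory.form (plane μ) p q = D.toPTheory.form (plane μ) q p := by
  rw [D.form_plane, D.form_plane, hD.pairing_symm hp hq, coeff_antipode, neg_zero]

/-- If `g μ` were zero, `g` would fix `p`. So `i • g` shifts the polynomial pairing by `i * g μ`,
which eventually moves its finite support away from degree `0`. -/
theorem form_local (hD : D.IsPaired σ sgn) {μ : Fin 3} {p : D.sectors}
    (hp : ∀ i, D.dir i ≠ μ → p.1 i = 0) (x : D.sectors) (g : Lattice)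
    (hg : ∀ i : ℤ, mono n (i • g) • p = p → i = 0) :
    ∃ m : ℤ, ∀ i : ℤ, m ≤ |i| → D.toPTheory.form (plane μ) (mono n (i • g) • p) x = 0 := by
  have hgμ : g μ ≠ 0 := by
    intro h0
    refine one_ne_zero (hg 1 ?_)
    rw [one_smul]
    refine Subtype.ext (funext fun i => ?_)
    rw [D.smul_apply]
    by_cases hi : D.dir i = μ
    · rw [hi, proj_mono, h0, mono_zero, one_mul]
    · rw [hp i hi, mul_zero]
  obtain ⟨m, hm0, hm⟩ := exists_coeff_eq_zero (D.pairing μ p.1 x.1)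
  refine ⟨m, fun i hi => ?_⟩
  rw [D.form_plane, hD.pairing_smul_left hp, proj_mono, coeff_mono_mul, add_zero]
  refine hm _ ?_
  rw [abs_neg, Pi.smul_apply, smul_eq_mul, abs_mul]
  have : 1 ≤ |g μ| := Int.one_le_abs hgμ
  nlinarith [abs_nonneg i]

/-- A nonzero coordinate `x i` is detected by a planon supported on the partner `σ i`, translated so
that a nonzero coefficient of `x i` reaches degree `0`. -/
theorem exists_form_ne_zero (hD : D.IsPaired σ sgn) (hn : 1 < n) {x : D.sectors} (hx : x ≠ 0) :
    ∃ μ, ∃ p : D.sectors, p ≠ 0 ∧ (∀ i, D.dir i ≠ μ → p.1 i = 0) ∧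
      D.toPTheory.form (plane μ) p x ≠ 0 := by
  have : Fact (1 < n) := ⟨hn⟩
  have h1 : ∃ i, x.1 i ≠ 0 := by
    by_contra! h0
    exact hx (Subtype.ext (funext h0))
  obtain ⟨i, hi⟩ := h1
  have h2 : ∃ k, (antipode (n := n) (G := ℤ) (x.1 i)).coeff k ≠ 0 := by
    by_contra! h0
    have : antipode (n := n) (G := ℤ) (x.1 i) = 0 := AddMonoidAlgebra.ext (Finsupp.ext h0)
    exact hi (by rw [← antipode_antipode (n := n) (G := ℤ) (x.1 i), this, map_zero])
  obtain ⟨k, hk⟩ := h2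
  -- Multiplying by `t⁻ᵏ` brings the coefficient at `k` to degree `0`. The factor `divisor` has
  -- augmentation zero, so `p` satisfies the constraints.
  let a : I → LaurentPolynomial (ZMod n) := fun j => if j = σ i then mono n (-k) else 0
  let p : D.sectors := ⟨fun j => a j * D.divisor j, by
    funext j
    refine Finset.sum_eq_zero fun l _ => ?_
    rw [map_mul, (hD.isDivisor l).augment_eq, mul_zero, zero_mul]⟩
  have hp : ∀ j, D.dir j ≠ D.dir i → p.1 j = 0 := by
    intro j hj
    have : j ≠ σ i := by
      rintro rfl
      exact hj (hD.dir_eq i)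
    change (if j = σ i then mono n (-k) else 0) * D.divisor j = 0
    rw [if_neg this, zero_mul]
  have hform : D.toPTheory.form (plane (D.dir i)) p x ≠ 0 := by
    rw [D.form_plane, hD.pairing_of_quotient (a := a) (fun j _ => rfl),
      Finset.sum_eq_single (σ i)]
    · rw [if_pos (hD.dir_eq i), hD.involutive, hD.sgn_eq]
      change ((if σ i = σ i then mono n (-k) else 0) * _ * _ : LaurentPolynomial (ZMod n)).coeff 0
        ≠ 0
      rw [if_pos rfl, mul_assoc, coeff_mono_mul, neg_neg, add_zero]
      rcases Int.units_eq_one_or (sgn i) with h | h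
      · simpa [h] using hk
      · simpa [h] using hk
    · intro j _ hj
      have : a j = 0 := if_neg hj
      rw [this]
      simp
    · intro h
      exact absurd (Finset.mem_univ _) h
  refine ⟨D.dir i, p, ?_, hp, hform⟩
  intro h0
  apply hform
  -- Additivity at `0 + 0` shows that the form vanishes at the zero planon.
  have h3 := hD.form_add_left (p := 0) (q := 0) (μ := D.dir i) (fun _ _ => rfl) (fun _ _ => rfl) x
  rw [add_zero] at h3
  rw [h0]
  simpa using h3

theorem isPModular (hD : D.IsPaired σ sgn) (hn : 1 < n) : D.toPTheory.IsPModular := by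
  intro x hx
  obtain ⟨μ, p, hp0, hp, hform⟩ := hD.exists_form_ne_zero hn (x := x) hx
  exact ⟨plane μ, D.plane_mem_orientations hp0 hp, p, (D.mem_planons_iff p μ).2 hp, hform⟩

end IsPaired

theorem eq_zero_of_isFullyMobile (D : PlaneChargeData n I J) (x : D.sectors)
    (hx : D.toPTheory.IsFullyMobile x) : x = 0 := by
  unfold PTheory.IsFullyMobile at hx
  rw [D.stab_eq, nonempty_coordSubgroup_equiv] at hx
  have h0 : D.support x = ∅ := Finset.card_eq_zero.1 (by omega)
  refine Subtype.ext (funext fun i => ?_)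
  by_contra hi
  have := D.mem_support.2 ⟨i, rfl, hi⟩
  rw [h0] at this
  exact absurd this (Finset.notMem_empty _)

/-- `Q` is a quotient of a free module of finite rank, because each projection is surjective; the
group ring is Noetherian, so the submodule of sectors is finitely generated too. -/
theorem finite_sectors (D : PlaneChargeData n I J) [NeZero n] :
    Module.Finite (GroupRing n Lattice) D.sectors := by
  let f : (I → R n) →ₗ[R n] D.Q :=
    { toFun := fun r i => proj n (D.dir i) (r i)
      map_add' := fun r s => funext fun i => map_add _ _ _
      map_smul' := fun r s => funext fun i => map_mul _ _ _ }
  have hf : Function.Surjective f := by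
    intro q
    exact ⟨fun i => incl n (D.dir i) (q i), funext fun i => proj_incl n _ _⟩
  have : IsNoetherianRing (R n) := Algebra.FiniteType.isNoetherianRing (ZMod n) (R n)
  have : Module.Finite (R n) D.Q := Module.Finite.of_surjective f hf
  infer_instance

/-- `n` acts as zero. Conversely, a sector whose only coordinate is a divisor, of constant
coefficient `1`, has additive order a multiple of `n`. -/
theorem exponent_sectors [Nonempty I] {σ : I → I} {sgn : I → ℤˣ} (hD : D.IsPaired σ sgn) :
    AddMonoid.exponent D.sectors = n := by
  apply Nat.dvd_antisymm
  · refine AddMonoid.exponent_dvd_of_forall_nsmul_eq_zero fun x => ?_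
    have h : ((n : ℕ) : R n) = 0 := by
      rw [← map_natCast (algebraMap (ZMod n) (R n)), ZMod.natCast_self, map_zero]
    rw [← Nat.cast_smul_eq_nsmul (R n), h, zero_smul]
  · obtain ⟨i⟩ := ‹Nonempty I›
    let p : D.sectors := ⟨fun j => (if j = i then 1 else 0) * D.divisor j, by
      funext j
      refine Finset.sum_eq_zero fun l _ => ?_
      rw [map_mul, (hD.isDivisor l).augment_eq, mul_zero, zero_mul]⟩
    have h := AddMonoid.exponent_nsmul_eq_zero p
    rw [← Nat.cast_smul_eq_nsmul (R n)] at h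
    have h1 : ((AddMonoid.exponent D.sectors : R n) • p).1 i = 0 := by
      rw [h]
      rfl
    rw [smul_apply, map_natCast] at h1
    change _ * ((if i = i then 1 else 0) * D.divisor i) = 0 at h1
    rw [if_pos rfl, one_mul, ← nsmul_eq_mul] at h1
    have h2 := congrArg (fun f : LaurentPolynomial (ZMod n) => f.coeff 0) h1
    simp only [AddMonoidAlgebra.coeff_smul_apply, (hD.isDivisor i).coeff_zero] at h2
    rw [nsmul_eq_mul, mul_one] at h2
    exact (ZMod.natCast_eq_zero_iff _ _).1 h2

theorem IsPaired.isPTheory [Nonempty I] [NeZero n] {σ : I → I} {sgn : I → ℤˣ}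
    (hD : D.IsPaired σ sgn) : D.toPTheory.IsPTheory where
  lattice := by
    refine ⟨Pi.basisFun ℤ (Fin 3), ?_⟩
    have h : (fun i => embed (Pi.basisFun ℤ (Fin 3) i)) =
        EuclideanSpace.basisFun (Fin 3) ℝ := by
      funext i
      rw [Pi.basisFun_apply, embed_single, EuclideanSpace.basisFun_apply, axis]
    rw [h]
    exact (EuclideanSpace.basisFun (Fin 3) ℝ).orthonormal.linearIndependent
  finite := D.finite_sectors
  exponent := exponent_sectors hD
  not_mobile := D.eq_zero_of_isFullyMobile
  normal_spec := by
    intro a ha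
    obtain ⟨μ, rfl⟩ := D.exists_eq_plane ha
    rw [D.normal_plane]
    refine ⟨by simp [axis], fun v hv => ?_⟩
    rw [plane, Submodule.mem_orthogonal_singleton_iff_inner_right] at hv
    exact hv
  translation := by
    intro a ha p hp x g
    obtain ⟨μ, rfl⟩ := D.exists_eq_plane ha
    exact hD.form_smul_smul ((D.mem_planons_iff p μ).1 hp) x g
  add_left := by
    intro a ha p hp q hq x
    obtain ⟨μ, rfl⟩ := D.exists_eq_plane ha
    exact hD.form_add_left ((D.mem_planons_iff p μ).1 hp) ((D.mem_planons_iff q μ).1 hq) x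
  add_right := by
    intro a ha p _ x y
    obtain ⟨μ, rfl⟩ := D.exists_eq_plane ha
    exact hD.form_add_right μ p x y
  symm := by
    intro a ha p hp q hq
    obtain ⟨μ, rfl⟩ := D.exists_eq_plane ha
    exact hD.form_symm ((D.mem_planons_iff p μ).1 hp) ((D.mem_planons_iff q μ).1 hq)
  locality := by
    intro a ha p hp x g hg
    obtain ⟨μ, rfl⟩ := D.exists_eq_plane ha
    exact hD.form_local ((D.mem_planons_iff p μ).1 hp) x g hg

end PlaneChargeData

/-! ### The anisotropic and checkerboard data, and the isomorphism of their modules. -/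

section Data

variable (n : ℕ)

theorem sum_sector {A : Type} [AddCommMonoid A] (f : Sector → A) :
    ∑ s, f s = f Sector.e + f Sector.m := by
  rw [show (Finset.univ : Finset Sector) = {Sector.e, Sector.m} from rfl,
    Finset.sum_pair (by decide)]

/-- The exchange of the two sectors. -/
def Sector.swap : Sector → Sector
  | .e => .m
  | .m => .e

theorem fin_three_add_one_one (μ : Fin 3) : μ + 1 + 1 = μ + 2 := by revert μ; decide

theorem fin_three_add_one_two (μ : Fin 3) : μ + 1 + 2 = μ := by revert μ; decide

theorem fin_three_add_two_one (μ : Fin 3) : μ + 2 + 1 = μ := by revert μ; decide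

theorem fin_three_add_two_two (μ : Fin 3) : μ + 2 + 2 = μ + 1 := by revert μ; decide

theorem fin_three_add_one_ne (μ : Fin 3) : μ + 1 ≠ μ := by revert μ; decide

theorem fin_three_add_two_ne (μ : Fin 3) : μ + 2 ≠ μ := by revert μ; decide

theorem sum_anisotropic_constraint (μ : Fin 3) (c : Fin 2 × Sector → ZMod n) (s : Sector) :
    ∑ i, c i * (anisotropicData n μ).constraint i s =
      match s with
      | .e => c (0, .e) - c (1, .e)
      | .m => c (0, .m) + c (1, .m) := by
  cases s <;> simp [Fintype.sum_prod_type, sum_sector, anisotropicData] <;> ring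

theorem sum_checkerboard_constraint (c : Fin 3 × Fin 2 × Sector → ZMod n) (μ : Fin 3)
    (s : Sector) : ∑ i, c i * (checkerboardData n).constraint i (μ, s) =
      c (μ, 1, s) + c (μ + 2, 0, s) - c (μ + 1, 0, s) := by
  fin_cases μ <;> cases s <;>
    simp [Fintype.sum_prod_type, sum_sector, checkerboardData, Fin.sum_univ_three] <;> ring

theorem isPaired_anisotropicData (μ : Fin 3) :
    (anisotropicData n μ).IsPaired (fun i => (i.1, i.2.swap)) (fun _ => 1) where
  involutive := by rintro ⟨k, s⟩; cases s <;> rfl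
  dir_eq _ := rfl
  sgn_eq _ := rfl
  isDivisor := by
    rintro ⟨k, s⟩
    cases s
    exacts [Or.inl rfl, Or.inr rfl]
  divisor_eq := by
    rintro ⟨k, s⟩
    cases s
    exacts [antipode_delta.symm, antipode_deltaBar.symm]
  stat_eq := by
    rintro ⟨k, s⟩ ⟨l, s'⟩
    cases s <;> cases s' <;> simp [anisotropicData, Sector.swap, eq_comm]
  independent := by
    intro ν c hc h
    have he := (sum_anisotropic_constraint n μ c .e).symm.trans (h .e)
    have hm := (sum_anisotropic_constraint n μ c .m).symm.trans (h .m)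
    simp only at he hm
    -- The two branches have different directions, so within one direction at most one of them
    -- carries charge, and each constraint then involves a single coefficient.
    have h01 : (∀ s, c (0, s) = 0) ∨ (∀ s, c (1, s) = 0) := by
      by_cases h0 : μ + 1 = ν
      · refine Or.inr fun s => hc _ ?_
        change μ + 2 ≠ ν
        rw [← h0, Ne, add_right_inj]
        decide
      · exact Or.inl fun s => hc _ h0
    rintro ⟨k, s⟩
    rcases h01 with h0 | h0 <;> rw [h0] at he hm <;> fin_cases k <;> cases s <;> simp_all

theorem isPaired_checkerboardData :
    (checkerboardData n).IsPaired (fun i => (i.1, 1 - i.2.1, i.2.2.swap))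
      (fun i => if i.2 = (0, Sector.e) ∨ i.2 = (1, Sector.m) then 1 else -1) where
  involutive := by rintro ⟨μ, k, s⟩; fin_cases k <;> cases s <;> rfl
  dir_eq _ := rfl
  sgn_eq := by rintro ⟨μ, k, s⟩; fin_cases k <;> cases s <;> simp [Sector.swap]
  isDivisor := by
    rintro ⟨μ, k, s⟩
    fin_cases k
    exacts [Or.inl rfl, Or.inr rfl]
  divisor_eq := by
    rintro ⟨μ, k, s⟩
    fin_cases k
    exacts [antipode_delta.symm, antipode_deltaBar.symm]
  stat_eq := by
    rintro ⟨μ, k, s⟩ ⟨ν, l, s'⟩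
    fin_cases k <;> fin_cases l <;> cases s <;> cases s' <;>
      simp [checkerboardData, Sector.swap, eq_comm]
  independent := by
    intro μ c hc h
    -- Within the direction `μ`, the constraint `r_μ` only sees the generator with index `1`, and
    -- `r_{μ+1}` only the one with index `0`.
    have h1 : ∀ s, c (μ, 1, s) = 0 := by
      intro s
      have := (sum_checkerboard_constraint n c μ s).symm.trans (h (μ, s))
      rw [hc (μ + 2, 0, s) (fin_three_add_two_ne μ), hc (μ + 1, 0, s) (fin_three_add_one_ne μ), add_zero, sub_zero] at this
      exact this
    have h0 : ∀ s, c (μ, 0, s) = 0 := by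
      intro s
      have := (sum_checkerboard_constraint n c (μ + 1) s).symm.trans (h (μ + 1, s))
      rw [fin_three_add_one_one, fin_three_add_one_two, hc (μ + 1, 1, s) (fin_three_add_one_ne μ),
        hc (μ + 2, 0, s) (fin_three_add_two_ne μ), zero_add, sub_zero] at this
      exact this
    rintro ⟨ν, k, s⟩
    by_cases hν : ν = μ
    · subst hν
      fin_cases k
      exacts [h0 s, h1 s]
    · exact hc _ hν

theorem anisotropic_mem_sectors_iff (μ : Fin 3) (q : (anisotropicData n μ).Q) :
    q ∈ (anisotropicData n μ).sectors ↔
      augment n (q (0, .e)) = augment n (q (1, .e)) ∧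
      augment n (q (0, .m)) + augment n (q (1, .m)) = 0 := by
  change (fun j => ∑ i, augment n (q i) * (anisotropicData n μ).constraint i j) = 0 ↔ _
  rw [funext_iff]
  constructor
  · intro h
    have he := (sum_anisotropic_constraint n μ (fun i => augment n (q i)) .e).symm.trans (h .e)
    have hm := (sum_anisotropic_constraint n μ (fun i => augment n (q i)) .m).symm.trans (h .m)
    exact ⟨sub_eq_zero.1 he, hm⟩
  · rintro ⟨he, hm⟩ s
    refine (sum_anisotropic_constraint n μ (fun i => augment n (q i)) s).trans ?_
    cases s
    exacts [sub_eq_zero.2 he, hm]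

theorem checkerboard_mem_sectors_iff (q : (checkerboardData n).Q) :
    q ∈ (checkerboardData n).sectors ↔ ∀ μ s,
      augment n (q (μ, 1, s)) = augment n (q (μ + 1, 0, s)) - augment n (q (μ + 2, 0, s)) := by
  change (fun j => ∑ i, augment n (q i) * (checkerboardData n).constraint i j) = 0 ↔ _
  rw [funext_iff]
  constructor
  · intro h μ s
    have : _ = (0 : ZMod n) :=
      (sum_checkerboard_constraint n (fun i => augment n (q i)) μ s).symm.trans (h (μ, s))
    linear_combination this
  · rintro h ⟨μ, s⟩
    refine (sum_checkerboard_constraint n (fun i => augment n (q i)) μ s).trans ?_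
    have := h μ s
    exact sub_eq_zero.2 (by linear_combination this)

/-- The constant `1/2` (for odd `n`). -/
noncomputable def halfL : LaurentPolynomial (ZMod n) := scalar ℤ ((2 : ZMod n)⁻¹)

variable {n}

theorem two_mul_zmod_half (hn : Odd n) : (2 : ZMod n) * 2⁻¹ = 1 := by
  have h2 : IsUnit (2 : ZMod n) := by
    have := (ZMod.isUnit_iff_coprime 2 n).2 (Nat.coprime_two_left.2 hn)
    exact_mod_cast this
  exact ZMod.mul_inv_of_unit _ h2

theorem two_mul_halfL (hn : Odd n) : 2 * halfL n = 1 := by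
  rw [halfL, ← scalar_two, ← scalar_mul, two_mul_zmod_half hn, scalar_one]

theorem antipode_halfL : antipode (halfL n) = halfL n := antipode_scalar _

/-- The signs in the isomorphism between the checkerboard and the anisotropic theories. -/
def branchSign (k : Fin 2) : ℤ := if k = 0 then 1 else -1

variable (n) in
/-- The projection of the checkerboard theory to an anisotropic theory, on plane charges. -/
noncomputable def toAnisotropicQ (μ : Fin 3) (x : (checkerboardData n).Q) :
    (anisotropicData n μ).Q := fun i =>
  let ν := (anisotropicData n μ).dir i
  match i.2 with
  | .e => halfL n * (x (ν, 0, .e) + branchSign i.1 * (mono n (1 : ℤ) * x (ν, 1, .e)))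
  | .m => x (ν, 1, .m) + branchSign i.1 * x (ν, 0, .m)

/-- By the checkerboard constraints, the augmentation at index `1` is a difference of those at index
`0`. With `c_κ` the augmentation at `(κ, 0)`, both `e`-coordinates get `(c_{μ+1} + c_{μ+2} -
c_μ)/2`, and the `m`-coordinates get opposite values. -/
theorem toAnisotropicQ_mem (μ : Fin 3) {x : (checkerboardData n).Q}
    (hx : x ∈ (checkerboardData n).sectors) :
    toAnisotropicQ n μ x ∈ (anisotropicData n μ).sectors := by
  rw [checkerboard_mem_sectors_iff] at hx
  rw [anisotropic_mem_sectors_iff]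
  have hx1 := fun s => hx (μ + 1) s
  have hx2 := fun s => hx (μ + 2) s
  rw [fin_three_add_one_one, fin_three_add_one_two] at hx1
  rw [fin_three_add_two_one, fin_three_add_two_two] at hx2
  simp only [toAnisotropicQ, anisotropicData, branchSign, if_true, one_ne_zero, if_false, map_mul,
    map_add, map_intCast, augment_mono]
  push_cast
  rw [hx1, hx2, hx1, hx2]
  constructor <;> ring

/-- The projection of the checkerboard theory to an anisotropic theory. -/
noncomputable def toAnisotropic (μ : Fin 3) :
    (checkerboardData n).sectors →ₗ[R n] (anisotropicData n μ).sectors where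
  toFun x := ⟨toAnisotropicQ n μ x.1, toAnisotropicQ_mem μ x.2⟩
  map_add' x y := by
    refine Subtype.ext (funext fun i => ?_)
    change toAnisotropicQ n μ (x.1 + y.1) i =
      toAnisotropicQ n μ x.1 i + toAnisotropicQ n μ y.1 i
    have h : ∀ j, (x.1 + y.1) j = x.1 j + y.1 j := fun _ => rfl
    obtain ⟨k, s⟩ := i
    cases s <;> simp only [toAnisotropicQ, h] <;> ring
  map_smul' r x := by
    refine Subtype.ext (funext fun i => ?_)
    change toAnisotropicQ n μ (r • x).1 i =
      proj n ((anisotropicData n μ).dir i) r * toAnisotropicQ n μ x.1 i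
    have h : ∀ j, (r • x).1 j = proj n j.1 r * x.1 j := fun _ => rfl
    obtain ⟨k, s⟩ := i
    cases s <;> simp only [toAnisotropicQ, h] <;> ring

variable (n) in
/-- The inverse of the projections to the anisotropic theories, on plane charges. -/
noncomputable def ofAnisotropicQ (y : ∀ μ, (anisotropicData n μ).Q) : (checkerboardData n).Q
  | (ν, k, s) => match s with
    | .e => if k = 0 then y (ν + 1) (1, .e) + y (ν + 2) (0, .e) else
        mono n (-1 : ℤ) * (y (ν + 2) (0, .e) - y (ν + 1) (1, .e))
    | .m => if k = 0 then halfL n * (y (ν + 2) (0, .m) - y (ν + 1) (1, .m)) else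
        halfL n * (y (ν + 2) (0, .m) + y (ν + 1) (1, .m))

theorem ofAnisotropicQ_mem {y : ∀ μ, (anisotropicData n μ).Q}
    (hy : ∀ μ, y μ ∈ (anisotropicData n μ).sectors) :
    ofAnisotropicQ n y ∈ (checkerboardData n).sectors := by
  rw [checkerboard_mem_sectors_iff]
  intro μ s
  have h := fun κ => (anisotropic_mem_sectors_iff n κ (y κ)).1 (hy κ)
  obtain ⟨h0, h0'⟩ := h μ
  obtain ⟨h1, h1'⟩ := h (μ + 1)
  obtain ⟨h2, h2'⟩ := h (μ + 2)
  cases s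
  · simp only [ofAnisotropicQ, if_true, one_ne_zero, if_false, map_mul, map_add, map_sub,
      augment_mono, one_mul]
    rw [fin_three_add_one_one, fin_three_add_one_two, fin_three_add_two_one,
      fin_three_add_two_two]
    linear_combination h2 - h0 + h1
  · simp only [ofAnisotropicQ, if_true, one_ne_zero, if_false, map_mul, map_add, map_sub]
    rw [fin_three_add_one_one, fin_three_add_one_two, fin_three_add_two_one,
      fin_three_add_two_two]
    linear_combination augment n (halfL n) * (h1' + h2' - h0')

theorem ofAnisotropicQ_toAnisotropicQ (hn : Odd n) (x : (checkerboardData n).Q) :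
    ofAnisotropicQ n (fun μ => toAnisotropicQ n μ x) = x := by
  have hh := two_mul_halfL hn
  have ht := mono_mul_mono_neg (n := n) (1 : ℤ)
  funext ⟨ν, k, s⟩
  fin_cases k <;> cases s <;>
    simp only [ofAnisotropicQ, toAnisotropicQ, anisotropicData, branchSign, if_true, one_ne_zero,
      if_false, fin_three_add_one_two, fin_three_add_two_one, Fin.zero_eta, Fin.mk_one,
      Int.cast_one, Int.cast_neg]
  · linear_combination x (ν, 0, .e) * hh
  · linear_combination x (ν, 0, .m) * hh
  · linear_combination x (ν, 1, .e) * hh + 2 * halfL n * x (ν, 1, .e) * ht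
  · linear_combination x (ν, 1, .m) * hh

theorem toAnisotropicQ_ofAnisotropicQ (hn : Odd n) (y : ∀ μ, (anisotropicData n μ).Q)
    (μ : Fin 3) : toAnisotropicQ n μ (ofAnisotropicQ n y) = y μ := by
  have hh := two_mul_halfL hn
  have ht := mono_mul_mono_neg (n := n) (1 : ℤ)
  funext ⟨k, s⟩
  fin_cases k <;> cases s <;>
    simp only [ofAnisotropicQ, toAnisotropicQ, anisotropicData, branchSign, if_true, one_ne_zero,
      if_false, Fin.zero_eta, Fin.mk_one, Int.cast_one, Int.cast_neg]
  · rw [fin_three_add_one_one, fin_three_add_one_two]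
    linear_combination y μ (0, .e) * hh +
      halfL n * (y μ (0, .e) - y (μ + 2) (1, .e)) * ht
  · rw [fin_three_add_one_one, fin_three_add_one_two]
    linear_combination y μ (0, .m) * hh
  · rw [fin_three_add_two_one, fin_three_add_two_two]
    linear_combination y μ (1, .e) * hh -
      halfL n * (y (μ + 1) (0, .e) - y μ (1, .e)) * ht
  · rw [fin_three_add_two_one, fin_three_add_two_two]
    linear_combination y μ (1, .m) * hh

theorem exists_toAnisotropic_eq (hn : Odd n) (y : ∀ μ, (anisotropicData n μ).sectors) :
    ∃ x, ∀ μ, toAnisotropic μ x = y μ :=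
  ⟨⟨ofAnisotropicQ n fun μ => (y μ).1, ofAnisotropicQ_mem fun μ => (y μ).2⟩,
    fun μ => Subtype.ext (toAnisotropicQ_ofAnisotropicQ hn _ μ)⟩

theorem bijective_toAnisotropic (hn : Odd n) : Function.Bijective
    (((toAnisotropic 0).prod (toAnisotropic 1)).prod (toAnisotropic (n := n) 2)) := by
  constructor
  · intro x x' h
    have h0 : toAnisotropicQ n 0 x.1 = toAnisotropicQ n 0 x'.1 :=
      congrArg (fun y => y.1.1.1) h
    have h1 : toAnisotropicQ n 1 x.1 = toAnisotropicQ n 1 x'.1 :=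
      congrArg (fun y => y.1.2.1) h
    have h2 : toAnisotropicQ n 2 x.1 = toAnisotropicQ n 2 x'.1 := congrArg (fun y => y.2.1) h
    have h3 : (fun μ => toAnisotropicQ n μ x.1) = fun μ => toAnisotropicQ n μ x'.1 := by
      funext μ
      fin_cases μ
      exacts [h0, h1, h2]
    refine Subtype.ext ?_
    rw [← ofAnisotropicQ_toAnisotropicQ hn x.1, h3, ofAnisotropicQ_toAnisotropicQ hn]
  · rintro ⟨⟨y0, y1⟩, y2⟩
    obtain ⟨x, hx⟩ := exists_toAnisotropic_eq hn fun
      | 0 => y0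
      | 1 => y1
      | 2 => y2
    have h0 := hx 0
    have h1 := hx 1
    have h2 := hx 2
    dsimp only at h0 h1 h2
    refine ⟨x, ?_⟩
    change ((toAnisotropic 0 x, toAnisotropic 1 x), toAnisotropic 2 x) = _
    rw [h0, h1, h2]

/-- The checkerboard theory is the sum of the anisotropic theories, as a module. -/
noncomputable def anisotropicEquiv (hn : Odd n) : (checkerboardData n).sectors ≃ₗ[R n]
    ((anisotropicData n 0).sectors × (anisotropicData n 1).sectors) ×
      (anisotropicData n 2).sectors :=
  LinearEquiv.ofBijective (((toAnisotropic 0).prod (toAnisotropic 1)).prod (toAnisotropic 2))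
    (bijective_toAnisotropic hn)

end Data

/-! ### Comparison of the statistics. -/

section Pairing

variable {n : ℕ}

variable (n) in
/-- The contribution of one anisotropic theory to the statistics in the planes with normal `ν`;
here `q` holds the quotients of the components of the planon by the divisors. -/
noncomputable def branchPairing (k : Fin 2) (ν : Fin 3)
    (q : Fin 3 × Fin 2 × Sector → LaurentPolynomial (ZMod n)) (x : (checkerboardData n).Q) :
    LaurentPolynomial (ZMod n) :=
  halfL n * (q (ν, 0, .e) - branchSign k * q (ν, 1, .e)) *
      antipode (n := n) (G := ℤ) (x (ν, 1, .m) + branchSign k * x (ν, 0, .m)) +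
    (q (ν, 1, .m) - branchSign k * (mono n (1 : ℤ) * q (ν, 0, .m))) *
      antipode (n := n) (G := ℤ)
        (halfL n * (x (ν, 0, .e) + branchSign k * (mono n (1 : ℤ) * x (ν, 1, .e))))

/-- The theory `μ` has charges only in the directions `μ + 1` (branch `0`) and `μ + 2` (branch `1`),
so at most one branch contributes for each `ν`. -/
theorem pairing_toAnisotropicQ {p : (checkerboardData n).Q}
    {q : Fin 3 × Fin 2 × Sector → LaurentPolynomial (ZMod n)}
    (hq : ∀ i, p i = q i * (checkerboardData n).divisor i) (x : (checkerboardData n).Q)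
    (μ ν : Fin 3) :
    (anisotropicData n μ).pairing ν (toAnisotropicQ n μ p) (toAnisotropicQ n μ x) =
      (if μ + 1 = ν then branchPairing n 0 ν q x else 0) +
        (if μ + 2 = ν then branchPairing n 1 ν q x else 0) := by
  let a : Fin 2 × Sector → LaurentPolynomial (ZMod n) := fun i =>
    match i.2 with
    | .e => halfL n * (q ((anisotropicData n μ).dir i, 0, .e) -
        branchSign i.1 * q ((anisotropicData n μ).dir i, 1, .e))
    | .m => q ((anisotropicData n μ).dir i, 1, .m) -
        branchSign i.1 * (mono n (1 : ℤ) * q ((anisotropicData n μ).dir i, 0, .m))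
  have h0 : ∀ κ s, p (κ, 0, s) = q (κ, 0, s) * delta n := fun κ s => hq (κ, 0, s)
  have h1 : ∀ κ s, p (κ, 1, s) = q (κ, 1, s) * deltaBar n := fun κ s => hq (κ, 1, s)
  have hd := delta_eq (n := n)
  -- The factor `t` in front of the `e`-coordinate of index `1`, and the relation `Δ = -t Δ̄`, turn
  -- sums of a multiple of `Δ` and one of `Δ̄` into multiples of one divisor.
  have ha : ∀ i, toAnisotropicQ n μ p i = a i * (anisotropicData n μ).divisor i := by
    rintro ⟨k, s⟩
    cases s
    · change halfL n * (p (_, 0, .e) + branchSign k * (mono n (1 : ℤ) * p (_, 1, .e))) =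
        halfL n * (q (_, 0, .e) - branchSign k * q (_, 1, .e)) * delta n
      rw [h0, h1]
      linear_combination
        halfL n * branchSign k * q ((anisotropicData n μ).dir (k, .e), 1, .e) * hd
    · change p (_, 1, .m) + branchSign k * p (_, 0, .m) =
        (q (_, 1, .m) - branchSign k * (mono n (1 : ℤ) * q (_, 0, .m))) * deltaBar n
      rw [h0, h1]
      linear_combination branchSign k * q ((anisotropicData n μ).dir (k, .m), 0, .m) * hd
  rw [(isPaired_anisotropicData n μ).pairing_of_quotient (fun i _ => ha i)]
  rw [Fintype.sum_prod_type, Fin.sum_univ_two, sum_sector, sum_sector]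
  have hk : ∀ k : Fin 2, ((if (anisotropicData n μ).dir (k, .e) = ν then
      a (k, .e) * (((1 : ℤˣ) : ℤ) : LaurentPolynomial (ZMod n)) *
        antipode (n := n) (G := ℤ) (toAnisotropicQ n μ x (k, .m)) else 0) +
      if (anisotropicData n μ).dir (k, .m) = ν then
      a (k, .m) * (((1 : ℤˣ) : ℤ) : LaurentPolynomial (ZMod n)) *
        antipode (n := n) (G := ℤ) (toAnisotropicQ n μ x (k, .e)) else 0) =
      if (anisotropicData n μ).dir (k, .e) = ν then branchPairing n k ν q x else 0 := by
    intro k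
    have hem : (anisotropicData n μ).dir (k, .m) = (anisotropicData n μ).dir (k, .e) := rfl
    rw [hem]
    split_ifs with h
    · subst h
      rw [Units.val_one, Int.cast_one, mul_one, mul_one]
      rfl
    · rw [add_zero]
  exact congrArg₂ _ (hk 0) (hk 1)

/-- The two branches differ by a sign, so the terms odd in that sign cancel in the sum, and the even
ones double, which absorbs the factor `1/2`. -/
theorem pairing_checkerboard (hn : Odd n) {p : (checkerboardData n).Q}
    {q : Fin 3 × Fin 2 × Sector → LaurentPolynomial (ZMod n)}
    (hq : ∀ i, p i = q i * (checkerboardData n).divisor i) (x : (checkerboardData n).Q)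
    (ν : Fin 3) : (checkerboardData n).pairing ν p x =
      branchPairing n 0 ν q x + branchPairing n 1 ν q x := by
  have hdir : ∀ i, (checkerboardData n).dir i = i.1 := fun _ => rfl
  rw [(isPaired_checkerboardData n).pairing_of_quotient (fun i _ => hq i), Fintype.sum_prod_type,
    Finset.sum_eq_single ν]
  · simp only [Fintype.sum_prod_type, Fin.sum_univ_two, sum_sector, hdir, if_true, Sector.swap]
    have hh := two_mul_halfL hn
    have ht : mono n (1 : ℤ) * antipode (n := n) (G := ℤ) (mono n 1) = 1 := by
      rw [antipode_mono, mono_mul_mono_neg]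
    have hc : antipode (n := n) (G := ℤ) (halfL n) = halfL n := antipode_halfL
    simp [branchPairing, branchSign, -antipode_mono, hc]
    set T := antipode (n := n) (G := ℤ) (mono n 1)
    linear_combination
      (-q (ν, 0, .e) * antipode (n := n) (G := ℤ) (x (ν, 1, .m))
        + q (ν, 1, .e) * antipode (n := n) (G := ℤ) (x (ν, 0, .m))
        - q (ν, 1, .m) * antipode (n := n) (G := ℤ) (x (ν, 0, .e))
        + q (ν, 0, .m) * antipode (n := n) (G := ℤ) (x (ν, 1, .e))) * hh +
      2 * halfL n * q (ν, 0, .m) * antipode (n := n) (G := ℤ) (x (ν, 1, .e)) * ht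
  · intro κ _ hκ
    refine Finset.sum_eq_zero fun i _ => ?_
    rw [hdir, if_neg hκ]
  · intro h
    exact absurd (Finset.mem_univ _) h

/-- In the direction `ν`, branch `0` comes from exactly one of the three theories, branch `1` from
another, and the third contributes nothing. -/
theorem sum_pairing_toAnisotropic (hn : Odd n) {p : (checkerboardData n).sectors} {ν : Fin 3}
    (hp : ∀ i, (checkerboardData n).dir i ≠ ν → p.1 i = 0) (x : (checkerboardData n).sectors) :
    (anisotropicData n 0).pairing ν (toAnisotropic 0 p).1 (toAnisotropic 0 x).1 +
      (anisotropicData n 1).pairing ν (toAnisotropic 1 p).1 (toAnisotropic 1 x).1 +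
      (anisotropicData n 2).pairing ν (toAnisotropic 2 p).1 (toAnisotropic 2 x).1 =
      (checkerboardData n).pairing ν p.1 x.1 := by
  choose q hq using (isPaired_checkerboardData n).exists_quotient hp
  have h := fun μ => pairing_toAnisotropicQ hq x.1 μ ν
  rw [pairing_checkerboard hn hq]
  refine (congrArg₂ _ (congrArg₂ _ (h 0) (h 1)) (h 2)).trans ?_
  fin_cases ν <;> simp [add_comm]

end Pairing

/-! ### Orientations under isomorphism and stacking. -/

namespace PTheory

variable {n : ℕ} {G : Type} [AddCommGroup G] {η : G →+ Space}

theorem orientations_eq_of_linearEquiv {P₁ P₂ : PTheory n G η}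
    (e : P₁.S ≃ₗ[GroupRing n G] P₂.S) : P₁.orientations = P₂.orientations := by
  have hs : ∀ x, P₂.stab (e x) = P₁.stab x := by
    intro x
    ext g
    change mono n g • e x = e x ↔ mono n g • x = x
    rw [← map_smul, e.injective.eq_iff]
  have h1 : ∀ x, P₂.IsPlanon (e x) ↔ P₁.IsPlanon x := fun x => by
    unfold IsPlanon
    rw [hs]
  have h2 : ∀ x, P₂.orientation (e x) = P₁.orientation x := fun x => by
    unfold orientation
    rw [hs]
  ext a
  constructor
  · rintro ⟨x, hx, rfl⟩
    exact ⟨e x, (h1 x).2 hx, h2 x⟩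
  · rintro ⟨y, hy, rfl⟩
    obtain ⟨x, rfl⟩ := e.surjective y
    exact ⟨x, (h1 x).1 hy, (h2 x).symm⟩

theorem isomorphic_of_linearEquiv {P₁ P₂ : PTheory n G η} (e : P₁.S ≃ₗ[GroupRing n G] P₂.S)
    (hnormal : ∀ a ∈ P₁.orientations, P₁.normal a = P₂.normal a)
    (hform : ∀ a ∈ P₁.orientations, ∀ p ∈ P₁.planons a, ∀ x,
      P₁.form a p x = P₂.form a (e p) (e x)) : Isomorphic P₁ P₂ := by
  refine ⟨AddEquiv.refl G, e.toAddEquiv, fun _ => rfl, fun r x => ?_,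
    orientations_eq_of_linearEquiv e, fun a ha => ⟨hnormal a ha, hform a ha⟩⟩
  have h : AddMonoidAlgebra.mapDomainRingHom (ZMod n) ((AddEquiv.refl G : G ≃+ G) : G →+ G) r =
      r := by
    induction r using AddMonoidAlgebra.induction_linear with
    | zero => exact map_zero _
    | add r s hr hs => rw [map_add, hr, hs]
    | single g c => exact AddMonoidAlgebra.mapDomain_single
  rw [h]
  exact map_smul e r x

theorem orientations_subset_stack (P₁ P₂ : PTheory n G η) :
    P₁.orientations ⊆ (stack P₁ P₂).orientations := by
  have hs : ∀ x : P₁.S, (stack P₁ P₂).stab (x, 0) = P₁.stab x := by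
    intro x
    ext g
    change (mono n g • x, mono n g • (0 : P₂.S)) = (x, 0) ↔ mono n g • x = x
    rw [smul_zero, Prod.mk.injEq, and_iff_left rfl]
  rintro _ ⟨x, hx, rfl⟩
  refine ⟨(x, 0), ?_, ?_⟩
  · unfold IsPlanon
    rwa [hs]
  · unfold orientation
    rw [hs]

theorem orientations_subset_stack_right (P₁ P₂ : PTheory n G η) :
    P₂.orientations ⊆ (stack P₁ P₂).orientations := by
  have hs : ∀ x : P₂.S, (stack P₁ P₂).stab (0, x) = P₂.stab x := by
    intro x
    ext g
    change (mono n g • (0 : P₁.S), mono n g • x) = (0, x) ↔ mono n g • x = x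
    rw [smul_zero, Prod.mk.injEq, and_iff_right rfl]
  rintro _ ⟨x, hx, rfl⟩
  refine ⟨(0, x), ?_, ?_⟩
  · unfold IsPlanon
    rwa [hs]
  · unfold orientation
    rw [hs]

end PTheory

/-! ### The stack of the three anisotropic theories. -/

section Stack

variable {n : ℕ}

theorem plane_mem_anisotropic_orientations (hn : 1 < n) {μ ν : Fin 3} (h : ν ≠ μ) :
    plane ν ∈ (anisotropicTheory n μ).orientations := by
  have : Fact (1 < n) := ⟨hn⟩
  have hk : ∃ k : Fin 2, (anisotropicData n μ).dir (k, .e) = ν := by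
    revert h
    change ν ≠ μ → ∃ k : Fin 2, (if k = 0 then μ + 1 else μ + 2) = ν
    revert μ ν
    decide
  obtain ⟨k, hk⟩ := hk
  let p : (anisotropicData n μ).sectors := ⟨fun i => if i = (k, .e) then delta n else 0, by
    funext j
    refine Finset.sum_eq_zero fun i _ => ?_
    change augment n (if i = (k, .e) then delta n else 0) * _ = 0
    by_cases hi : i = (k, .e)
    · rw [if_pos hi, augment_delta, zero_mul]
    · rw [if_neg hi, map_zero, zero_mul]⟩
  refine (anisotropicData n μ).plane_mem_orientations (x := p) ?_ ?_
  · intro h0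
    have h1 : delta n = 0 := by
      have h2 : p.1 (k, .e) = 0 := by rw [h0]; rfl
      change (if (k, Sector.e) = (k, .e) then delta n else 0) = 0 at h2
      rwa [if_pos rfl] at h2
    have h2 := IsDivisor.coeff_zero (n := n) (d := delta n) (Or.inl rfl)
    rw [h1] at h2
    exact zero_ne_one h2
  · intro i hi
    refine if_neg ?_
    rintro rfl
    exact hi hk

theorem anisotropic_form_self (μ : Fin 3) (p x : (anisotropicData n μ).sectors) :
    (anisotropicTheory n μ).form (plane μ) p x = 0 := by
  refine ((anisotropicData n μ).form_plane μ p x).trans ?_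
  rw [(isPaired_anisotropicData n μ).pairing_eq, Finset.sum_eq_zero]
  · rfl
  · rintro ⟨k, s⟩ _
    refine if_neg ?_
    change (if k = 0 then μ + 1 else μ + 2) ≠ μ
    split_ifs
    exacts [fin_three_add_one_ne μ, fin_three_add_two_ne μ]

/-- The case distinction in the definition of the stack is harmless: the only coordinate plane that
could fail to be an orientation is the one with normal `μ`, and there the pairing is zero anyway. -/
theorem anisotropic_form_ite (hn : 1 < n) (μ ν : Fin 3) (p x : (anisotropicData n μ).sectors) :
    (if plane ν ∈ (anisotropicTheory n μ).orientations then
      (anisotropicTheory n μ).form (plane ν) p x else 0) =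
        ((anisotropicData n μ).pairing ν p.1 x.1).coeff 0 := by
  rw [← (anisotropicData n μ).form_plane ν p x]
  split_ifs with h
  · rfl
  · have : ν = μ := by
      by_contra hne
      exact h (plane_mem_anisotropic_orientations hn hne)
    subst this
    exact (anisotropic_form_self ν p x).symm

variable (n) in
/-- The stack of the three anisotropic theories. -/
noncomputable def anisotropicStack : PTheory n Lattice embed :=
  PTheory.stack (PTheory.stack (anisotropicTheory n 0) (anisotropicTheory n 1))
    (anisotropicTheory n 2)

theorem stack_normal (a : Submodule ℝ Space) :
    (PTheory.stack (anisotropicTheory n 0) (anisotropicTheory n 1)).normal a =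
      (checkerboardTheory n).normal a := by
  change (if _ then _ else _) = _
  split_ifs <;> rfl

theorem anisotropicStack_normal (a : Submodule ℝ Space) :
    (anisotropicStack n).normal a = (checkerboardTheory n).normal a := by
  change (if _ then _ else _) = _
  split_ifs
  exacts [stack_normal a, rfl]

theorem stackable_anisotropic :
    PTheory.Stackable (anisotropicTheory n 0) (anisotropicTheory n 1) ∧
      PTheory.Stackable (PTheory.stack (anisotropicTheory n 0) (anisotropicTheory n 1))
        (anisotropicTheory n 2) :=
  ⟨fun _ _ _ => rfl, fun a _ _ => stack_normal a⟩

theorem anisotropicStack_form (hn : 1 < n) (ν : Fin 3)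
    (p x : ((anisotropicData n 0).sectors × (anisotropicData n 1).sectors) ×
      (anisotropicData n 2).sectors) :
    (anisotropicStack n).form (plane ν) p x =
      ((anisotropicData n 0).pairing ν p.1.1.1 x.1.1.1 +
        (anisotropicData n 1).pairing ν p.1.2.1 x.1.2.1 +
        (anisotropicData n 2).pairing ν p.2.1 x.2.1).coeff 0 := by
  -- The theory `0` has planons in every coordinate plane except the one with normal `0`, and the
  -- theory `1` supplies that one.
  have h01 : plane ν ∈
      (PTheory.stack (anisotropicTheory n 0) (anisotropicTheory n 1)).orientations := by
    by_cases h : ν = 0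
    · subst h
      exact PTheory.orientations_subset_stack_right _ _
        (plane_mem_anisotropic_orientations hn (by decide))
    · exact PTheory.orientations_subset_stack _ _ (plane_mem_anisotropic_orientations hn h)
  change (if _ then (PTheory.stack (anisotropicTheory n 0) (anisotropicTheory n 1)).form _ p.1 x.1
    else 0) + (if _ then (anisotropicTheory n 2).form (plane ν) p.2 x.2 else 0) = _
  rw [if_pos h01, AddMonoidAlgebra.coeff_add, AddMonoidAlgebra.coeff_add, Finsupp.add_apply,
    Finsupp.add_apply]
  exact congrArg₂ _ (congrArg₂ _ (anisotropic_form_ite hn 0 ν p.1.1 x.1.1)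
    (anisotropic_form_ite hn 1 ν p.1.2 x.1.2)) (anisotropic_form_ite hn 2 ν p.2 x.2)

theorem isomorphic_checkerboard (hn : Odd n) (hn1 : 1 < n) :
    PTheory.Isomorphic (checkerboardTheory n)
      (PTheory.stack (PTheory.stack (anisotropicTheory n 0) (anisotropicTheory n 1))
        (anisotropicTheory n 2)) := by
  let e : (checkerboardTheory n).S ≃ₗ[R n] (anisotropicStack n).S := anisotropicEquiv hn
  refine PTheory.isomorphic_of_linearEquiv e (fun a _ => (anisotropicStack_normal a).symm) ?_
  intro a ha p hp x
  obtain ⟨ν, rfl⟩ := (checkerboardData n).exists_eq_plane ha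
  replace hp := ((checkerboardData n).mem_planons_iff p ν).1 hp
  refine ((checkerboardData n).form_plane ν p x).trans ?_
  rw [← sum_pairing_toAnisotropic hn hp x]
  exact (anisotropicStack_form hn1 ν (anisotropicEquiv hn p) (anisotropicEquiv hn x)).symm

end Stack

/-! ### The stabilizer map in coordinates. -/

section StabilizerMap

variable {n : ℕ} {G : Type} [AddCommGroup G] {ι κ : Type} [Fintype ι] [Fintype κ] [DecidableEq ι]
  [DecidableEq κ]

theorem stabilizerMap_mulVec_inl (ε : Matrix κ (ι ⊕ ι) (GroupRing n G)) (w : κ → GroupRing n G)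
    (i : ι) : (stabilizerMap ε).mulVec w (Sum.inl i) =
      ∑ k, antipode (ε k (Sum.inr i)) * w k := by
  refine Finset.sum_congr rfl fun k _ => ?_
  congr 1
  simp [stabilizerMap, lam, Matrix.mul_apply, Matrix.one_apply, dagger]

theorem stabilizerMap_mulVec_inr (ε : Matrix κ (ι ⊕ ι) (GroupRing n G)) (w : κ → GroupRing n G)
    (i : ι) : (stabilizerMap ε).mulVec w (Sum.inr i) =
      -∑ k, antipode (ε k (Sum.inl i)) * w k := by
  rw [← Finset.sum_neg_distrib]
  refine Finset.sum_congr rfl fun k _ => ?_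
  rw [← neg_mul]
  congr 1
  simp [stabilizerMap, lam, Matrix.mul_apply, Matrix.one_apply, dagger]

end StabilizerMap

/-! ### Loop operators, and how they behave under equivalences of codes. -/

section Loops

variable {n : ℕ}

theorem proj_antipode (ν : Fin 3) (r : R n) :
    proj n ν (antipode r) = antipode (n := n) (G := ℤ) (proj n ν r) := by
  induction r using AddMonoidAlgebra.induction_linear with
  | zero => simp
  | add r s hr hs => simp [hr, hs]
  | single g c => rw [antipode_single, proj_single, proj_single, antipode_single, Pi.neg_apply]

theorem plane_combination (ν : Fin 3) (k : ℤ × ℤ) (g : Lattice) :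
    g = k.1 • (Pi.single (ν + 1) 1 : Lattice) + k.2 • (Pi.single (ν + 2) 1 : Lattice) ↔
      g ν = 0 ∧ k = (g (ν + 1), g (ν + 2)) := by
  rw [funext_iff, Prod.ext_iff]
  fin_cases ν <;> simp [Fin.forall_fin_succ, Pi.single_apply] <;> grind

/-- Summing the coefficients of `r` over the plane with normal `ν` through the origin. -/
theorem finsum_coeff_plane (ν : Fin 3) (r : R n) :
    Function.HasFiniteSupport (fun k : ℤ × ℤ => r.coeff (k.1 • (Pi.single (ν + 1) 1 : Lattice) +
        k.2 • (Pi.single (ν + 2) 1 : Lattice))) ∧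
      ∑ᶠ k : ℤ × ℤ, r.coeff (k.1 • (Pi.single (ν + 1) 1 : Lattice) +
        k.2 • (Pi.single (ν + 2) 1 : Lattice)) = (proj n ν r).coeff 0 := by
  induction r using AddMonoidAlgebra.induction_linear with
  | zero => simp [Function.HasFiniteSupport]
  | add r s hr hs =>
    have h : ∀ k : ℤ × ℤ, (r + s).coeff (k.1 • (Pi.single (ν + 1) 1 : Lattice) +
        k.2 • (Pi.single (ν + 2) 1 : Lattice)) =
          r.coeff (k.1 • (Pi.single (ν + 1) 1 : Lattice) +
            k.2 • (Pi.single (ν + 2) 1 : Lattice)) +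
          s.coeff (k.1 • (Pi.single (ν + 1) 1 : Lattice) +
            k.2 • (Pi.single (ν + 2) 1 : Lattice)) := fun k => rfl
    simp only [h]
    refine ⟨hr.1.add hs.1, ?_⟩
    rw [finsum_add_distrib hr.1 hs.1, hr.2, hs.2, map_add]
    rfl
  | single g c =>
    have h : ∀ k : ℤ × ℤ, (AddMonoidAlgebra.single g c : R n).coeff
        (k.1 • (Pi.single (ν + 1) 1 : Lattice) + k.2 • (Pi.single (ν + 2) 1 : Lattice)) =
          if g ν = 0 ∧ k = (g (ν + 1), g (ν + 2)) then c else 0 := by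
      intro k
      rw [AddMonoidAlgebra.coeff_single, Finsupp.single_apply]
      simp only [plane_combination]
    simp only [h]
    constructor
    · refine (Set.finite_singleton (g (ν + 1), g (ν + 2))).subset fun k hk => ?_
      by_contra hk'
      exact hk (if_neg fun hh => hk' hh.2)
    · rw [proj_single, AddMonoidAlgebra.coeff_single, Finsupp.single_apply,
        finsum_eq_single _ (g (ν + 1), g (ν + 2)) fun k hk => if_neg fun hh => hk hh.2]
      simp

/-- `w` is the product of stabilizers that moves `e` around an elementary parallelogram in the
plane with normal `ν`. -/
def IsLoop {ι κ : Type} [Fintype ι] [Fintype κ] [DecidableEq ι]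
  [DecidableEq κ] (ε : Matrix κ (ι ⊕ ι) (R n)) (ν : Fin 3)
    (e w : κ → R n) : Prop :=
  ∃ s s' : ι ⊕ ι → R n, ε.mulVec s = (var n (ν + 1) - 1) • e ∧
    ε.mulVec s' = (var n (ν + 2) - 1) • e ∧
    (1 - var n (ν + 2)) • s - (1 - var n (ν + 1)) • s' = (stabilizerMap ε).mulVec w

/-- The `ℤ_n[t^±]`-valued phase of the loops that are products of translates of `w`. -/
noncomputable def loopPhase {κ : Type} [Fintype κ] (ν : Fin 3) (w x : κ → R n) :
    LaurentPolynomial (ZMod n) :=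
  proj n ν (∑ i, w i * antipode (x i))

variable {ι κ : Type} [Fintype ι] [Fintype κ] [DecidableEq ι]
  [DecidableEq κ] {ε : Matrix κ (ι ⊕ ι) (R n)} {ν : Fin 3}

theorem loopPhase_zero (x : κ → R n) : loopPhase ν 0 x = 0 := by
  simp [loopPhase]

/-- Summing over all translates in the plane collects the coefficients with vanishing `ν`-component,
which is the constant coefficient of the projection. The axes `ν + 1`, `ν + 2`, `ν` are in cyclic
order, so the loop is counterclockwise; `Braids` puts the antipode on the other factor, which does
not affect degree `0`. -/
theorem IsLoop.braids {e w : κ → R n} (h : IsLoop ε ν e w) :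
    Braids embed ε (plane ν) (axis ν) e (fun x => (loopPhase ν w x).coeff 0) := by
  obtain ⟨s, s', hs, hs', hw⟩ := h
  refine ⟨Pi.single (ν + 1) 1, Pi.single (ν + 2) 1, s, s', w, ?_, ?_, ?_, hs, hs', hw, ?_⟩
  · rw [mem_plane, embed_single]
    exact Pi.single_eq_of_ne (fin_three_add_one_ne ν).symm 1
  · rw [mem_plane, embed_single]
    exact Pi.single_eq_of_ne (fin_three_add_two_ne ν).symm 1
  · rw [embed_single, embed_single]
    fin_cases ν <;> simp [Matrix.det_fin_three, axis]
  · intro x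
    rw [(finsum_coeff_plane ν _).2, ← neg_zero, ← coeff_antipode, ← proj_antipode, neg_zero]
    simp [loopPhase]

theorem IsLoop.add {e w e' w' : κ → R n} (h : IsLoop ε ν e w) (h' : IsLoop ε ν e' w') :
    IsLoop ε ν (e + e') (w + w') := by
  obtain ⟨s, t, hs, ht, hw⟩ := h
  obtain ⟨s', t', hs', ht', hw'⟩ := h'
  refine ⟨s + s', t + t', ?_, ?_, ?_⟩
  · rw [Matrix.mulVec_add, hs, hs', smul_add]
  · rw [Matrix.mulVec_add, ht, ht', smul_add]
  · rw [Matrix.mulVec_add, ← hw, ← hw', smul_add, smul_add]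
    abel

/-- A locally created excitation is moved by translating the operator that creates it. The two
translations commute, so going around the parallelogram is the identity. -/
theorem isLoop_of_range (r : ι ⊕ ι → R n) : IsLoop ε ν (ε.mulVec r) 0 := by
  refine ⟨_, _, Matrix.mulVec_smul ε (var n (ν + 1) - 1) r,
    Matrix.mulVec_smul ε (var n (ν + 2) - 1) r, ?_⟩
  rw [Matrix.mulVec_zero, smul_smul, smul_smul, ← sub_smul,
    show (1 - var n (ν + 2)) * (var n (ν + 1) - 1) - (1 - var n (ν + 1)) * (var n (ν + 2) - 1) = 0
      by ring, zero_smul]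

/-- A loop found for one representative of a sector serves for all of them, with the same product of
stabilizers. -/
theorem IsLoop.of_sub_mem_range {e e' w : κ → R n} (h : IsLoop ε ν e' w)
    (he : e - e' ∈ LinearMap.range ε.mulVecLin) : IsLoop ε ν e w := by
  obtain ⟨r, hr⟩ := he
  have := h.add (isLoop_of_range (ε := ε) (ν := ν) r)
  rw [Matrix.mulVecLin_apply] at hr
  rwa [hr, add_sub_cancel, add_zero] at this

/-- The code `ε` has the module `M` of superselection sectors, where the elements of `planar ν` can
be moved in the planes with normal `ν`, with the statistics `Ψ ν`. -/
def Realizes {M : Type} [AddCommGroup M] [Module (R n) M] (ε : Matrix κ (ι ⊕ ι) (R n))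
    (planar : Fin 3 → Set M) (Ψ : Fin 3 → M → M → LaurentPolynomial (ZMod n)) : Prop :=
  ∃ f : (κ → R n) →ₗ[R n] M, Function.Surjective f ∧
    LinearMap.ker f = LinearMap.range ε.mulVecLin ∧
    ∀ ν e, f e ∈ planar ν → ∃ w, IsLoop ε ν e w ∧ ∀ x, Ψ ν (f e) (f x) = loopPhase ν w x

theorem Realizes.isTheoryOf {I J : Type} [Fintype I] {D : PlaneChargeData n I J}
    (h : Realizes ε (fun ν => {p : D.sectors | ∀ i, D.dir i ≠ ν → p.1 i = 0})
      (fun ν p x => D.pairing ν p.1 x.1)) : D.toPTheory.IsTheoryOf ε := by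
  obtain ⟨f, hf, hk, hl⟩ := h
  let θ : ((κ → R n) ⧸ LinearMap.range ε.mulVecLin) ≃ₗ[R n] D.sectors :=
    (Submodule.quotEquivOfEq _ _ hk.symm).trans (f.quotKerEquivOfSurjective hf)
  have hθ : ∀ e, θ (Submodule.Quotient.mk e) = f e := fun e => rfl
  refine ⟨θ, fun a ha e he => ?_⟩
  obtain ⟨ν, rfl⟩ := D.exists_eq_plane ha
  have he' := (D.mem_planons_iff (f e) ν).1 he
  obtain ⟨w, hw, hx⟩ := hl ν e he'
  have hb := hw.braids
  rw [D.normal_plane]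
  convert hb using 2 with x
  refine (D.form_plane ν (f e) (f x)).trans ?_
  rw [← hx]

section Stack

variable {ι' κ' : Type} [Fintype ι'] [Fintype κ'] [DecidableEq ι'] [DecidableEq κ']
  {ε' : Matrix κ' (ι' ⊕ ι') (R n)}

/-- The combination of Pauli operators of two decoupled systems. -/
def joinPauli {A : Type} (s : ι ⊕ ι → A) (s' : ι' ⊕ ι' → A) : (ι ⊕ ι') ⊕ (ι ⊕ ι') → A :=
  Sum.elim s s' ∘ Equiv.sumSumSumComm ι ι' ι ι'

theorem stackCodes_mulVec_joinPauli (s : ι ⊕ ι → R n) (s' : ι' ⊕ ι' → R n) :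
    (stackCodes ε ε').mulVec (joinPauli s s') = Sum.elim (ε.mulVec s) (ε'.mulVec s') := by
  rw [stackCodes, joinPauli, Matrix.submatrix_mulVec_equiv, Function.comp_assoc,
    Equiv.self_comp_symm, Function.comp_id, Function.comp_id, Matrix.fromBlocks_mulVec]
  simp

theorem exists_eq_joinPauli {A : Type} (t : (ι ⊕ ι') ⊕ (ι ⊕ ι') → A) :
    ∃ s s', t = joinPauli s s' := by
  refine ⟨fun i => t ((Equiv.sumSumSumComm ι ι' ι ι').symm (Sum.inl i)),
    fun i => t ((Equiv.sumSumSumComm ι ι' ι ι').symm (Sum.inr i)), ?_⟩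
  funext i
  rcases i with (i | i) | (i | i) <;> rfl

theorem stabilizerMap_stackCodes (w : κ → R n) (w' : κ' → R n) :
    (stabilizerMap (stackCodes ε ε')).mulVec (Sum.elim w w') =
      joinPauli ((stabilizerMap ε).mulVec w) ((stabilizerMap ε').mulVec w') := by
  funext i
  rcases i with (i | i) | (i | i)
  all_goals
    simp [stabilizerMap_mulVec_inl, stabilizerMap_mulVec_inr, joinPauli, stackCodes]

theorem IsLoop.stack {e w : κ → R n} {e' w' : κ' → R n} (h : IsLoop ε ν e w)
    (h' : IsLoop ε' ν e' w') : IsLoop (stackCodes ε ε') ν (Sum.elim e e') (Sum.elim w w') := by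
  obtain ⟨s, t, hs, ht, hw⟩ := h
  obtain ⟨s', t', hs', ht', hw'⟩ := h'
  refine ⟨joinPauli s s', joinPauli t t', ?_, ?_, ?_⟩
  · rw [stackCodes_mulVec_joinPauli, hs, hs']
    funext i
    rcases i with i | i <;> rfl
  · rw [stackCodes_mulVec_joinPauli, ht, ht']
    funext i
    rcases i with i | i <;> rfl
  · rw [stabilizerMap_stackCodes, ← hw, ← hw']
    funext i
    rcases i with (i | i) | (i | i) <;> rfl

theorem Realizes.stack {ι' κ' M M' : Type} [Fintype ι'] [Fintype κ']
    [DecidableEq ι'] [DecidableEq κ']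
    {ε' : Matrix κ' (ι' ⊕ ι') (R n)} [AddCommGroup M] [Module (R n) M] [AddCommGroup M']
    [Module (R n) M'] {planar : Fin 3 → Set M} {planar' : Fin 3 → Set M'}
    {Ψ : Fin 3 → M → M → LaurentPolynomial (ZMod n)}
    {Ψ' : Fin 3 → M' → M' → LaurentPolynomial (ZMod n)}
    (h : Realizes ε planar Ψ) (h' : Realizes ε' planar' Ψ') :
    Realizes (stackCodes ε ε') (fun ν => planar ν ×ˢ planar' ν)
      (fun ν p x => Ψ ν p.1 x.1 + Ψ' ν p.2 x.2) := by
  obtain ⟨f, hf, hk, hl⟩ := h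
  obtain ⟨f', hf', hk', hl'⟩ := h'
  refine ⟨(f.comp (LinearMap.funLeft _ _ Sum.inl)).prod
    (f'.comp (LinearMap.funLeft _ _ Sum.inr)), ?_, ?_, ?_⟩
  · rintro ⟨m, m'⟩
    obtain ⟨e, rfl⟩ := hf m
    obtain ⟨e', rfl⟩ := hf' m'
    exact ⟨Sum.elim e e', rfl⟩
  · ext e
    have h1 : f (e ∘ Sum.inl) = 0 ↔ ∃ s, ε.mulVec s = e ∘ Sum.inl := by
      rw [← LinearMap.mem_ker, hk]
      rfl
    have h2 : f' (e ∘ Sum.inr) = 0 ↔ ∃ s, ε'.mulVec s = e ∘ Sum.inr := by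
      rw [← LinearMap.mem_ker, hk']
      rfl
    rw [LinearMap.mem_ker, LinearMap.mem_range]
    change (f (e ∘ Sum.inl), f' (e ∘ Sum.inr)) = 0 ↔ _
    rw [Prod.mk_eq_zero, h1, h2]
    constructor
    · rintro ⟨⟨s, hs⟩, s', hs'⟩
      refine ⟨joinPauli s s', ?_⟩
      rw [Matrix.mulVecLin_apply, stackCodes_mulVec_joinPauli, hs, hs', Sum.elim_comp_inl_inr]
    · rintro ⟨t, rfl⟩
      obtain ⟨s, s', rfl⟩ := exists_eq_joinPauli t
      rw [Matrix.mulVecLin_apply, stackCodes_mulVec_joinPauli]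
      exact ⟨⟨s, rfl⟩, s', rfl⟩
  · intro ν e he
    obtain ⟨w, hw, hx⟩ := hl ν (e ∘ Sum.inl) he.1
    obtain ⟨w', hw', hx'⟩ := hl' ν (e ∘ Sum.inr) he.2
    refine ⟨Sum.elim w w', ?_, fun x => ?_⟩
    · rw [← Sum.elim_comp_inl_inr e]
      exact hw.stack hw'
    · refine (congrArg₂ _ (hx (x ∘ Sum.inl)) (hx' (x ∘ Sum.inr))).trans ?_
      simp [loopPhase]

end Stack

theorem IsLoop.of_submatrix {ι' κ' : Type} [Fintype ι'] [Fintype κ'] [DecidableEq ι']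
    [DecidableEq κ'] (eκ : κ' ≃ κ) (eι : ι' ≃ ι) {e w : κ → R n}
    (h : IsLoop (ε.submatrix eκ (Sum.map eι eι)) ν (e ∘ eκ) (w ∘ eκ)) : IsLoop ε ν e w := by
  have hm : ∀ s : ι' ⊕ ι' → R n, (ε.submatrix eκ (Sum.map eι eι)).mulVec s =
      ε.mulVec (s ∘ (eι.sumCongr eι).symm) ∘ eκ :=
    fun s => Matrix.submatrix_mulVec_equiv ε s eκ (eι.sumCongr eι)
  obtain ⟨s, t, hs, ht, hw⟩ := h
  refine ⟨s ∘ (eι.sumCongr eι).symm, t ∘ (eι.sumCongr eι).symm, ?_, ?_, ?_⟩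
  · rw [hm] at hs
    exact eκ.surjective.injective_comp_right hs
  · rw [hm] at ht
    exact eκ.surjective.injective_comp_right ht
  · funext i
    have hi := congrFun hw ((eι.sumCongr eι).symm i)
    refine hi.trans ?_
    rcases i with i | i
    all_goals
      simp [stabilizerMap_mulVec_inl, stabilizerMap_mulVec_inr]
      exact eκ.sum_comp (fun k => antipode (ε k _) * w k)

/-- The stabilizer map of `u ε v` is `λ v† ε† u†`; applying `v` on the left and using `v λ v† = λ`
leaves the stabilizer map of `ε` applied to `u† w`. -/
theorem IsLoop.of_transformed {u : Matrix κ κ (R n)} {v : Matrix (ι ⊕ ι) (ι ⊕ ι) (R n)}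
    (hu : IsUnit u) (hv : IsSymplectic v) {e w : κ → R n}
    (h : IsLoop (u * ε * v) ν (u.mulVec e) w) : IsLoop ε ν e ((dagger u).mulVec w) := by
  have hi := Matrix.mulVec_injective_of_isUnit hu
  obtain ⟨s, t, hs, ht, hw⟩ := h
  refine ⟨v.mulVec s, v.mulVec t, hi ?_, hi ?_, ?_⟩
  · rw [Matrix.mulVec_mulVec, Matrix.mulVec_mulVec, hs, Matrix.mulVec_smul]
  · rw [Matrix.mulVec_mulVec, Matrix.mulVec_mulVec, ht, Matrix.mulVec_smul]
  · rw [← Matrix.mulVec_smul, ← Matrix.mulVec_smul, ← Matrix.mulVec_sub, hw, Matrix.mulVec_mulVec,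
      Matrix.mulVec_mulVec, stabilizerMap, stabilizerMap, dagger_mul, dagger_mul]
    congr 1
    calc v * (lam n Lattice ι * (dagger v * (dagger ε * dagger u))) =
        v * lam n Lattice ι * dagger v * (dagger ε * dagger u) := by simp only [Matrix.mul_assoc]
      _ = _ := by rw [hv.mul_lam_mul_dagger, Matrix.mul_assoc]

theorem loopPhase_dagger (u : Matrix κ κ (R n)) (w x : κ → R n) :
    loopPhase ν ((dagger u).mulVec w) x = loopPhase ν w (u.mulVec x) := by
  have h : (dagger u).mulVec w ⬝ᵥ (antipode ∘ x) = w ⬝ᵥ (antipode ∘ u.mulVec x) := by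
    rw [← Matrix.vecMul_transpose, ← Matrix.dotProduct_mulVec]
    congr 1
    funext i
    simp [dagger, Matrix.mulVec, dotProduct]
  exact congrArg (proj n ν) h

/-- Sectors are carried along by `u` and the relabelling, loops by `v` and `u†`. The phases agree
because `u†` is adjoint to `u` (`loopPhase_dagger`), and `g` identifies the sectors with those of
another description. -/
theorem Realizes.of_transformed {ι' κ' M M' : Type} [Fintype ι'] [Fintype κ']
    [DecidableEq ι'] [DecidableEq κ']
    [AddCommGroup M] [Module (R n) M] [AddCommGroup M']
    [Module (R n) M'] {planar : Fin 3 → Set M} {planar' : Fin 3 → Set M'}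
    {Ψ : Fin 3 → M → M → LaurentPolynomial (ZMod n)}
    {Ψ' : Fin 3 → M' → M' → LaurentPolynomial (ZMod n)}
    {u : Matrix κ κ (R n)} {v : Matrix (ι ⊕ ι) (ι ⊕ ι) (R n)} (hu : IsUnit u)
    (hv : IsSymplectic v) (eκ : κ' ≃ κ) (eι : ι' ≃ ι)
    (h : Realizes ((u * ε * v).submatrix eκ (Sum.map eι eι)) planar Ψ) (g : M' ≃ₗ[R n] M)
    (hg : ∀ ν, ∀ p ∈ planar' ν, g p ∈ planar ν ∧ ∀ x, Ψ' ν p x = Ψ ν (g p) (g x)) :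
    Realizes ε planar' Ψ' := by
  obtain ⟨f, hf, hk, hl⟩ := h
  have hb : Function.Bijective u.mulVec :=
    ⟨Matrix.mulVec_injective_of_isUnit hu, Matrix.mulVec_surjective_iff_isUnit.2 hu⟩
  -- Since `v λ v† = λ` and `λ² = -1`, the matrix `-λ v† λ` is a right inverse of `v`; surjectivity
  -- shows that `ε` and `ε v` have the same range.
  have hvs : Function.Surjective v.mulVec := by
    refine Matrix.mulVec_surjective_iff_exists_right_inverse.2
      ⟨lam n Lattice ι * dagger v * -lam n Lattice ι, ?_⟩
    rw [← Matrix.mul_assoc, ← Matrix.mul_assoc, hv.mul_lam_mul_dagger, Matrix.mul_neg, lam_mul_lam,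
      neg_neg]
  refine ⟨g.symm.toLinearMap.comp (f.comp ((LinearMap.funLeft _ _ eκ).comp u.mulVecLin)),
    ?_, ?_, ?_⟩
  · exact g.symm.surjective.comp (hf.comp
      ((LinearMap.funLeft_surjective_of_injective (R n) (R n) eκ eκ.injective).comp hb.2))
  · ext e
    have h1 : f (u.mulVec e ∘ eκ) = 0 ↔ ∃ s,
        ((u * ε * v).submatrix eκ (Sum.map eι eι)).mulVec s = u.mulVec e ∘ eκ := by
      rw [← LinearMap.mem_ker, hk]
      rfl
    have hm : ∀ s : ι' ⊕ ι' → R n, ((u * ε * v).submatrix eκ (Sum.map eι eι)).mulVec s =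
        (u * ε * v).mulVec (s ∘ (eι.sumCongr eι).symm) ∘ eκ :=
      fun s => Matrix.submatrix_mulVec_equiv _ s eκ (eι.sumCongr eι)
    rw [LinearMap.mem_ker, LinearMap.mem_range]
    change g.symm (f (u.mulVec e ∘ eκ)) = 0 ↔ _
    rw [LinearEquiv.map_eq_zero_iff, h1]
    constructor
    · rintro ⟨s, hs⟩
      rw [hm] at hs
      refine ⟨v.mulVec (s ∘ (eι.sumCongr eι).symm), hb.1 ?_⟩
      rw [Matrix.mulVecLin_apply, Matrix.mulVec_mulVec, Matrix.mulVec_mulVec]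
      exact eκ.surjective.injective_comp_right hs
    · rintro ⟨t, rfl⟩
      obtain ⟨s, rfl⟩ := hvs t
      refine ⟨s ∘ eι.sumCongr eι, ?_⟩
      rw [hm, Function.comp_assoc, Equiv.self_comp_symm, Function.comp_id, Matrix.mulVecLin_apply,
        Matrix.mulVec_mulVec, Matrix.mulVec_mulVec]
  · intro ν e he
    have hge : ∀ x, g (g.symm (f (u.mulVec x ∘ eκ))) = f (u.mulVec x ∘ eκ) :=
      fun x => g.apply_symm_apply _
    obtain ⟨hp, hx⟩ := hg ν _ he
    obtain ⟨w, hw, hx'⟩ := hl ν (u.mulVec e ∘ eκ) ((hge e) ▸ hp)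
    refine ⟨(dagger u).mulVec (w ∘ eκ.symm), ?_, fun x => ?_⟩
    · refine IsLoop.of_transformed hu hv (IsLoop.of_submatrix eκ eι ?_)
      rwa [Function.comp_assoc, Equiv.symm_comp_self, Function.comp_id]
    · refine (hx _).trans ?_
      rw [loopPhase_dagger]
      refine (congrArg₂ (Ψ ν) (hge e) (hge x)).trans ((hx' _).trans ?_)
      refine congrArg (proj n ν) ?_
      rw [← eκ.sum_comp]
      simp

end Loops

/-! ### The anisotropic code: cokernel and planon loops. -/

section Anisotropic

variable {n : ℕ}

theorem incl_delta (μ : Fin 3) : incl n μ (delta n) = dd n μ := by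
  rw [delta, map_sub, map_one, mono, incl_single]
  rfl

theorem incl_deltaBar (μ : Fin 3) : incl n μ (deltaBar n) = antipode (dd n μ) := by
  rw [deltaBar, map_sub, map_one, mono, incl_single, dd, map_sub, map_one, antipode_var, varInv,
    Pi.single_neg]
  rfl

theorem proj_var_of_ne {μ ν : Fin 3} (h : ν ≠ μ) : proj n ν (var n μ) = 1 := by
  rw [var, mono, proj_single, Pi.single_eq_of_ne h]
  rfl

theorem proj_dd_of_ne {μ ν : Fin 3} (h : ν ≠ μ) : proj n ν (dd n μ) = 0 := by
  rw [dd, map_sub, map_one, proj_var_of_ne h, sub_self]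

theorem proj_scalar (μ : Fin 3) (c : ZMod n) : proj n μ (scalar Lattice c) = scalar ℤ c := by
  rw [scalar, proj_single]
  rfl

theorem fin_three_add_one_ne_add_two (μ : Fin 3) : μ + 1 ≠ μ + 2 := by
  revert μ
  decide

theorem dd_dvd_one_sub_mono (μ : Fin 3) (k : ℤ) :
    dd n μ ∣ 1 - mono n (Pi.single μ k : Lattice) := by
  have h := map_dvd (incl n μ) (delta_dvd_one_sub_mono (n := n) k)
  rwa [incl_delta, map_sub, map_one, mono, incl_single] at h

/-- An element of the group ring is determined by two of its projections up to the image of the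
anisotropic excitation map. -/
theorem exists_sub_eq (μ : Fin 3) (r : R n) : ∃ a b : R n,
    r - (incl n (μ + 1) (proj n (μ + 1) r) + incl n (μ + 2) (proj n (μ + 2) r) -
      scalar Lattice (augment n (proj n (μ + 1) r))) =
      dd n μ * a + dd₂ n (μ + 1) (μ + 2) * b := by
  induction r using AddMonoidAlgebra.induction_linear with
  | zero => exact ⟨0, 0, by simp [scalar]⟩
  | add r s hr hs =>
    obtain ⟨a, b, h⟩ := hr
    obtain ⟨a', b', h'⟩ := hs
    have hsc : scalar Lattice (augment n (proj n (μ + 1) (r + s))) =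
        scalar Lattice (augment n (proj n (μ + 1) r)) +
          scalar Lattice (augment n (proj n (μ + 1) s)) := by
      rw [map_add, map_add]
      exact AddMonoidAlgebra.single_add ..
    refine ⟨a + a', b + b', ?_⟩
    rw [hsc, map_add, map_add, map_add, map_add]
    linear_combination h + h'
  | single g c =>
    obtain ⟨a, ha⟩ := dd_dvd_one_sub_mono (n := n) μ (g μ)
    obtain ⟨b, hb⟩ := dd_dvd_one_sub_mono (n := n) (μ + 1) (g (μ + 1))
    obtain ⟨d, hd⟩ := dd_dvd_one_sub_mono (n := n) (μ + 2) (g (μ + 2))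
    have hs : ∀ h : Lattice, (AddMonoidAlgebra.single h c : R n) =
        scalar Lattice c * mono n h := by
      intro h
      rw [scalar, mono, AddMonoidAlgebra.single_mul_single, zero_add, mul_one]
    have hg : mono n g = mono n (Pi.single μ (g μ) : Lattice) *
        mono n (Pi.single (μ + 1) (g (μ + 1)) : Lattice) *
        mono n (Pi.single (μ + 2) (g (μ + 2)) : Lattice) := by
      rw [← mono_add, ← mono_add]
      congr 1
      funext i
      fin_cases μ <;> fin_cases i <;> simp
    rw [proj_single, proj_single, incl_single, incl_single, augment_single, hs, hs, hs, hg, dd₂]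
    set E := mono n (Pi.single μ (g μ) : Lattice)
    set F := mono n (Pi.single (μ + 1) (g (μ + 1)) : Lattice)
    set H := mono n (Pi.single (μ + 2) (g (μ + 2)) : Lattice)
    -- With `g = E F H` the difference is `c` times `EFH - F - H + 1 = -(1 - E) F H + (1 - F)(1 -
    -- H)`, and each `1 - μ^k` is a multiple of `d_μ`.
    refine ⟨-scalar Lattice c * a * F * H, scalar Lattice c * b * d, ?_⟩
    linear_combination (-scalar Lattice c * F * H) * ha + scalar Lattice c * (1 - H) * hb +
      scalar Lattice c * dd n (μ + 1) * b * hd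

/-- The ideal generated by `d_μ` and `d_{νρ}`, the image of one row of the excitation map, is the
intersection of the kernels of the two projections; hence the two projections describe the cokernel
of that row. -/
theorem proj_eq_zero_iff (μ : Fin 3) (r : R n) :
    proj n (μ + 1) r = 0 ∧ proj n (μ + 2) r = 0 ↔
      ∃ a b : R n, dd n μ * a + dd₂ n (μ + 1) (μ + 2) * b = r := by
  constructor
  · rintro ⟨h1, h2⟩
    obtain ⟨a, b, h⟩ := exists_sub_eq μ r
    refine ⟨a, b, ?_⟩
    rw [← h, h1, h2]
    simp [scalar]
  · rintro ⟨a, b, rfl⟩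
    rw [dd₂, map_add, map_add, map_mul, map_mul, map_mul, map_mul, map_mul, map_mul,
      proj_dd_of_ne (fin_three_add_one_ne μ), proj_dd_of_ne (fin_three_add_two_ne μ),
      proj_dd_of_ne (fin_three_add_one_ne_add_two μ),
      proj_dd_of_ne (fin_three_add_one_ne_add_two μ).symm]
    simp

/-- Two Laurent polynomials with a common augmentation glue: add their inclusions and subtract the
part counted twice. -/
theorem exists_proj_eq (μ : Fin 3) {a b : LaurentPolynomial (ZMod n)}
    (h : augment n a = augment n b) :
    ∃ r : R n, proj n (μ + 1) r = a ∧ proj n (μ + 2) r = b := by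
  refine ⟨incl n (μ + 1) a + incl n (μ + 2) b - scalar Lattice (augment n a), ?_, ?_⟩
  · rw [map_sub, map_add, proj_incl, proj_incl_of_ne n (fin_three_add_one_ne_add_two μ), proj_scalar,
      h, add_sub_cancel_right]
  · rw [map_sub, map_add, proj_incl, proj_incl_of_ne n (fin_three_add_one_ne_add_two μ).symm,
      proj_scalar, add_sub_cancel_left]

theorem anisotropicCode_mulVec (μ : Fin 3) (s : Fin 2 ⊕ Fin 2 → R n) :
    (anisotropicCode n μ).mulVec s =
      ![dd n μ * (-s (.inr 0)) + dd₂ n (μ + 1) (μ + 2) * s (.inr 1),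
        antipode (dd n μ * antipode (-s (.inl 1)) +
          dd₂ n (μ + 1) (μ + 2) * antipode (-s (.inl 0)))] := by
  funext i
  fin_cases i <;> simp [anisotropicCode, Matrix.mulVec, dotProduct, Fin.sum_univ_two] <;> ring

theorem stabilizerMap_anisotropicCode (μ : Fin 3) (w : Fin 2 → R n) :
    (stabilizerMap (anisotropicCode n μ)).mulVec w =
      Sum.elim ![-antipode (dd n μ) * w 0, antipode (dd₂ n (μ + 1) (μ + 2)) * w 0]
        ![dd₂ n (μ + 1) (μ + 2) * w 1, dd n μ * w 1] := by
  funext i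
  rcases i with i | i <;> fin_cases i <;>
    simp [stabilizerMap_mulVec_inl, stabilizerMap_mulVec_inr, anisotropicCode]

/-- The superselection sector of an excitation pattern of the anisotropic code. -/
noncomputable def anisotropicCharge (μ : Fin 3) :
    (Fin 2 → R n) →ₗ[R n] (anisotropicData n μ).sectors where
  toFun x := ⟨fun i => match i.2 with
    | .e => proj n ((anisotropicData n μ).dir i) (x 0)
    | .m => (if i.1 = 0 then -1 else 1) * proj n ((anisotropicData n μ).dir i) (x 1), by
    refine (anisotropic_mem_sectors_iff n μ _).2 ⟨PlaneChargeData.augment_proj _ _ _, ?_⟩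
    change augment n (-1 * proj n (μ + 1) (x 1)) + augment n (1 * proj n (μ + 2) (x 1)) = 0
    rw [map_mul, map_mul, PlaneChargeData.augment_proj (μ + 2) (μ + 1), map_neg, map_one]
    ring⟩
  map_add' x y := by
    refine Subtype.ext (funext fun i => ?_)
    rcases i with ⟨k, _ | _⟩
    · exact map_add (proj n _) (x 0) (y 0)
    · exact (congrArg _ (map_add (proj n _) (x 1) (y 1))).trans (mul_add ..)
  map_smul' r x := by
    refine Subtype.ext (funext fun i => ?_)
    rcases i with ⟨k, _ | _⟩
    · exact map_mul (proj n _) r (x 0)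
    · exact (congrArg _ (map_mul (proj n _) r (x 1))).trans (mul_left_comm ..)

theorem anisotropicCharge_eq_zero_iff (μ : Fin 3) (x : Fin 2 → R n) :
    anisotropicCharge μ x = 0 ↔
      (proj n (μ + 1) (x 0) = 0 ∧ proj n (μ + 2) (x 0) = 0) ∧
        proj n (μ + 1) (x 1) = 0 ∧ proj n (μ + 2) (x 1) = 0 := by
  have h : anisotropicCharge μ x = 0 ↔ ∀ i, (anisotropicCharge μ x).1 i = 0 :=
    Subtype.ext_iff.trans funext_iff
  have h2 : ∀ f : Fin 2 × Sector → Prop, (∀ i, f i) ↔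
      (f (0, .e) ∧ f (1, .e)) ∧ f (0, .m) ∧ f (1, .m) := by
    intro f
    refine ⟨fun hf => ⟨⟨hf _, hf _⟩, hf _, hf _⟩, ?_⟩
    rintro ⟨⟨h1, h2⟩, h3, h4⟩ ⟨k, s⟩
    fin_cases k <;> cases s <;> assumption
  rw [h, h2]
  refine and_congr Iff.rfl (and_congr ?_ ?_)
  · change -1 * proj n (μ + 1) (x 1) = 0 ↔ _
    rw [neg_one_mul, neg_eq_zero]
  · change 1 * proj n (μ + 2) (x 1) = 0 ↔ _
    rw [one_mul]

/-- The first row only involves `X`-operators and is covered by `proj_eq_zero_iff`; the second only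
involves `Z`-operators and is the same up to the antipode. -/
theorem ker_anisotropicCharge (μ : Fin 3) : LinearMap.ker (anisotropicCharge (n := n) μ) =
    LinearMap.range (anisotropicCode n μ).mulVecLin := by
  ext x
  have h : proj n (μ + 1) (x 1) = 0 ∧ proj n (μ + 2) (x 1) = 0 ↔
      proj n (μ + 1) (antipode (x 1)) = 0 ∧ proj n (μ + 2) (antipode (x 1)) = 0 := by
    have hz : ∀ f : LaurentPolynomial (ZMod n), antipode (n := n) (G := ℤ) f = 0 ↔ f = 0 := by
      intro f
      refine ⟨fun hf => ?_, fun hf => by rw [hf, map_zero]⟩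
      rw [← antipode_antipode f, hf, map_zero]
    rw [proj_antipode, proj_antipode, hz, hz]
  rw [LinearMap.mem_ker, anisotropicCharge_eq_zero_iff, h, proj_eq_zero_iff, proj_eq_zero_iff,
    LinearMap.mem_range]
  constructor
  · rintro ⟨⟨a, b, h0⟩, a', b', h1⟩
    refine ⟨Sum.elim ![-antipode b', -antipode a'] ![-a, b], ?_⟩
    rw [Matrix.mulVecLin_apply, anisotropicCode_mulVec]
    funext i
    fin_cases i
    · simpa using h0
    · have := congrArg antipode h1
      simpa using this
  · rintro ⟨s, rfl⟩
    rw [Matrix.mulVecLin_apply, anisotropicCode_mulVec]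
    refine ⟨⟨_, _, rfl⟩, _, _, (antipode_antipode _).symm⟩

theorem surjective_anisotropicCharge (μ : Fin 3) :
    Function.Surjective (anisotropicCharge (n := n) μ) := by
  intro y
  obtain ⟨he, hm⟩ := (anisotropic_mem_sectors_iff n μ y.1).1 y.2
  obtain ⟨r, hr1, hr2⟩ := exists_proj_eq μ he
  obtain ⟨t, ht1, ht2⟩ := exists_proj_eq μ (a := -y.1 (0, .m)) (b := y.1 (1, .m)) (by
    rw [map_neg]
    exact neg_eq_of_add_eq_zero_right hm)
  refine ⟨![r, t], Subtype.ext (funext ?_)⟩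
  rintro ⟨k, s⟩
  fin_cases k <;> cases s
  · exact hr1
  · change -1 * proj n (μ + 1) t = _
    rw [ht1, neg_one_mul, neg_neg]
    rfl
  · exact hr2
  · change 1 * proj n (μ + 2) t = _
    rw [ht2, one_mul]
    rfl

/-- The planon is moved along `μ + 2` by the column with `d_{νρ}`, whose extra factor `d_{μ+1}` is
already in the charge, and along `μ` by the column with `d_μ`. The monomials in the `Z`-part convert
`1 - t⁻¹` into `t - 1`. -/
theorem isLoop_anisotropic_add_one (μ : Fin 3) (a b : R n) :
    IsLoop (anisotropicCode n μ) (μ + 1) ![a * dd n (μ + 1), b * antipode (dd n (μ + 1))]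
      ![-(var n (μ + 2) * var n μ * b), -a] := by
  refine ⟨Sum.elim ![-(var n (μ + 2) * b), 0] ![0, -a],
    Sum.elim ![0, -(var n μ * antipode (dd n (μ + 1)) * b)] ![a * dd n (μ + 1), 0], ?_, ?_, ?_⟩
  · rw [anisotropicCode_mulVec, fin_three_add_one_one]
    have h := var_mul_varInv n (μ + 2)
    funext i
    fin_cases i
    · simp [dd₂, dd]
      ring
    · simp [dd₂, dd]
      linear_combination (varInv n (μ + 1) - 1) * b * h
  · rw [anisotropicCode_mulVec, fin_three_add_one_two]
    have h := var_mul_varInv n μ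
    funext i
    fin_cases i
    · simp [dd₂, dd]
      ring
    · simp [dd₂, dd]
      linear_combination (varInv n (μ + 1) - 1) * b * h
  · rw [stabilizerMap_anisotropicCode, fin_three_add_one_one, fin_three_add_one_two]
    have h := var_mul_varInv n μ
    have h' := var_mul_varInv n (μ + 2)
    funext i
    rcases i with i | i <;> fin_cases i <;> simp [dd₂, dd]
    · linear_combination -var n (μ + 2) * b * h
    · linear_combination -var n μ * b * (1 - varInv n (μ + 1)) * h'
    · ring

theorem isLoop_anisotropic_add_two (μ : Fin 3) (a b : R n) :
    IsLoop (anisotropicCode n μ) (μ + 2) ![a * dd n (μ + 2), b * antipode (dd n (μ + 2))]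
      ![var n (μ + 1) * var n μ * b, a] := by
  refine ⟨Sum.elim ![0, -(var n μ * antipode (dd n (μ + 2)) * b)] ![a * dd n (μ + 2), 0],
    Sum.elim ![-(var n (μ + 1) * b), 0] ![0, -a], ?_, ?_, ?_⟩
  · rw [anisotropicCode_mulVec, fin_three_add_two_one]
    have h := var_mul_varInv n μ
    funext i
    fin_cases i
    · simp [dd₂, dd]
      ring
    · simp [dd₂, dd]
      linear_combination (varInv n (μ + 2) - 1) * b * h
  · rw [anisotropicCode_mulVec, fin_three_add_two_two]
    have h := var_mul_varInv n (μ + 1)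
    funext i
    fin_cases i
    · simp [dd₂, dd]
      ring
    · simp [dd₂, dd]
      linear_combination (varInv n (μ + 2) - 1) * b * h
  · rw [stabilizerMap_anisotropicCode, fin_three_add_two_one, fin_three_add_two_two]
    have h := var_mul_varInv n μ
    have h' := var_mul_varInv n (μ + 1)
    funext i
    rcases i with i | i <;> fin_cases i <;> simp [dd₂, dd]
    · linear_combination -var n (μ + 1) * b * h
    · linear_combination var n μ * b * (1 - varInv n (μ + 2)) * h'
    · ring

/-- A vanishing projection forces augmentation zero in the other direction, hence divisibility
there. The standard planon with that quotient has the same two projections as `r`, so both define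
the same sector. -/
theorem exists_quotient_of_proj_eq_zero {ν κ : Fin 3} (h : κ ≠ ν) {d : LaurentPolynomial (ZMod n)}
    (hd : IsDivisor d) {r : R n} (hr : proj n κ r = 0) : ∃ a : LaurentPolynomial (ZMod n),
      proj n ν r = a * d ∧ proj n ν (r - incl n ν a * incl n ν d) = 0 ∧
        proj n κ (r - incl n ν a * incl n ν d) = 0 := by
  obtain ⟨a, ha⟩ := hd.exists_mul (proj n ν r) (by
    rw [PlaneChargeData.augment_proj ν κ, hr, map_zero])
  refine ⟨a, ha, ?_, ?_⟩
  · rw [map_sub, map_mul, proj_incl, proj_incl, ha, sub_self]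
  · rw [map_sub, map_mul, proj_incl_of_ne n h d, hr, hd.augment_eq]
    simp [scalar]

theorem fin_three_cases (μ ν : Fin 3) : ν = μ ∨ ν = μ + 1 ∨ ν = μ + 2 := by
  revert μ ν
  decide

/-- Every planar excitation pattern is reduced, modulo the range of the excitation map, to one of
the two explicit planons, whose loop is known. -/
theorem realizes_anisotropic (μ : Fin 3) : Realizes (anisotropicCode n μ)
    (fun ν => {p : (anisotropicData n μ).sectors |
      ∀ i, (anisotropicData n μ).dir i ≠ ν → p.1 i = 0})
    (fun ν p x => (anisotropicData n μ).pairing ν p.1 x.1) := by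
  refine ⟨anisotropicCharge μ, surjective_anisotropicCharge μ, ker_anisotropicCharge μ, ?_⟩
  intro ν e he
  have h12 := fin_three_add_one_ne_add_two μ
  have hdir0 : ∀ s, (anisotropicData n μ).dir (0, s) = μ + 1 := fun _ => rfl
  have hdir1 : ∀ s, (anisotropicData n μ).dir (1, s) = μ + 2 := fun _ => rfl
  have hsub : ∀ e' : Fin 2 → R n, ((proj n (μ + 1) (e 0 - e' 0) = 0 ∧
      proj n (μ + 2) (e 0 - e' 0) = 0) ∧ proj n (μ + 1) (e 1 - e' 1) = 0 ∧
        proj n (μ + 2) (e 1 - e' 1) = 0) →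
      e - e' ∈ LinearMap.range (anisotropicCode n μ).mulVecLin := by
    intro e' h
    rw [← ker_anisotropicCharge, LinearMap.mem_ker, anisotropicCharge_eq_zero_iff]
    exact h
  have he0 : μ + 1 ≠ ν → proj n (μ + 1) (e 0) = 0 ∧ proj n (μ + 1) (e 1) = 0 := by
    intro h
    have hm : -1 * proj n (μ + 1) (e 1) = 0 := he (0, .m) h
    rw [neg_one_mul, neg_eq_zero] at hm
    exact ⟨he (0, .e) h, hm⟩
  have he1 : μ + 2 ≠ ν → proj n (μ + 2) (e 0) = 0 ∧ proj n (μ + 2) (e 1) = 0 := by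
    intro h
    have hm : 1 * proj n (μ + 2) (e 1) = 0 := he (1, .m) h
    rw [one_mul] at hm
    exact ⟨he (1, .e) h, hm⟩
  rcases fin_three_cases μ ν with rfl | rfl | rfl
  -- No generator has direction `μ` itself, so the sector is trivial, and so are its loop and its
  -- phases.
  · refine ⟨0, ?_, fun x => ?_⟩
    · have h0 := he0 (fin_three_add_one_ne ν)
      have h1 := he1 (fin_three_add_two_ne ν)
      have h := hsub 0 (by
        simp only [Pi.zero_apply, sub_zero]
        exact ⟨⟨h0.1, h1.1⟩, h0.2, h1.2⟩)
      rw [sub_zero] at h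
      obtain ⟨r, rfl⟩ := h
      exact isLoop_of_range r
    · beta_reduce
      rw [loopPhase_zero, (isPaired_anisotropicData n ν).pairing_eq]
      refine Finset.sum_eq_zero fun i _ => if_neg ?_
      change (if i.1 = 0 then ν + 1 else ν + 2) ≠ ν
      split_ifs
      exacts [fin_three_add_one_ne ν, fin_three_add_two_ne ν]
  · obtain ⟨h0, h1⟩ := he1 h12.symm
    obtain ⟨a, ha, ha1, ha2⟩ :=
      exists_quotient_of_proj_eq_zero h12.symm (Or.inl rfl : IsDivisor (delta n)) h0
    obtain ⟨b, hb, hb1, hb2⟩ :=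
      exists_quotient_of_proj_eq_zero h12.symm (Or.inr rfl : IsDivisor (deltaBar n)) h1
    rw [incl_delta] at ha1 ha2
    rw [incl_deltaBar] at hb1 hb2
    refine ⟨_, (isLoop_anisotropic_add_one μ (incl n (μ + 1) a) (incl n (μ + 1) b)).of_sub_mem_range
      (hsub _ ⟨⟨ha1, ha2⟩, hb1, hb2⟩), fun x => ?_⟩
    beta_reduce
    -- The quotient is `-b` because `anisotropicCharge` puts a sign on the `m`-coordinate of branch
    -- `0`; branch `1` below has no sign.
    rw [(isPaired_anisotropicData n μ).pairing_of_quotient (a := fun i => match i.2 with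
      | .e => a
      | .m => -b)]
    · rw [Fintype.sum_prod_type, Fin.sum_univ_two, sum_sector, sum_sector]
      simp only [hdir0, hdir1, if_true, if_neg h12.symm, add_zero]
      change a * _ * antipode (n := n) (G := ℤ) (-1 * proj n (μ + 1) (x 1)) +
        -b * _ * antipode (n := n) (G := ℤ) (proj n (μ + 1) (x 0)) = _
      simp [loopPhase, proj_antipode, proj_var_of_ne h12,
        proj_var_of_ne (fin_three_add_one_ne μ)]
      ring
    · rintro ⟨k, s⟩ hi
      obtain rfl : k = 0 := by
        by_contra hk
        exact h12.symm ((if_neg hk).symm.trans hi)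
      cases s
      · exact ha
      · change -1 * proj n (μ + 1) (e 1) = -b * deltaBar n
        rw [hb]
        ring
  · obtain ⟨h0, h1⟩ := he0 h12
    obtain ⟨a, ha, ha1, ha2⟩ :=
      exists_quotient_of_proj_eq_zero h12 (Or.inl rfl : IsDivisor (delta n)) h0
    obtain ⟨b, hb, hb1, hb2⟩ :=
      exists_quotient_of_proj_eq_zero h12 (Or.inr rfl : IsDivisor (deltaBar n)) h1
    rw [incl_delta] at ha1 ha2
    rw [incl_deltaBar] at hb1 hb2
    refine ⟨_, (isLoop_anisotropic_add_two μ (incl n (μ + 2) a) (incl n (μ + 2) b)).of_sub_mem_range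
      (hsub _ ⟨⟨ha2, ha1⟩, hb2, hb1⟩), fun x => ?_⟩
    beta_reduce
    rw [(isPaired_anisotropicData n μ).pairing_of_quotient (a := fun i => match i.2 with
      | .e => a
      | .m => b)]
    · rw [Fintype.sum_prod_type, Fin.sum_univ_two, sum_sector, sum_sector]
      simp only [hdir0, hdir1, if_true, if_neg h12, zero_add]
      change a * _ * antipode (n := n) (G := ℤ) (1 * proj n (μ + 2) (x 1)) +
        b * _ * antipode (n := n) (G := ℤ) (proj n (μ + 2) (x 0)) = _
      simp [loopPhase, proj_antipode, proj_var_of_ne h12.symm,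
        proj_var_of_ne (fin_three_add_two_ne μ)]
      ring
    · rintro ⟨k, s⟩ hi
      obtain rfl : k = 1 := by
        by_contra hk
        have hk0 : k = 0 := by omega
        exact h12 ((if_pos hk0).symm.trans hi)
      cases s
      · exact ha
      · change 1 * proj n (μ + 2) (e 1) = b * deltaBar n
        rw [hb, one_mul]

theorem isTheoryOf_anisotropic (μ : Fin 3) :
    (anisotropicTheory n μ).IsTheoryOf (anisotropicCode n μ) :=
  (realizes_anisotropic μ).isTheoryOf

end Anisotropic

/-! ### The checkerboard code, by transport from the decoupled code. -/

section Checkerboard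

variable {n : ℕ}

/-- A code with trivial cokernel, such as an ancilla, contributes one sector and no statistics. -/
theorem realizes_of_surjective {κ ι : Type} [Fintype ι] [Fintype κ] [DecidableEq ι]
    [DecidableEq κ] {ε : Matrix κ (ι ⊕ ι) (R n)} (h : Function.Surjective ε.mulVec) :
    Realizes ε (fun _ => (Set.univ : Set Unit)) (fun _ _ _ => 0) := by
  refine ⟨0, fun _ => ⟨0, rfl⟩, ?_, fun ν e _ => ?_⟩
  · rw [LinearMap.ker_zero]
    exact (LinearMap.range_eq_top.2 h).symm
  · obtain ⟨r, rfl⟩ := h e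
    exact ⟨0, isLoop_of_range r, fun x => (loopPhase_zero x).symm⟩

theorem surjective_ancillaX : Function.Surjective (ancillaX n).mulVec := by
  intro x
  refine ⟨Sum.elim (-x) 0, ?_⟩
  funext i
  fin_cases i
  simp [ancillaX, Matrix.mulVec, dotProduct]

theorem surjective_ancillaZ : Function.Surjective (ancillaZ n).mulVec := by
  intro x
  refine ⟨Sum.elim 0 x, ?_⟩
  funext i
  fin_cases i
  simp [ancillaZ, Matrix.mulVec, dotProduct]

theorem toAnisotropicQ_eq_zero {μ ν : Fin 3} {p : (checkerboardData n).Q}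
    (hp : ∀ i, (checkerboardData n).dir i ≠ ν → p i = 0) (i : Fin 2 × Sector)
    (hi : (anisotropicData n μ).dir i ≠ ν) : toAnisotropicQ n μ p i = 0 := by
  have h : ∀ k s, p ((anisotropicData n μ).dir i, k, s) = 0 := fun k s => hp _ hi
  rcases i with ⟨k, _ | _⟩
  · simp [toAnisotropicQ, h]
  · simp [toAnisotropicQ, h]

/-- The superselection sectors of the decoupled code are those of the checkerboard theory. -/
noncomputable def decoupledEquiv (hn : Odd n) : (checkerboardData n).sectors ≃ₗ[R n]
    (Unit × Unit) × ((anisotropicData n 0).sectors ×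
      ((anisotropicData n 1).sectors × (anisotropicData n 2).sectors)) :=
  (anisotropicEquiv hn).trans
    { toFun := fun y => (((), ()), y.1.1, y.1.2, y.2)
      invFun := fun y => ((y.2.1, y.2.2.1), y.2.2.2)
      map_add' := fun _ _ => rfl
      map_smul' := fun _ _ => rfl
      left_inv := fun _ => rfl
      right_inv := fun _ => rfl }

/-- The decoupled code is described by stacking, the decoupling circuit carries this description to
the checkerboard code, and the isomorphism of p-theories replaces the stacked sectors and pairings
by the checkerboard ones. -/
theorem realizes_checkerboard (hn : Odd n) : Realizes (checkerboardCode n)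
    (fun ν => {p : (checkerboardData n).sectors |
      ∀ i, (checkerboardData n).dir i ≠ ν → p.1 i = 0})
    (fun ν p x => (checkerboardData n).pairing ν p.1 x.1) := by
  have h := ((realizes_of_surjective (surjective_ancillaX (n := n))).stack
    (realizes_of_surjective (surjective_ancillaZ (n := n)))).stack
      ((realizes_anisotropic 0).stack
        ((realizes_anisotropic 1).stack (realizes_anisotropic 2)))
  change Realizes (decoupledCode n) _ _ at h
  rw [← decoupling hn] at h
  refine Realizes.of_transformed (isUnit_decouplingStab hn)
    (isCssCircuit_decouplingCircuit hn).isSymplectic stabLabel quditLabel h (decoupledEquiv hn) ?_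
  intro ν p hp
  refine ⟨⟨⟨trivial, trivial⟩, fun i hi => toAnisotropicQ_eq_zero (μ := 0) hp i hi,
    fun i hi => toAnisotropicQ_eq_zero (μ := 1) hp i hi,
    fun i hi => toAnisotropicQ_eq_zero (μ := 2) hp i hi⟩, fun x => ?_⟩
  refine (sum_pairing_toAnisotropic hn hp x).symm.trans ?_
  rw [add_assoc]
  exact ((add_assoc (0 : LaurentPolynomial (ZMod n)) 0 _).trans
    ((zero_add _).trans (zero_add _))).symm

theorem isTheoryOf_checkerboard (hn : Odd n) :
    (checkerboardTheory n).IsTheoryOf (checkerboardCode n) :=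
  (realizes_checkerboard hn).isTheoryOf

end Checkerboard

end Fracton

theorem mainTheorem8 (n : ℕ) (hn : Odd n) (hn1 : 1 < n) :
    -- the data define p-modular p-theories, namely those of the respective models
    ((checkerboardTheory n).IsPTheory ∧ (checkerboardTheory n).IsPModular ∧
      (checkerboardTheory n).IsTheoryOf (checkerboardCode n)) ∧
    (∀ μ : Fin 3, (anisotropicTheory n μ).IsPTheory ∧ (anisotropicTheory n μ).IsPModular ∧
      (anisotropicTheory n μ).IsTheoryOf (anisotropicCode n μ)) ∧
    -- equivalence of p-theories
    (PTheory.Stackable (anisotropicTheory n 0) (anisotropicTheory n 1) ∧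
      PTheory.Stackable (PTheory.stack (anisotropicTheory n 0) (anisotropicTheory n 1))
        (anisotropicTheory n 2) ∧
      PTheory.Isomorphic (checkerboardTheory n)
        (PTheory.stack (PTheory.stack (anisotropicTheory n 0) (anisotropicTheory n 1))
          (anisotropicTheory n 2))) ∧
    -- the explicit transformation of the excitation map
    IsUnit (uMatrix n) ∧ IsSymplectic (vMatrix n) ∧
    IsElementarySymplectic (vMatrix n * translateQudit n (0 : Fin 8) (![2, 2, 2] : Lattice)) ∧
    uMatrix n * checkerboardCode n * vMatrix n = transformedCode n ∧
    SameUpToLabelsAndSigns (transformedCode n) (decoupledCode n) ∧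
    -- circuit equivalence
    FiniteDepthEquivalent embed (checkerboardCode n) (decoupledCode n) := by
  have : NeZero n := ⟨by omega⟩
  have : Nonempty Sector := ⟨.e⟩
  exact ⟨⟨(isPaired_checkerboardData n).isPTheory, (isPaired_checkerboardData n).isPModular hn1,
      isTheoryOf_checkerboard hn⟩,
    fun μ => ⟨(isPaired_anisotropicData n μ).isPTheory,
      (isPaired_anisotropicData n μ).isPModular hn1, isTheoryOf_anisotropic μ⟩,
    ⟨stackable_anisotropic.1, stackable_anisotropic.2, isomorphic_checkerboard hn hn1⟩,
    isUnit_uMatrix hn, isSymplectic_vMatrix hn,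
    (isCssCircuit_vMatrix_mul_translateQudit hn).isElementarySymplectic,
    uMatrix_mul_checkerboardCode_mul_vMatrix hn, sameUpToLabelsAndSigns_transformedCode n,
    finiteDepthEquivalent_checkerboardCode hn⟩
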